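/- **Network.** Consider a residual network with $L$ blocks, $z^1=x\in\mathbb R^{d_1}$, $\bar z^l=\xi_2^l\odot h^l(z^l)$, $$z^{l+1}=\xi_B^l\,W_2^l\big(\xi_1^l\odot a^l(W_1^l\bar z^l)\big)+W_3^l\bar z^l\quad(l=1,\dots,L),\qquad \hat y=h^{L+1}(z^{L+1}),$$ where $a^l,h^l$ act element-wise and biases are absorbed into $W_1^l,W_3^l$ as a last column (their inputs get a last entry $1$). The entries of $\xi_B^l,\xi_1^l,\xi_2^l$ are independent Bernoulli variables with parameters $\theta_B^l,\theta_1^l,\theta_2^l$, collected in $\Theta$. The data $(x,y)$ have a law $\mu$ (for instance the empirical law of a data set), and $C(W,\Theta)=\mathbb E_{\xi}\,\mathbb E_{(x,y)\sim\mu}[-\log p(y\mid x,W,\xi)]$, where $p$ is either Gaussian with mean $\hat y$ and covariance $vI$, $v>0$, or categorical with logits $\hat y$ (cross-entropy loss). Fix one block $l$ and drop the index $l$ from $W_1,W_2,\theta_B,\theta_1\in\mathbb R^K$. Write $w_{1i}$ and $w_{2i}$ for the fan-in and fan-out weights of unit $i$, $C^{b}$ for $C$ conditioned on $\xi_B=b$,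 and $C^{1}_{1i,c}$ for $C$ conditioned on $\xi_B=1,\ \xi_{1i}=c$. Norms of vectors and matrices are Euclidean/Frobenius norms. **Dynamics.** Let $\lambda>0$, $\nu>0$, $\alpha\ge 0$, $\beta\in[0,1]$, let $f_1,f_2,p_1,p_2\ge 0$, $f_a,F,P>0$ be the constants of the complexity measure, and $$R=\nu\Big(\tfrac{\beta}{F}\big(f_1\|\theta_2^l\|_1+f_a+f_2\|\theta_2^{l+1}\|_1\big)+\tfrac{1-\beta}{P}\big(p_1\|\theta_2^l\|_1+1+p_2\|\theta_2^{l+1}\|_1\big)\Big),$$ where $\theta_2^{L+1}=(1,\dots,1)$. The block evolves by $$\dot w_{1i}=-\theta_B\theta_{1i}\nabla_{w_{1i}}C^1_{1i,1}-\lambda w_{1i},\qquad \dot w_{2i}=-\theta_B\theta_{1i}\nabla_{w_{2i}}C^1_{1i,1}-\lambda w_{2i},$$ $$\dot\theta_{1i}=-G_i-h_{1i},\quad G_i=\theta_B\big[C^1_{1i,1}-C^1_{1i,0}+R\big],\qquad \dot\theta_B=-G_B-h_B,\quad G_B=\big[C^1-C^0+\|\theta_1\|_1R\big]+\nu\alpha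 .$$ The projection term $h$ belonging to a parameter $\theta$ and its $G$ is $-\max(G,0)$ if $\theta=0$, is $\max(-G,0)$ if $\theta=1$, and is $0$ if $0<\theta<1$. The parameters of the rest of the network are arbitrary functions of time $t\ge0$, so that the system is non-autonomous. Solutions are absolutely continuous, have $\theta_B,\theta_{1i}\in[0,1]$, and satisfy the equations for almost every $t$; initial times are $t_0\ge 0$. **Assumptions.** (A1) The weights of the network remain bounded: $\|W_j^k(t)\|\le M$ for all $t\ge 0$; all Bernoulli parameters lie in $[0,1]$. (A2) All activation functions are continuously differentiable with bounded derivative and vanish at $0$. (A3) $\mathbb E\|x\|^k<\infty$ for $k\in\{1,2,3,4\}$ and $\mathbb E\|y\|^k<\infty$ for $k\in\{1,2\}$. Moreover, the right-hand side without the projection terms is piecewise continuous in time and, on the set where $\theta_B,\theta_{1i}\in[0,1]$, locally Lipschitz in $(W_1,W_2,\theta_B,\theta_1)$, uniformly in $t\ge 0$. **Constants.** Let $R_m>0$ be such that $R\ge R_m$ at all times $t\ge 0$. Let $\eta,\kappa>0$ be such that at all times, for all units $i$, all $\theta_B\in[0,1]$, $\theta_1\in[0,1]^K$ and all $W_1,W_2$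 with $\|W_1\|,\|W_2\|\le \frac{R_m}{4(\eta+\kappa)}$, $$|w_{ji}^T\nabla_{w_{ji}}C^1_{1i,1}|\le\eta\|w_{ji}\|\ (j=1,2),\qquad |C^1_{1i,1}-C^1_{1i,0}|\le\kappa(\|w_{1i}\|+\|w_{2i}\|).$$ **Theorem.** Such constants exist: $R\ge\nu\big(f_a\frac{\beta}{F}+\frac{1-\beta}{P}\big)>0$; and for every $R_m>0$ there are $\eta,\kappa>0$ that depend on the parameters of the rest of the network only through the bound $M$, such that these inequalities hold for all $\|W_1\|,\|W_2\|\le\max\{M,\frac{R_m}{4(\eta+\kappa)}\}$. For all such $R_m,\eta,\kappa$, let $\Lambda_B=\frac12(\|W_1\|^2+\|W_2\|^2+\theta_B^2)$ and $$\mathcal D_B=\Big\{(W_1,W_2,\theta_B,\theta_1)\ \Big|\ \theta_B\in[0,1],\ \theta_1\in[0,1]^K,\ \Lambda_B\le\frac12\,\frac{R_m^2}{16(\eta+\kappa)^2}\Big\},$$ $$E_B=\{(W_1,W_2,\theta_B,\theta_1)\in\mathcal D_B\mid W_1=0,\ W_2=0,\ \|\theta_1\|_1\,\theta_B=0\}.$$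 Then $E_B$ is invariant (solutions starting in $E_B$ stay in $E_B$) and stable (for every $\varepsilon>0$ there is $\delta>0$, independent of $t_0$, such that solutions starting at distance less than $\delta$ from $E_B$ stay at distance less than $\varepsilon$ from $E_B$). Moreover $\mathcal D_B$ lies in the region of attraction of $E_B$: from each initial state in $\mathcal D_B$ there is a solution on $[t_0,\infty)$, and every such solution has distance to $E_B$ tending to $0$. -/

import Mathlib

open Set Filter Topology MeasureTheory
open scoped NNReal

noncomputable section

namespace ResPrune

/-- Euclidean space of dimension `n`. -/
abbrev E (n : ℕ) : Type := EuclideanSpace ℝ (Fin n)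

/-- A residual network with `L` blocks, numbered `0, …, L - 1`. Block `l` maps `ℝ^(d l)` to
`ℝ^(d (l+1))` and has `k l` units on its nonlinear path. `a l` and `h l` are the element-wise
activation functions of block `l`, and `h L` is the output activation. -/
structure Net where
  L : ℕ
  d : ℕ → ℕ
  k : ℕ → ℕ
  a : ℕ → ℝ → ℝ
  h : ℕ → ℝ → ℝ

/-- An activation function that is continuously differentiable with bounded derivative and
vanishes at `0`. -/
def GoodActivation (f : ℝ → ℝ) : Prop :=
  ContDiff ℝ 1 f ∧ (∃ B : ℝ, ∀ x, |deriv f x| ≤ B) ∧ f 0 = 0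

/-- Assumption on all the activation functions used in the network. -/
def Net.GoodActivations (N : Net) : Prop :=
  (∀ l < N.L, GoodActivation (N.a l)) ∧ ∀ l ≤ N.L, GoodActivation (N.h l)

/-- All trainable parameters of the network. For block `l`:
`W1 l i` is the row of fan-in weights of unit `i` (its last entry is the bias),
`W2 l i` is the column of fan-out weights of unit `i`,
`W3 l r` is the `r`-th row of the linear path (its last entry is the bias),
and `θB`, `θ1`, `θ2` are the parameters of the Bernoulli variables. -/
structure Params (N : Net) where
  W1 : ∀ l : Fin N.L, Fin (N.k l) → E (N.d l + 1)
  W2 : ∀ l : Fin N.L, Fin (N.k l) → E (N.d (l + 1))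
  W3 : ∀ l : Fin N.L, Fin (N.d (l + 1)) → E (N.d l + 1)
  θB : Fin N.L → ℝ
  θ1 : ∀ l : Fin N.L, Fin (N.k l) → ℝ
  θ2 : ∀ l : Fin N.L, Fin (N.d l) → ℝ

/-- A realization of the binary variables: for each block `(ξ_B, ξ_1, ξ_2)`. -/
abbrev Mask (N : Net) : Type :=
  ∀ l : Fin N.L, Bool × (Fin (N.k l) → Bool) × (Fin (N.d l) → Bool)

/-- A binary variable as a real number. -/
def bit (b : Bool) : ℝ := if b then 1 else 0

/-- Probability of the value `b` under the Bernoulli distribution with parameter `θ`. -/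
def bern (θ : ℝ) (b : Bool) : ℝ := if b then θ else 1 - θ

variable {N : Net}

/-- The product Bernoulli probability of the realization `ξ`. -/
def Params.maskProb (p : Params N) (ξ : Mask N) : ℝ :=
  ∏ l : Fin N.L, (bern (p.θB l) (ξ l).1 * (∏ i, bern (p.θ1 l i) ((ξ l).2.1 i)) *
    ∏ j, bern (p.θ2 l j) ((ξ l).2.2 j))

/-- Product of the row `w`, whose last entry is a bias, with the vector `z` extended by a
last entry `1`. -/
def affine {n : ℕ} (w : E (n + 1)) (z : Fin n → ℝ) : ℝ :=
  (∑ j : Fin n, w j.castSucc * z j) + w (Fin.last n)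

/-- One residual block. -/
def Params.block (p : Params N) (ξ : Mask N) (l : Fin N.L) (z : Fin (N.d l) → ℝ) :
    Fin (N.d (l + 1)) → ℝ :=
  let zbar : Fin (N.d l) → ℝ := fun j => bit ((ξ l).2.2 j) * N.h l (z j)
  fun r =>
    bit (ξ l).1 * (∑ i, p.W2 l i r * (bit ((ξ l).2.1 i) * N.a l (affine (p.W1 l i) zbar)))
      + affine (p.W3 l r) zbar

/-- The features after the first `n` blocks. -/
def Params.features (p : Params N) (ξ : Mask N) (x : E (N.d 0)) :
    (n : ℕ) → n ≤ N.L → Fin (N.d n) → ℝ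
  | 0, _ => fun j => x j
  | n + 1, hn => p.block ξ ⟨n, hn⟩ (p.features ξ x n (Nat.le_of_succ_le hn))

/-- The output of the network. -/
def Params.output (p : Params N) (ξ : Mask N) (x : E (N.d 0)) : Fin (N.d N.L) → ℝ :=
  fun r => N.h N.L (p.features ξ x N.L le_rfl r)

/-- The statistical models for the data: the Gaussian one with variance `v` (regression) and
the categorical one with logits `ŷ`, whose negative log-likelihood is the softmax
cross-entropy (classification). -/
inductive Model where
  | gaussian (v : ℝ≥0) (hv : v ≠ 0)
  | categorical

/-- The likelihood of the target `y` given the network output `ŷ`. -/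
def Model.likelihood (m : Model) {n : ℕ} (yhat : Fin n → ℝ) (y : E n) : ℝ :=
  match m with
  | .gaussian v _ => ∏ r, ProbabilityTheory.gaussianPDFReal (yhat r) v (y r)
  | .categorical => ∏ r, (Real.exp (yhat r) / ∑ s, Real.exp (yhat s)) ^ (y r)

/-- The expected negative log-likelihood `C(W, Θ)`: expectation over the independent Bernoulli
variables and over the law `μ` of the data. -/
def Params.cost (m : Model) (μ : Measure (E (N.d 0) × E (N.d N.L))) (p : Params N) : ℝ :=
  ∑ ξ : Mask N, p.maskProb ξ * ∫ z, -Real.log (m.likelihood (p.output ξ z.1) z.2) ∂μ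

/-- `C^{l,b}`: the cost conditioned on `ξ_B^l = b`. The Bernoulli variables are independent, so
conditioning on a value amounts to making the parameter of that variable degenerate. -/
def Params.costB (m : Model) (μ : Measure (E (N.d 0) × E (N.d N.L))) (p : Params N)
    (l : Fin N.L) (b : Bool) : ℝ :=
  ({ p with θB := Function.update p.θB l (bit b) } : Params N).cost m μ

/-- `C_{1i,c}^{l,1}`: the cost conditioned on `ξ_B^l = 1` and `ξ_{1i}^l = c`. -/
def Params.costU (m : Model) (μ : Measure (E (N.d 0) × E (N.d N.L))) (p : Params N)
    (l : Fin N.L) (i : Fin (N.k l)) (c : Bool) : ℝ :=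
  ({ p with
      θB := Function.update p.θB l 1
      θ1 := Function.update p.θ1 l (Function.update (p.θ1 l) i (bit c)) } : Params N).cost m μ

/-- `∇_{w_{1i}} C_{1i,1}^{l,1}`. -/
def Params.gradW1 (m : Model) (μ : Measure (E (N.d 0) × E (N.d N.L))) (p : Params N)
    (l : Fin N.L) (i : Fin (N.k l)) : E (N.d l + 1) :=
  gradient (fun w : E (N.d l + 1) =>
    ({ p with W1 := Function.update p.W1 l (Function.update (p.W1 l) i w) } :
      Params N).costU m μ l i true) (p.W1 l i)

/-- `∇_{w_{2i}} C_{1i,1}^{l,1}`. -/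
def Params.gradW2 (m : Model) (μ : Measure (E (N.d 0) × E (N.d N.L))) (p : Params N)
    (l : Fin N.L) (i : Fin (N.k l)) : E (N.d (l + 1)) :=
  gradient (fun w : E (N.d (l + 1)) =>
    ({ p with W2 := Function.update p.W2 l (Function.update (p.W2 l) i w) } :
      Params N).costU m μ l i true) (p.W2 l i)

/-- The hyperparameters of the objective, with the constants of the complexity measure for the
block under consideration: `f1, fa, f2` and `p1, p2` are the proportionality factors of the
operation and parameter counts, `F` and `P` the totals for the unreduced network. -/
structure Hyper where
  lam : ℝ
  nu : ℝ
  α : ℝ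
  β : ℝ
  f1 : ℝ
  fa : ℝ
  f2 : ℝ
  p1 : ℝ
  p2 : ℝ
  F : ℝ
  P : ℝ

/-- The ranges of the hyperparameters. -/
structure Hyper.Valid (H : Hyper) : Prop where
  lam_pos : 0 < H.lam
  nu_pos : 0 < H.nu
  α_nonneg : 0 ≤ H.α
  β_mem : H.β ∈ Icc (0 : ℝ) 1
  f1_nonneg : 0 ≤ H.f1
  fa_pos : 0 < H.fa
  f2_nonneg : 0 ≤ H.f2
  p1_nonneg : 0 ≤ H.p1
  p2_nonneg : 0 ≤ H.p2
  F_pos : 0 < H.F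
  P_pos : 0 < H.P

/-- `‖θ_2^n‖_1`, where the parameters that belong to the network output are fixed to `1`. -/
def Params.θ2Norm (p : Params N) (n : ℕ) : ℝ :=
  if hn : n < N.L then ∑ j, |p.θ2 ⟨n, hn⟩ j| else N.d n

/-- The effective regularization `R = ν ∂²J_FP / ∂θ_B ∂θ_{1i}` in block `l`. -/
def Params.R (H : Hyper) (p : Params N) (l : Fin N.L) : ℝ :=
  H.nu * (H.β / H.F * (H.f1 * p.θ2Norm l + H.fa + H.f2 * p.θ2Norm (l + 1))
    + (1 - H.β) / H.P * (H.p1 * p.θ2Norm l + 1 + H.p2 * p.θ2Norm (l + 1)))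

/-- The Frobenius norm of a matrix given by its rows (or by its columns). -/
def frob {ι : Type*} [Fintype ι] {n : ℕ} (W : ι → E n) : ℝ := √(∑ i, ‖W i‖ ^ 2)

/-- The weights are bounded by `M`, and the Bernoulli parameters lie in the unit cube. -/
structure Params.BoundedBy (p : Params N) (M : ℝ) : Prop where
  W1_le : ∀ l, frob (p.W1 l) ≤ M
  W2_le : ∀ l, frob (p.W2 l) ≤ M
  W3_le : ∀ l, frob (p.W3 l) ≤ M
  θB_mem : ∀ l, p.θB l ∈ Icc (0 : ℝ) 1
  θ1_mem : ∀ l i, p.θ1 l i ∈ Icc (0 : ℝ) 1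
  θ2_mem : ∀ l j, p.θ2 l j ∈ Icc (0 : ℝ) 1

/-- The moment assumption on the law of the data. -/
def DataMoments {m n : ℕ} (μ : Measure (E m × E n)) : Prop :=
  (∀ k ∈ Finset.Icc 1 4, Integrable (fun z => ‖z.1‖ ^ k) μ) ∧
    ∀ k ∈ Finset.Icc 1 2, Integrable (fun z => ‖z.2‖ ^ k) μ

/-- The state `(W_1, W_2, θ_B, θ_1)` of the subsystem of block `l`. (It carries the maximum of
the norms of its entries, which is equivalent to the Euclidean norm.) -/
abbrev State (N : Net) (l : Fin N.L) : Type :=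
  (Fin (N.k l) → E (N.d l + 1)) × (Fin (N.k l) → E (N.d (l + 1))) × ℝ × (Fin (N.k l) → ℝ)

variable {l : Fin N.L}

/-- The weights `W_1`, given by the fan-in weights of the units. -/
def w1 (s : State N l) : Fin (N.k l) → E (N.d l + 1) := s.1

/-- The weights `W_2`, given by the fan-out weights of the units. -/
def w2 (s : State N l) : Fin (N.k l) → E (N.d (l + 1)) := s.2.1

/-- The layer parameter. -/
def tB (s : State N l) : ℝ := s.2.2.1

/-- The unit parameters. -/
def t1 (s : State N l) : Fin (N.k l) → ℝ := s.2.2.2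

/-- The states with all Bernoulli parameters in `[0, 1]`. -/
def box (N : Net) (l : Fin N.L) : Set (State N l) :=
  {s | tB s ∈ Icc (0 : ℝ) 1 ∧ ∀ i, t1 s i ∈ Icc (0 : ℝ) 1}

/-- The parameters of the network in which block `l` is in state `s`, while everything else
is as in `p`. -/
def Params.withBlock (p : Params N) (s : State N l) : Params N :=
  { p with
    W1 := Function.update p.W1 l (w1 s)
    W2 := Function.update p.W2 l (w2 s)
    θB := Function.update p.θB l (tB s)
    θ1 := Function.update p.θ1 l (t1 s) }

/-- `∂L/∂θ_B`, for the parameters `p` of the whole network. -/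
def lossB (m : Model) (μ : Measure (E (N.d 0) × E (N.d N.L))) (H : Hyper) (p : Params N)
    (l : Fin N.L) : ℝ :=
  (p.costB m μ l true - p.costB m μ l false + (∑ i, |p.θ1 l i|) * p.R H l) + H.nu * H.α

/-- `∂L/∂θ_{1i}`, for the parameters `p` of the whole network. -/
def lossU (m : Model) (μ : Measure (E (N.d 0) × E (N.d N.L))) (H : Hyper) (p : Params N)
    (l : Fin N.L) (i : Fin (N.k l)) : ℝ :=
  p.θB l * (p.costU m μ l i true - p.costU m μ l i false + p.R H l)

/-- The projection term `h` that keeps `θ` in `[0, 1]`, where `g` is the partial derivative of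
the loss with respect to `θ`. -/
def projTerm (θ g : ℝ) : ℝ :=
  if θ = 0 then -max g 0 else if θ = 1 then max (-g) 0 else 0

/-- The right-hand side for the block without the projection terms, when the rest of the
network is as in `p`. -/
def freeField (m : Model) (μ : Measure (E (N.d 0) × E (N.d N.L))) (H : Hyper) (p : Params N)
    (s : State N l) : State N l :=
  let q := p.withBlock s
  (fun i => -(tB s * t1 s i) • q.gradW1 m μ l i - H.lam • w1 s i,
    fun i => -(tB s * t1 s i) • q.gradW2 m μ l i - H.lam • w2 s i,
    -lossB m μ H q l,
    fun i => -lossU m μ H q l i)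

/-- The right-hand side of the projected dynamical system of the block. -/
def field (m : Model) (μ : Measure (E (N.d 0) × E (N.d N.L))) (H : Hyper) (p : Params N)
    (s : State N l) : State N l :=
  let q := p.withBlock s
  (fun i => -(tB s * t1 s i) • q.gradW1 m μ l i - H.lam • w1 s i,
    fun i => -(tB s * t1 s i) • q.gradW2 m μ l i - H.lam • w2 s i,
    -lossB m μ H q l - projTerm (tB s) (lossB m μ H q l),
    fun i => -lossU m μ H q l i - projTerm (t1 s i) (lossU m μ H q l i))

/-- `x` is a (Carathéodory) solution on `[t₀, T]` of `ẋ = f(t, x)` with values in `B`: it is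
absolutely continuous and satisfies the equation almost everywhere, in integrated form. -/
def IsSolutionOn {X : Type*} [NormedAddCommGroup X] [NormedSpace ℝ X] (f : ℝ → X → X)
    (B : Set X) (x : ℝ → X) (t₀ T : ℝ) : Prop :=
  (∀ t ∈ Icc t₀ T, x t ∈ B) ∧
    IntervalIntegrable (fun s => f s (x s)) volume t₀ T ∧
    ∀ t ∈ Icc t₀ T, x t = x t₀ + ∫ s in t₀..t, f s (x s)

/-- `f` is piecewise continuous on `[0, ∞)`: on every bounded interval it is continuous except
for at most finitely many jumps. -/
def PiecewiseContinuous {X : Type*} [TopologicalSpace X] (f : ℝ → X) : Prop :=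
  ∀ T : ℝ, ∃ S : Finset ℝ,
    (∀ t ∈ Icc 0 T, t ∉ S → ContinuousWithinAt f (Ici 0) t) ∧
    ∀ t ∈ S, (0 ≤ t → ∃ a, Tendsto f (𝓝[>] t) (𝓝 a)) ∧
      (0 < t → ∃ b, Tendsto f (𝓝[<] t) (𝓝 b))

/-- `f` is locally Lipschitz in the state on `B`, uniformly in time `t ≥ 0`. -/
def LocallyLipschitzUniformly {X : Type*} [PseudoEMetricSpace X] (f : ℝ → X → X)
    (B : Set X) : Prop :=
  ∀ s ∈ B, ∃ U ∈ 𝓝 s, ∃ K : ℝ≥0, ∀ t, 0 ≤ t → LipschitzOnWith K (f t) (U ∩ B)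

/-- The constants `η`, `κ`: the bounds (a) on `|w_{ji}ᵀ ∇_{w_{ji}} C_{1i,1}^{l,1}|`, `j = 1, 2`,
and (b) on `|C_{1i,1}^{l,1} - C_{1i,0}^{l,1}|`, for all weights `W_1`, `W_2` of block `l` with norm at
most `r` and all of its Bernoulli parameters, when the rest of the network is as in `p`. -/
def SensitivityBounds (m : Model) (μ : Measure (E (N.d 0) × E (N.d N.L))) (p : Params N)
    (l : Fin N.L) (r η κ : ℝ) : Prop :=
  ∀ s ∈ box N l, frob (w1 s) ≤ r → frob (w2 s) ≤ r → ∀ i,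
    |inner ℝ (w1 s i) ((p.withBlock s).gradW1 m μ l i)| ≤ η * ‖w1 s i‖ ∧
    |inner ℝ (w2 s i) ((p.withBlock s).gradW2 m μ l i)| ≤ η * ‖w2 s i‖ ∧
    |(p.withBlock s).costU m μ l i true - (p.withBlock s).costU m μ l i false|
      ≤ κ * (‖w1 s i‖ + ‖w2 s i‖)

/-- The Lyapunov function `Λ_B = (‖W_1‖² + ‖W_2‖² + θ_B²) / 2`. -/
def lyap (s : State N l) : ℝ := 1 / 2 * (frob (w1 s) ^ 2 + frob (w2 s) ^ 2 + tB s ^ 2)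

/-- The set `D_B`. -/
def DB (N : Net) (l : Fin N.L) (Rm η κ : ℝ) : Set (State N l) :=
  {s | s ∈ box N l ∧ lyap s ≤ 1 / 2 * (Rm ^ 2 / (16 * (η + κ) ^ 2))}

/-- The set `E_B`. -/
def EB (N : Net) (l : Fin N.L) (Rm η κ : ℝ) : Set (State N l) :=
  {s | s ∈ DB N l Rm η κ ∧ w1 s = 0 ∧ w2 s = 0 ∧ (∑ i, |t1 s i|) * tB s = 0}

/-- Solutions that start in `S` at some time `t₀ ≥ 0` stay in `S`. -/
def Invariant {X : Type*} [NormedAddCommGroup X] [NormedSpace ℝ X] (f : ℝ → X → X)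
    (B S : Set X) : Prop :=
  ∀ (t₀ T : ℝ) (x : ℝ → X), 0 ≤ t₀ → IsSolutionOn f B x t₀ T → x t₀ ∈ S →
    ∀ t ∈ Icc t₀ T, x t ∈ S

/-- Lyapunov stability of the set `S`, uniformly in the initial time. -/
def Stable {X : Type*} [NormedAddCommGroup X] [NormedSpace ℝ X] (f : ℝ → X → X)
    (B S : Set X) : Prop :=
  ∀ ε > 0, ∃ δ > 0, ∀ (t₀ T : ℝ) (x : ℝ → X), 0 ≤ t₀ → IsSolutionOn f B x t₀ T →
    Metric.infDist (x t₀) S < δ → ∀ t ∈ Icc t₀ T, Metric.infDist (x t) S < ε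

/-- `A` lies in the region of attraction of `S`: from each initial state in `A`, at each initial
time, there is a solution for all future time, and every such solution approaches `S`. -/
def AttractedTo {X : Type*} [NormedAddCommGroup X] [NormedSpace ℝ X] (f : ℝ → X → X)
    (B A S : Set X) : Prop :=
  ∀ t₀ : ℝ, 0 ≤ t₀ → ∀ s ∈ A,
    (∃ x : ℝ → X, x t₀ = s ∧ ∀ T ≥ t₀, IsSolutionOn f B x t₀ T) ∧
    ∀ x : ℝ → X, x t₀ = s → (∀ T ≥ t₀, IsSolutionOn f B x t₀ T) →
      Tendsto (fun t => Metric.infDist (x t) S) atTop (𝓝 0)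

end ResPrune

end

noncomputable section

namespace ResPrune

/-! The constants `η`, `κ` come from Lipschitz estimates. For bounded weights every block is
Lipschitz and of linear growth, uniformly in the parameters and in the binary variables. So changing
the weights of one unit, or flipping its binary variable, moves the output by at most a constant
times the size of the change times `1 + ‖x‖`. The negative log-likelihood is Lipschitz in the output
with a constant that grows linearly, hence the integrands differ by a multiple of `(1 + ‖x‖ + ‖y‖) ^
2`, which second moments control. This bounds the gradients and the cost differences
(`exists_sensitivityBounds`). The cost is affine in each unit parameter, so turning the units off
one at a time gives `|C¹ - C⁰| ≤ ∑ θ₁ᵢ κ (‖w₁ᵢ‖ + ‖w₂ᵢ‖)` (`SensitivityBounds.abs_costB_sub_le`).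

Let `r = Rm / (4 (η + κ))`. As long as both weight matrices have norm at most `r`, the
regularization beats the cost: each `C¹₁ᵢ,₁ - C¹₁ᵢ,₀ + R` is at least `Rm / 2`. Hence `θ_B` and all
`θ₁ᵢ` are nonincreasing, and the derivative of `Λ_B` is at most `-(Rm / 2) θ_B ‖θ₁‖₁ - λ (‖W₁‖² +
‖W₂‖²)` (`Regime.quadDeriv_lyap_le`). The sublevel set `D_B` lies in this ball but touches its
boundary, at points with `θ_B = 0`. There weight decay keeps the weights from growing, so `D_B` is
invariant (`Regime.quad_le_of_start`).

`E_B` has two pieces, `θ_B = 0` and `θ₁ = 0`. Near the first, `Λ_B` is small. Near the second it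
need not be, and `‖W₁‖² + ‖W₂‖² + c ‖θ₁‖²` with `c = 4 η r / Rm` takes over
(`Regime.quadDeriv_units_le`). These two functions give invariance and stability.

For attraction no LaSalle principle for non-autonomous systems is needed. By monotonicity `Λ_B`,
`θ_B` and `‖θ₁‖₁` converge, so the dissipation rate converges too; a positive limit would drive
`Λ_B` below zero (`Regime.tendsto_infDist`).

Existence has to face a discontinuous projection. The unprojected equation, with the state retracted
to the ball, is globally Lipschitz and is solved by a contraction argument. Its Bernoulli parameters
are nonincreasing, so their positive parts stop at zero exactly as the projection prescribes
(`Regime.exists_solution`). -/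

/-- The negative log-likelihood of the target `y` given the network output `ŷ`. -/
def Model.nll (m : Model) {n : ℕ} (yhat : Fin n → ℝ) (y : E n) : ℝ :=
  -Real.log (m.likelihood yhat y)

/-! ### Growth and Lipschitz bounds for the two likelihood models. -/

lemma E.abs_apply_le {n : ℕ} (y : E n) (r : Fin n) : |y r| ≤ ‖y‖ := by
  simpa using PiLp.norm_apply_le y r

lemma abs_apply_le_norm {n : ℕ} (z : Fin n → ℝ) (r : Fin n) : |z r| ≤ ‖z‖ := by
  simpa using norm_le_pi_norm z r

lemma Model.nll_gaussian (v : ℝ≥0) (hv : v ≠ 0) {n : ℕ} (a : Fin n → ℝ) (y : E n) :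
    (Model.gaussian v hv).nll a y =
      ∑ r, (Real.log √(2 * Real.pi * v) + (y r - a r) ^ 2 / (2 * v)) := by
  have hv' : (0 : ℝ) < v := by positivity
  have hs : 0 < √(2 * Real.pi * v) := by positivity
  simp only [Model.nll, Model.likelihood, ProbabilityTheory.gaussianPDFReal]
  rw [Real.log_prod (fun r _ => by positivity), ← Finset.sum_neg_distrib]
  refine Finset.sum_congr rfl fun r _ => ?_
  rw [Real.log_mul (by positivity) (by positivity), Real.log_inv, Real.log_exp]
  ring

/-- The logarithm of the sum of the exponentials. -/
def logSumExp {n : ℕ} (a : Fin n → ℝ) : ℝ := Real.log (∑ s, Real.exp (a s))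

lemma Model.nll_categorical {n : ℕ} (a : Fin n → ℝ) (y : E n) :
    Model.categorical.nll a y = ∑ r, y r * (logSumExp a - a r) := by
  simp only [Model.nll, Model.likelihood]
  have hS : ∀ r : Fin n, 0 < ∑ s, Real.exp (a s) := fun r =>
    Finset.sum_pos (fun s _ => Real.exp_pos _) ⟨r, Finset.mem_univ r⟩
  rw [Real.log_prod, ← Finset.sum_neg_distrib]
  · refine Finset.sum_congr rfl fun r _ => ?_
    have := hS r
    rw [Real.log_rpow (by positivity), Real.log_div (by positivity) (by positivity),
      Real.log_exp, logSumExp]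
    ring
  · intro r _
    have := hS r
    positivity

/-- Each `exp (a s)` is at most `exp (b s) * exp ‖a - b‖`; the second factor comes out of the sum.
-/
lemma logSumExp_le {n : ℕ} (hn : 0 < n) (a b : Fin n → ℝ) :
    logSumExp a ≤ logSumExp b + ‖a - b‖ := by
  have hne : (Finset.univ : Finset (Fin n)).Nonempty := ⟨⟨0, hn⟩, Finset.mem_univ _⟩
  have hb : 0 < ∑ s, Real.exp (b s) := Finset.sum_pos (fun s _ => Real.exp_pos _) hne
  have ha : 0 < ∑ s, Real.exp (a s) := Finset.sum_pos (fun s _ => Real.exp_pos _) hne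
  have h : ∑ s, Real.exp (a s) ≤ (∑ s, Real.exp (b s)) * Real.exp ‖a - b‖ := by
    rw [Finset.sum_mul]
    refine Finset.sum_le_sum fun s _ => ?_
    rw [← Real.exp_add]
    refine Real.exp_le_exp.2 ?_
    have := (le_abs_self _).trans (abs_apply_le_norm (a - b) s)
    simp only [Pi.sub_apply] at this
    linarith
  have := Real.log_le_log ha h
  rwa [Real.log_mul hb.ne' (Real.exp_pos _).ne', Real.log_exp] at this

lemma abs_logSumExp_sub_le {n : ℕ} (a b : Fin n → ℝ) :
    |logSumExp a - logSumExp b| ≤ ‖a - b‖ := by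
  rcases Nat.eq_zero_or_pos n with rfl | hn
  · have : a = b := Subsingleton.elim _ _
    simp [this]
  · have h1 := logSumExp_le hn a b
    have h2 := logSumExp_le hn b a
    rw [norm_sub_rev] at h2
    rw [abs_le]; constructor <;> linarith

/-- The Gaussian loss is quadratic, so its difference quotient is linear in the data. The
categorical loss is `y` times a function that is 2-Lipschitz in the sup norm. One bound of this form
serves both models. -/
lemma Model.exists_nll_sub_le (m : Model) (n : ℕ) : ∃ C : ℝ, 0 ≤ C ∧
    ∀ (a b : Fin n → ℝ) (y : E n),
      |m.nll a y - m.nll b y| ≤ C * ((1 + ‖y‖ + ‖a‖ + ‖b‖) * ‖a - b‖) := by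
  rcases m with ⟨v, hv⟩ | _
  · have hv' : (0 : ℝ) < v := by positivity
    refine ⟨n * (1 / v), by positivity, fun a b y => ?_⟩
    rw [Model.nll_gaussian, Model.nll_gaussian, ← Finset.sum_sub_distrib]
    refine (Finset.abs_sum_le_sum_abs _ _).trans ?_
    have : ∀ r ∈ (Finset.univ : Finset (Fin n)),
        |(Real.log √(2 * Real.pi * v) + (y r - a r) ^ 2 / (2 * v))
          - (Real.log √(2 * Real.pi * v) + (y r - b r) ^ 2 / (2 * v))|
        ≤ (1 / v) * ((1 + ‖y‖ + ‖a‖ + ‖b‖) * ‖a - b‖) := by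
      intro r _
      have e : (Real.log √(2 * Real.pi * v) + (y r - a r) ^ 2 / (2 * v))
          - (Real.log √(2 * Real.pi * v) + (y r - b r) ^ 2 / (2 * v))
          = (1 / v) * (((a r + b r - 2 * y r) / 2) * (a r - b r)) := by
        field_simp; ring
      rw [e, abs_mul, abs_mul, abs_of_pos (by positivity : (0 : ℝ) < 1 / v)]
      have h1 := abs_apply_le_norm a r
      have h2 := abs_apply_le_norm b r
      have h3 := E.abs_apply_le y r
      have h4 := abs_apply_le_norm (a - b) r
      simp only [Pi.sub_apply] at h4
      gcongr
      rw [abs_div, abs_two, div_le_iff₀ two_pos]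
      have : |a r + b r - 2 * y r| ≤ |a r| + |b r| + 2 * |y r| := by
        refine (abs_sub _ _).trans ?_
        rw [abs_mul, abs_two]
        linarith [abs_add_le (a r) (b r)]
      linarith [norm_nonneg a, norm_nonneg b]
    refine (Finset.sum_le_card_nsmul _ _ _ this).trans (le_of_eq ?_)
    simp; ring
  · refine ⟨n * 2, by positivity, fun a b y => ?_⟩
    rw [Model.nll_categorical, Model.nll_categorical, ← Finset.sum_sub_distrib]
    refine (Finset.abs_sum_le_sum_abs _ _).trans ?_
    have : ∀ r ∈ (Finset.univ : Finset (Fin n)),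
        |y r * (logSumExp a - a r) - y r * (logSumExp b - b r)|
        ≤ 2 * ((1 + ‖y‖ + ‖a‖ + ‖b‖) * ‖a - b‖) := by
      intro r _
      rw [← mul_sub, abs_mul]
      have h3 := E.abs_apply_le y r
      have h4 := abs_apply_le_norm (a - b) r
      have h5 := abs_logSumExp_sub_le a b
      simp only [Pi.sub_apply] at h4
      have h6 : |logSumExp a - a r - (logSumExp b - b r)| ≤ 2 * ‖a - b‖ := by
        rw [abs_le] at *
        constructor <;> linarith
      calc |y r| * |logSumExp a - a r - (logSumExp b - b r)|
          ≤ (1 + ‖y‖ + ‖a‖ + ‖b‖) * (2 * ‖a - b‖) := by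
            gcongr
            linarith [norm_nonneg a, norm_nonneg b]
        _ = _ := by ring
    refine (Finset.sum_le_card_nsmul _ _ _ this).trans (le_of_eq ?_)
    simp; ring

lemma Model.exists_nll_zero_le (m : Model) (n : ℕ) : ∃ C : ℝ, 0 ≤ C ∧
    ∀ y : E n, |m.nll (0 : Fin n → ℝ) y| ≤ C * (1 + ‖y‖) ^ 2 := by
  rcases m with ⟨v, hv⟩ | _
  · have hv' : (0 : ℝ) < v := by positivity
    refine ⟨n * (|Real.log √(2 * Real.pi * v)| + 1 / (2 * v)), by positivity, fun y => ?_⟩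
    rw [Model.nll_gaussian]
    refine (Finset.abs_sum_le_sum_abs _ _).trans ?_
    have : ∀ r ∈ (Finset.univ : Finset (Fin n)),
        |Real.log √(2 * Real.pi * v) + (y r - (0 : Fin n → ℝ) r) ^ 2 / (2 * v)|
        ≤ (|Real.log √(2 * Real.pi * v)| + 1 / (2 * v)) * (1 + ‖y‖) ^ 2 := by
      intro r _
      refine (abs_add_le _ _).trans ?_
      have h3 := E.abs_apply_le y r
      have h5 : (y r) ^ 2 ≤ (1 + ‖y‖) ^ 2 := by
        rw [← sq_abs]
        gcongr
        linarith
      have h6 : 1 ≤ (1 + ‖y‖) ^ 2 := by nlinarith [norm_nonneg y]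
      rw [add_mul, abs_of_nonneg (a := (_ : ℝ) / _) (by positivity)]
      refine add_le_add (le_mul_of_one_le_right (abs_nonneg _) h6) ?_
      rw [one_div, div_eq_inv_mul]
      simp only [Pi.zero_apply, sub_zero]
      gcongr
    refine (Finset.sum_le_card_nsmul _ _ _ this).trans (le_of_eq ?_)
    simp; ring
  · refine ⟨n * |logSumExp (0 : Fin n → ℝ)|, by positivity, fun y => ?_⟩
    rw [Model.nll_categorical]
    refine (Finset.abs_sum_le_sum_abs _ _).trans ?_
    have : ∀ r ∈ (Finset.univ : Finset (Fin n)),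
        |y r * (logSumExp (0 : Fin n → ℝ) - (0 : Fin n → ℝ) r)|
        ≤ |logSumExp (0 : Fin n → ℝ)| * (1 + ‖y‖) ^ 2 := by
      intro r _
      have h3 := E.abs_apply_le y r
      rw [abs_mul, mul_comm]
      simp only [Pi.zero_apply, sub_zero]
      gcongr
      nlinarith [norm_nonneg y]
    refine (Finset.sum_le_card_nsmul _ _ _ this).trans (le_of_eq ?_)
    simp; ring

lemma continuous_logSumExp {n : ℕ} : Continuous (logSumExp (n := n)) := by
  have : LipschitzWith 1 (logSumExp (n := n)) := LipschitzWith.of_dist_le_mul fun a b => by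
    simpa [Real.dist_eq, dist_eq_norm] using abs_logSumExp_sub_le a b
  exact this.continuous

lemma Model.continuous_nll (m : Model) {n : ℕ} :
    Continuous fun z : (Fin n → ℝ) × E n => m.nll z.1 z.2 := by
  rcases m with ⟨v, hv⟩ | _
  · simp only [Model.nll_gaussian]
    fun_prop
  · simp only [Model.nll_categorical]
    have := continuous_logSumExp (n := n)
    fun_prop

/-! ### Lipschitz and growth bounds for the network maps. -/

variable {N : Net}

/-- All activation functions vanish at `0` and are Lipschitz with constant `A`. -/
structure Net.LipschitzActivations (N : Net) (A : ℝ) : Prop where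
  nonneg : 0 ≤ A
  a_sub : ∀ l < N.L, ∀ x y, |N.a l x - N.a l y| ≤ A * |x - y|
  a_zero : ∀ l < N.L, N.a l 0 = 0
  h_sub : ∀ l ≤ N.L, ∀ x y, |N.h l x - N.h l y| ≤ A * |x - y|
  h_zero : ∀ l ≤ N.L, N.h l 0 = 0

lemma GoodActivation.exists_lipschitz {f : ℝ → ℝ} (hf : GoodActivation f) :
    ∃ B : ℝ, 0 ≤ B ∧ ∀ x y, |f x - f y| ≤ B * |x - y| := by
  obtain ⟨h1, ⟨B, hB⟩, -⟩ := hf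
  refine ⟨B, (abs_nonneg _).trans (hB 0), fun x y => ?_⟩
  have := Convex.norm_image_sub_le_of_norm_deriv_le (s := univ) (f := f) (C := B)
    (fun x _ => h1.differentiable one_ne_zero x) (fun x _ => hB x) convex_univ
    (mem_univ y) (mem_univ x)
  simpa using this

/-- The layers are indexed by all natural numbers but only finitely many are controlled, so a common
constant is a maximum built by induction on the number of layers. -/
lemma Net.GoodActivations.exists_lipschitz (h : N.GoodActivations) :
    ∃ A, N.LipschitzActivations A := by
  have key : ∀ (f : ℕ → ℝ → ℝ) (n : ℕ), (∀ l < n, GoodActivation (f l)) →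
      ∃ A : ℝ, 0 ≤ A ∧ ∀ l < n, ∀ x y, |f l x - f l y| ≤ A * |x - y| := by
    intro f n
    induction n with
    | zero => exact fun _ => ⟨0, le_rfl, fun l hl => absurd hl (Nat.not_lt_zero l)⟩
    | succ n ih =>
      intro hf
      obtain ⟨A, hA, hA'⟩ := ih fun l hl => hf l (by omega)
      obtain ⟨B, hB, hB'⟩ := (hf n (by omega)).exists_lipschitz
      refine ⟨max A B, le_max_of_le_left hA, fun l hl x y => ?_⟩
      rcases Nat.lt_succ_iff_lt_or_eq.1 hl with hl | rfl
      · exact (hA' l hl x y).trans (by gcongr; exact le_max_left _ _)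
      · exact (hB' x y).trans (by gcongr; exact le_max_right _ _)
  obtain ⟨A, hA, hA'⟩ := key N.a N.L h.1
  obtain ⟨B, hB, hB'⟩ := key N.h (N.L + 1) fun l hl => h.2 l (by omega)
  refine ⟨max A B, le_max_of_le_left hA, fun l hl x y => (hA' l hl x y).trans ?_,
    fun l hl => (h.1 l hl).2.2, fun l hl x y => (hB' l (by omega) x y).trans ?_,
    fun l hl => (h.2 l hl).2.2⟩
  · gcongr; exact le_max_left _ _
  · gcongr; exact le_max_right _ _

namespace Net.LipschitzActivations

variable {A : ℝ} (hA : N.LipschitzActivations A)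
include hA

lemma abs_a_le {l : ℕ} (hl : l < N.L) (x : ℝ) : |N.a l x| ≤ A * |x| := by
  simpa [hA.a_zero l hl] using hA.a_sub l hl x 0

lemma abs_h_le {l : ℕ} (hl : l ≤ N.L) (x : ℝ) : |N.h l x| ≤ A * |x| := by
  simpa [hA.h_zero l hl] using hA.h_sub l hl x 0

end Net.LipschitzActivations

/-- The fan-in, fan-out and linear-path weights are bounded by `c`. -/
structure Params.WeightsLE (p : Params N) (c : ℝ) : Prop where
  nonneg : 0 ≤ c
  W1_le : ∀ l i, ‖p.W1 l i‖ ≤ c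
  W2_le : ∀ l i, ‖p.W2 l i‖ ≤ c
  W3_le : ∀ l r, ‖p.W3 l r‖ ≤ c

lemma abs_bit_le (b : Bool) : |bit b| ≤ 1 := by cases b <;> simp [bit]

/-- The gated activation `z̄ = ξ_2 ⊙ h(z)`. -/
def gated (ξ : Mask N) (l : Fin N.L) (z : Fin (N.d l) → ℝ) : Fin (N.d l) → ℝ :=
  fun j => bit ((ξ l).2.2 j) * N.h l (z j)

lemma affine_sub_right {n : ℕ} (w : E (n + 1)) (z z' : Fin n → ℝ) :
    |affine w z - affine w z'| ≤ ‖w‖ * (n * ‖z - z'‖) := by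
  have e : affine w z - affine w z' = ∑ j : Fin n, w j.castSucc * (z j - z' j) := by
    simp only [affine, mul_sub, Finset.sum_sub_distrib]; ring
  rw [e]
  refine (Finset.abs_sum_le_sum_abs _ _).trans ?_
  refine (Finset.sum_le_card_nsmul _ _ (‖w‖ * ‖z - z'‖) fun j _ => ?_).trans
    (le_of_eq (by simp; ring))
  rw [abs_mul]
  exact mul_le_mul (E.abs_apply_le _ _) (abs_apply_le_norm (z - z') j) (abs_nonneg _)
    (norm_nonneg _)

lemma affine_sub_left {n : ℕ} (w w' : E (n + 1)) (z : Fin n → ℝ) :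
    affine w z - affine w' z = affine (w - w') z := by
  simp only [affine, PiLp.sub_apply, sub_mul, Finset.sum_sub_distrib]; ring

lemma abs_affine_le {n : ℕ} (w : E (n + 1)) (z : Fin n → ℝ) :
    |affine w z| ≤ ‖w‖ * (n * ‖z‖ + 1) := by
  have h := affine_sub_right w z 0
  have h0 : |affine w (0 : Fin n → ℝ)| ≤ ‖w‖ := by
    simpa [affine] using E.abs_apply_le w (Fin.last n)
  have := abs_sub_abs_le_abs_sub (affine w z) (affine w 0)
  rw [sub_zero] at h
  linarith

section Gated

variable {A : ℝ} (hA : N.LipschitzActivations A) (ξ : Mask N) (l : Fin N.L)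
include hA

lemma gated_sub_le (z z' : Fin (N.d l) → ℝ) : ‖gated ξ l z - gated ξ l z'‖ ≤ A * ‖z - z'‖ := by
  have hA0 := hA.nonneg
  refine (pi_norm_le_iff_of_nonneg (by positivity)).2 fun j => ?_
  simp only [gated, Pi.sub_apply, ← mul_sub, Real.norm_eq_abs, abs_mul]
  have h1 := hA.h_sub l l.2.le (z j) (z' j)
  have h2 := abs_apply_le_norm (z - z') j
  calc |bit ((ξ l).2.2 j)| * |N.h l (z j) - N.h l (z' j)|
      ≤ 1 * (A * |z j - z' j|) := mul_le_mul (abs_bit_le _) h1 (abs_nonneg _) zero_le_one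
    _ ≤ A * ‖z - z'‖ := by rw [one_mul]; gcongr; exact h2

lemma gated_zero : gated ξ l (0 : Fin (N.d l) → ℝ) = 0 := by
  ext j; simp [gated, hA.h_zero l l.2.le]

lemma norm_gated_le (z : Fin (N.d l) → ℝ) : ‖gated ξ l z‖ ≤ A * ‖z‖ := by
  simpa [gated_zero hA ξ l] using gated_sub_le hA ξ l z 0

end Gated

/-- The contribution of unit `i` to the coordinate `r` of the nonlinear path. -/
def Params.unitTerm (p : Params N) (ξ : Mask N) (l : Fin N.L) (z : Fin (N.d l) → ℝ)
    (r : Fin (N.d (l + 1))) (i : Fin (N.k l)) : ℝ :=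
  p.W2 l i r * (bit ((ξ l).2.1 i) * N.a l (affine (p.W1 l i) (gated ξ l z)))

lemma Params.block_apply (p : Params N) (ξ : Mask N) (l : Fin N.L) (z : Fin (N.d l) → ℝ)
    (r : Fin (N.d (l + 1))) :
    p.block ξ l z r = bit (ξ l).1 * ∑ i, p.unitTerm ξ l z r i
      + affine (p.W3 l r) (gated ξ l z) := rfl

lemma abs_bit_mul_le (b : Bool) (x : ℝ) : |bit b * x| ≤ |x| := by
  rw [abs_mul]
  exact mul_le_of_le_one_left (abs_nonneg _) (abs_bit_le b)

lemma Params.abs_unitTerm_le {A : ℝ} (hA : N.LipschitzActivations A) (p : Params N) (ξ : Mask N)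
    (l : Fin N.L) (z : Fin (N.d l) → ℝ) (r : Fin (N.d (l + 1))) (i : Fin (N.k l)) :
    |p.unitTerm ξ l z r i| ≤ ‖p.W2 l i‖ * (A * (‖p.W1 l i‖ * (N.d l * (A * ‖z‖) + 1))) := by
  have hA0 := hA.nonneg
  rw [Params.unitTerm, abs_mul]
  refine mul_le_mul (E.abs_apply_le _ _) ((abs_bit_mul_le _ _).trans ?_) (abs_nonneg _)
    (norm_nonneg _)
  refine (hA.abs_a_le l.2 _).trans ?_
  gcongr
  refine (abs_affine_le _ _).trans ?_
  gcongr
  exact norm_gated_le hA ξ l z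

lemma exists_block_sub_le {A : ℝ} (hA : N.LipschitzActivations A) (c : ℝ) (l : Fin N.L) :
    ∃ C : ℝ, 0 ≤ C ∧ ∀ p : Params N, p.WeightsLE c → ∀ (ξ : Mask N) (z z' : Fin (N.d l) → ℝ),
      ‖p.block ξ l z - p.block ξ l z'‖ ≤ C * ‖z - z'‖ := by
  have hA0 := hA.nonneg
  -- For negative `c` no parameters satisfy `WeightsLE`, and any constant will do.
  by_cases hc : 0 ≤ c
  swap
  · exact ⟨0, le_rfl, fun p hp => absurd hp.nonneg hc⟩
  refine ⟨N.k l * (c * (A * (c * (N.d l * A)))) + c * (N.d l * A), by positivity, ?_⟩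
  intro p hp ξ z z'
  refine (pi_norm_le_iff_of_nonneg (by positivity)).2 fun r => ?_
  have hg := gated_sub_le hA ξ l z z'
  have haff : ∀ w : E (N.d l + 1), ‖w‖ ≤ c →
      |affine w (gated ξ l z) - affine w (gated ξ l z')| ≤ c * (N.d l * (A * ‖z - z'‖)) := by
    intro w hw
    refine (affine_sub_right _ _ _).trans ?_
    gcongr
  have hterm : ∀ i ∈ (Finset.univ : Finset (Fin (N.k l))),
      |p.unitTerm ξ l z r i - p.unitTerm ξ l z' r i|
        ≤ c * (A * (c * (N.d l * (A * ‖z - z'‖)))) := by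
    intro i _
    rw [Params.unitTerm, Params.unitTerm, ← mul_sub, ← mul_sub, abs_mul]
    refine mul_le_mul ((E.abs_apply_le _ _).trans (hp.W2_le l i))
      ((abs_bit_mul_le _ _).trans ?_) (abs_nonneg _) hc
    refine (hA.a_sub l l.2 _ _).trans ?_
    gcongr
    exact haff _ (hp.W1_le l i)
  have hsum : |∑ i, (p.unitTerm ξ l z r i - p.unitTerm ξ l z' r i)|
      ≤ N.k l * (c * (A * (c * (N.d l * (A * ‖z - z'‖))))) :=
    (Finset.abs_sum_le_sum_abs _ _).trans
      ((Finset.sum_le_card_nsmul _ _ _ hterm).trans (le_of_eq (by simp)))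
  have e : (p.block ξ l z - p.block ξ l z') r
      = bit (ξ l).1 * (∑ i, (p.unitTerm ξ l z r i - p.unitTerm ξ l z' r i))
        + (affine (p.W3 l r) (gated ξ l z) - affine (p.W3 l r) (gated ξ l z')) := by
    rw [Pi.sub_apply, Params.block_apply, Params.block_apply, Finset.sum_sub_distrib]; ring
  rw [e, Real.norm_eq_abs]
  refine (abs_add_le _ _).trans ?_
  have h1 := (abs_bit_mul_le (ξ l).1 _).trans hsum
  have h2 := haff _ (hp.W3_le l r)
  refine (add_le_add h1 h2).trans (le_of_eq ?_)
  ring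

lemma exists_norm_block_le {A : ℝ} (hA : N.LipschitzActivations A) (c : ℝ) (l : Fin N.L) :
    ∃ C : ℝ, 0 ≤ C ∧ ∀ p : Params N, p.WeightsLE c → ∀ (ξ : Mask N) (z : Fin (N.d l) → ℝ),
      ‖p.block ξ l z‖ ≤ C * (1 + ‖z‖) := by
  have hA0 := hA.nonneg
  by_cases hc : 0 ≤ c
  swap
  · exact ⟨0, le_rfl, fun p hp => absurd hp.nonneg hc⟩
  obtain ⟨C, hC, hC'⟩ := exists_block_sub_le hA c l
  refine ⟨N.k l * (c * (A * c)) + c + C, by positivity, fun p hp ξ z => ?_⟩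
  have h0 : ‖p.block ξ l 0‖ ≤ N.k l * (c * (A * c)) + c := by
    refine (pi_norm_le_iff_of_nonneg (by positivity)).2 fun r => ?_
    rw [Params.block_apply, Real.norm_eq_abs]
    refine (abs_add_le _ _).trans (add_le_add ((abs_bit_mul_le _ _).trans ?_) ?_)
    · refine (Finset.abs_sum_le_sum_abs _ _).trans
        ((Finset.sum_le_card_nsmul _ _ (c * (A * c)) fun i _ => ?_).trans (le_of_eq (by simp)))
      refine (p.abs_unitTerm_le hA ξ l 0 r i).trans ?_
      rw [norm_zero, mul_zero, mul_zero, zero_add, mul_one]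
      have := hp.W1_le l i
      have := hp.W2_le l i
      gcongr
    · rw [gated_zero hA]
      refine (abs_affine_le _ _).trans ?_
      simpa using hp.W3_le l r
  have h1 := hC' p hp ξ z 0
  rw [sub_zero] at h1
  have h2 := norm_sub_norm_le (p.block ξ l z) (p.block ξ l 0)
  have : 0 ≤ N.k l * (c * (A * c)) + c := by positivity
  nlinarith [norm_nonneg z, mul_nonneg this (norm_nonneg z)]

lemma norm_ofLp_le {n : ℕ} (x : E n) : ‖fun j => x j‖ ≤ ‖x‖ :=
  (pi_norm_le_iff_of_nonneg (norm_nonneg _)).2 fun j => PiLp.norm_apply_le x j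

lemma exists_norm_features_le {A : ℝ} (hA : N.LipschitzActivations A) (c : ℝ) (n : ℕ)
    (hn : n ≤ N.L) :
    ∃ C : ℝ, 0 ≤ C ∧ ∀ p : Params N, p.WeightsLE c → ∀ (ξ : Mask N) (x : E (N.d 0)),
      ‖p.features ξ x n hn‖ ≤ C * (1 + ‖x‖) := by
  induction n with
  | zero =>
    refine ⟨1, zero_le_one, fun p _ ξ x => ?_⟩
    have := norm_ofLp_le x
    change ‖fun j => x j‖ ≤ _
    linarith
  | succ n ih =>
    obtain ⟨C, hC, hC'⟩ := ih (Nat.le_of_succ_le hn)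
    obtain ⟨B, hB, hB'⟩ := exists_norm_block_le hA c ⟨n, hn⟩
    refine ⟨B * (1 + C), by positivity, fun p hp ξ x => ?_⟩
    have h1 := hC' p hp ξ x
    refine (hB' p hp ξ (p.features ξ x n (Nat.le_of_succ_le hn))).trans ?_
    rw [mul_assoc]
    gcongr
    nlinarith [norm_nonneg x]

/-- The error is created in block `l` only, with size relative to `1 + ‖z‖`, and the later blocks
amplify it by their Lipschitz constants. Both the parameters and the realizations may differ, so
that weight changes and flips of binary variables are covered at once. -/
lemma exists_features_sub_le {A : ℝ} (hA : N.LipschitzActivations A) (c : ℝ) (l : Fin N.L)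
    (n : ℕ) (hn : n ≤ N.L) :
    ∃ C : ℝ, 0 ≤ C ∧ ∀ p p' : Params N, p.WeightsLE c → p'.WeightsLE c →
      ∀ (ξ ξ' : Mask N) (δ : ℝ), 0 ≤ δ → (∀ l' ≠ l, p.block ξ l' = p'.block ξ' l') →
      (∀ z, ‖p.block ξ l z - p'.block ξ' l z‖ ≤ δ * (1 + ‖z‖)) → ∀ x : E (N.d 0),
      ‖p.features ξ x n hn - p'.features ξ' x n hn‖ ≤ C * (δ * (1 + ‖x‖)) := by
  induction n with
  | zero =>
    refine ⟨0, le_rfl, fun p p' _ _ ξ ξ' δ _ _ _ x => ?_⟩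
    simp [Params.features]
  | succ n ih =>
    have hn' := Nat.le_of_succ_le hn
    obtain ⟨C, hC, hC'⟩ := ih hn'
    obtain ⟨F, hF, hF'⟩ := exists_norm_features_le hA c n hn'
    obtain ⟨B, hB, hB'⟩ := exists_block_sub_le hA c ⟨n, hn⟩
    refine ⟨B * C + (1 + F), by positivity, fun p p' hp hp' ξ ξ' δ hδ hne hl x => ?_⟩
    have h1 := hC' p p' hp hp' ξ ξ' δ hδ hne hl x
    have h2 := hF' p hp ξ x
    change ‖p.block ξ ⟨n, hn⟩ (p.features ξ x n hn')
      - p'.block ξ' ⟨n, hn⟩ (p'.features ξ' x n hn')‖ ≤ _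
    set z := p.features ξ x n hn'
    set z' := p'.features ξ' x n hn'
    -- The difference of the block maps is taken at the same input here; the difference of the
    -- inputs is handled in `h4`.
    have h3 : ‖p.block ξ ⟨n, hn⟩ z - p'.block ξ' ⟨n, hn⟩ z‖ ≤ δ * (1 + ‖z‖) := by
      by_cases h : (⟨n, hn⟩ : Fin N.L) = l
      · subst h; exact hl z
      · rw [hne _ h, sub_self, norm_zero]; positivity
    have h4 := hB' p' hp' ξ' z z'
    have h5 := norm_add_le (p.block ξ ⟨n, hn⟩ z - p'.block ξ' ⟨n, hn⟩ z)
      (p'.block ξ' ⟨n, hn⟩ z - p'.block ξ' ⟨n, hn⟩ z')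
    rw [sub_add_sub_cancel] at h5
    calc _ ≤ δ * (1 + ‖z‖) + B * ‖z - z'‖ := h5.trans (add_le_add h3 h4)
      _ ≤ δ * ((1 + F) * (1 + ‖x‖)) + B * (C * (δ * (1 + ‖x‖))) := by
          gcongr
          nlinarith [norm_nonneg x]
      _ = _ := by ring

lemma output_sub_le {A : ℝ} (hA : N.LipschitzActivations A) (p p' : Params N) (ξ ξ' : Mask N)
    (x : E (N.d 0)) : ‖p.output ξ x - p'.output ξ' x‖
      ≤ A * ‖p.features ξ x N.L le_rfl - p'.features ξ' x N.L le_rfl‖ := by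
  have hA0 := hA.nonneg
  refine (pi_norm_le_iff_of_nonneg (by positivity)).2 fun r => ?_
  refine (hA.h_sub N.L le_rfl _ _).trans ?_
  gcongr
  exact abs_apply_le_norm (p.features ξ x N.L le_rfl - p'.features ξ' x N.L le_rfl) r

lemma exists_norm_output_le {A : ℝ} (hA : N.LipschitzActivations A) (c : ℝ) :
    ∃ C : ℝ, 0 ≤ C ∧ ∀ p : Params N, p.WeightsLE c → ∀ (ξ : Mask N) (x : E (N.d 0)),
      ‖p.output ξ x‖ ≤ C * (1 + ‖x‖) := by
  have hA0 := hA.nonneg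
  obtain ⟨C, hC, hC'⟩ := exists_norm_features_le hA c N.L le_rfl
  refine ⟨A * C, by positivity, fun p hp ξ x => ?_⟩
  refine (pi_norm_le_iff_of_nonneg (by positivity)).2 fun r => ?_
  refine (hA.abs_h_le le_rfl _).trans ?_
  rw [mul_assoc]
  gcongr
  exact (abs_apply_le_norm _ r).trans (hC' p hp ξ x)

lemma Params.WeightsLE.continuous_features {A : ℝ} (hA : N.LipschitzActivations A) {c : ℝ}
    {p : Params N} (hp : p.WeightsLE c) (ξ : Mask N) (n : ℕ) (hn : n ≤ N.L) :
    Continuous fun x : E (N.d 0) => p.features ξ x n hn := by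
  induction n with
  | zero =>
    change Continuous fun (x : E (N.d 0)) j => x j
    fun_prop
  | succ n ih =>
    obtain ⟨C, hC, hC'⟩ := exists_block_sub_le hA c ⟨n, hn⟩
    have : LipschitzWith C.toNNReal (p.block ξ ⟨n, hn⟩) :=
      LipschitzWith.of_dist_le_mul fun z z' => by
        rw [dist_eq_norm, dist_eq_norm, Real.coe_toNNReal _ hC]; exact hC' p hp ξ z z'
    exact this.continuous.comp (ih (Nat.le_of_succ_le hn))

lemma Params.WeightsLE.continuous_output {A : ℝ} (hA : N.LipschitzActivations A) {c : ℝ}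
    {p : Params N} (hp : p.WeightsLE c) (ξ : Mask N) :
    Continuous fun x : E (N.d 0) => p.output ξ x := by
  have hh : Continuous (N.h N.L) := by
    have : LipschitzWith A.toNNReal (N.h N.L) :=
      LipschitzWith.of_dist_le_mul fun z z' => by
        rw [Real.coe_toNNReal _ hA.nonneg]; exact hA.h_sub N.L le_rfl z z'
    exact this.continuous
  have hf := hp.continuous_features hA ξ N.L le_rfl
  exact continuous_pi fun r => hh.comp ((continuous_apply r).comp hf)

/-! ### Expected loss for a fixed realization of the binary variables. -/

/-- The expected negative log-likelihood for a fixed realization of the binary variables. -/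
def Params.maskCost (m : Model) (μ : Measure (E (N.d 0) × E (N.d N.L))) (p : Params N)
    (ξ : Mask N) : ℝ :=
  ∫ z, m.nll (p.output ξ z.1) z.2 ∂μ

lemma Params.cost_eq (m : Model) (μ : Measure (E (N.d 0) × E (N.d N.L))) (p : Params N) :
    p.cost m μ = ∑ ξ : Mask N, p.maskProb ξ * p.maskCost m μ ξ := rfl

section Integrals

variable (m : Model) (μ : Measure (E (N.d 0) × E (N.d N.L))) [IsProbabilityMeasure μ]

omit [IsProbabilityMeasure μ] in
lemma DataMoments.integrable_sq [IsFiniteMeasure μ] (hdata : DataMoments μ) :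
    Integrable (fun z => (1 + ‖z.1‖ + ‖z.2‖) ^ 2) μ := by
  have h1 := hdata.1 2 (by simp)
  have h2 := hdata.2 2 (by simp)
  refine Integrable.mono' (g := fun z => 3 * (1 + ‖z.1‖ ^ 2 + ‖z.2‖ ^ 2))
    ((((integrable_const 1).add h1).add h2).const_mul 3) ?_ (Eventually.of_forall fun z => ?_)
  · exact (by fun_prop : Continuous fun z : E (N.d 0) × E (N.d N.L) =>
      (1 + ‖z.1‖ + ‖z.2‖) ^ 2).aestronglyMeasurable
  · rw [Real.norm_of_nonneg (by positivity)]
    nlinarith [sq_nonneg (‖z.1‖ - 1), sq_nonneg (‖z.2‖ - 1), sq_nonneg (‖z.1‖ - ‖z.2‖)]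

variable {A : ℝ} (hA : N.LipschitzActivations A)
include hA

lemma Params.WeightsLE.integrable_nll (hdata : DataMoments μ) {c : ℝ} {p : Params N}
    (hp : p.WeightsLE c) (ξ : Mask N) :
    Integrable (fun z => m.nll (p.output ξ z.1) z.2) μ := by
  obtain ⟨C1, h1, h1'⟩ := m.exists_nll_sub_le (N.d N.L)
  obtain ⟨C0, h0, h0'⟩ := m.exists_nll_zero_le (N.d N.L)
  obtain ⟨F, hF, hF'⟩ := exists_norm_output_le hA c
  refine Integrable.mono' ((hdata.integrable_sq μ).const_mul (C0 + C1 * ((1 + F) * F))) ?_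
    (Eventually.of_forall fun z => ?_)
  · have := hp.continuous_output hA ξ
    exact ((m.continuous_nll).comp
      ((this.comp continuous_fst).prodMk continuous_snd)).aestronglyMeasurable
  · have e1 := h1' (p.output ξ z.1) 0 z.2
    have e0 := h0' z.2
    have e2 := hF' p hp ξ z.1
    rw [norm_zero, add_zero, sub_zero] at e1
    rw [Real.norm_eq_abs]
    have e3 := abs_sub_abs_le_abs_sub (m.nll (p.output ξ z.1) z.2) (m.nll 0 z.2)
    set X := ‖z.1‖
    set Y := ‖z.2‖
    have hX : 0 ≤ X := norm_nonneg _
    have hY : 0 ≤ Y := norm_nonneg _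
    have e4 : C1 * ((1 + Y + ‖p.output ξ z.1‖) * ‖p.output ξ z.1‖)
        ≤ C1 * (((1 + F) * (1 + X + Y)) * (F * (1 + X + Y))) := by
      gcongr
      · nlinarith [mul_nonneg hF hY]
      · nlinarith [mul_nonneg hF hY]
    have e5 : C0 * (1 + Y) ^ 2 ≤ C0 * (1 + X + Y) ^ 2 := by gcongr; linarith
    nlinarith

/-- All sensitivity estimates reduce to this one: a relative perturbation `δ` of a single block
costs `O(δ)`. The output difference and the local Lipschitz constant of the loss each contribute a
factor linear in the data, whence the second moment. -/
lemma exists_maskCost_sub_le (hdata : DataMoments μ) (c : ℝ) (l : Fin N.L) :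
    ∃ C : ℝ, 0 ≤ C ∧ ∀ p p' : Params N, p.WeightsLE c → p'.WeightsLE c →
      ∀ (ξ ξ' : Mask N) (δ : ℝ), 0 ≤ δ → (∀ l' ≠ l, p.block ξ l' = p'.block ξ' l') →
      (∀ z, ‖p.block ξ l z - p'.block ξ' l z‖ ≤ δ * (1 + ‖z‖)) →
      |p.maskCost m μ ξ - p'.maskCost m μ ξ'| ≤ C * δ := by
  have hA0 := hA.nonneg
  obtain ⟨C1, h1, h1'⟩ := m.exists_nll_sub_le (N.d N.L)
  obtain ⟨F, hF, hF'⟩ := exists_norm_output_le hA c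
  obtain ⟨G, hG, hG'⟩ := exists_features_sub_le hA c l N.L le_rfl
  have hI := hdata.integrable_sq μ
  set I := ∫ z, (1 + ‖z.1‖ + ‖z.2‖) ^ 2 ∂μ
  have hI0 : 0 ≤ I := integral_nonneg fun z => by positivity
  refine ⟨(C1 * ((1 + 2 * F) * (A * G))) * I, by positivity, ?_⟩
  intro p p' hp hp' ξ ξ' δ hδ hne hl
  rw [Params.maskCost, Params.maskCost, ← integral_sub (hp.integrable_nll m μ hA hdata ξ)
    (hp'.integrable_nll m μ hA hdata ξ')]
  have key : ∀ z : E (N.d 0) × E (N.d N.L),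
      ‖m.nll (p.output ξ z.1) z.2 - m.nll (p'.output ξ' z.1) z.2‖
      ≤ (C1 * ((1 + 2 * F) * (A * G))) * δ * (1 + ‖z.1‖ + ‖z.2‖) ^ 2 := by
    intro z
    have e1 := h1' (p.output ξ z.1) (p'.output ξ' z.1) z.2
    have e2 := hF' p hp ξ z.1
    have e3 := hF' p' hp' ξ' z.1
    have e4 := output_sub_le hA p p' ξ ξ' z.1
    have e5 := hG' p p' hp hp' ξ ξ' δ hδ hne hl z.1
    set X := ‖z.1‖
    set Y := ‖z.2‖
    have hX : 0 ≤ X := norm_nonneg _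
    have hY : 0 ≤ Y := norm_nonneg _
    have e6 : ‖p.output ξ z.1 - p'.output ξ' z.1‖ ≤ A * (G * (δ * (1 + X + Y))) :=
      e4.trans (by gcongr; exact e5.trans (by gcongr G * (δ * ?_); linarith))
    rw [Real.norm_eq_abs]
    refine e1.trans ?_
    calc _ ≤ C1 * (((1 + 2 * F) * (1 + X + Y)) * (A * (G * (δ * (1 + X + Y))))) := by
          gcongr
          nlinarith [mul_nonneg hF hY]
      _ = _ := by ring
  have := norm_integral_le_of_norm_le (hI.const_mul (C1 * ((1 + 2 * F) * (A * G)) * δ))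
    (Eventually.of_forall key)
  rw [integral_const_mul] at this
  exact this.trans (le_of_eq (by ring))

end Integrals

/-! ### Perturbing a single unit. -/

/-- The realization in which the binary variable of unit `i` of block `l` is flipped. -/
def flipU (l : Fin N.L) (i : Fin (N.k l)) (ξ : Mask N) : Mask N :=
  Function.update ξ l ((ξ l).1, Function.update (ξ l).2.1 i (!(ξ l).2.1 i), (ξ l).2.2)

lemma flipU_involutive (l : Fin N.L) (i : Fin (N.k l)) : Function.Involutive (flipU l i) := by
  intro ξ
  simp [flipU]

/-- The realization in which the binary variable of block `l` is flipped. -/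
def flipB (l : Fin N.L) (ξ : Mask N) : Mask N :=
  Function.update ξ l (!(ξ l).1, (ξ l).2.1, (ξ l).2.2)

lemma flipB_involutive (l : Fin N.L) : Function.Involutive (flipB l) := by
  intro ξ
  simp [flipB]

lemma gated_congr {ξ ξ' : Mask N} {l : Fin N.L} (h : (ξ l).2.2 = (ξ' l).2.2)
    (z : Fin (N.d l) → ℝ) : gated ξ l z = gated ξ' l z := by
  ext j; simp only [gated, h]

lemma Params.block_congr {p p' : Params N} {ξ ξ' : Mask N} {l : Fin N.L}
    (h1 : p.W1 l = p'.W1 l) (h2 : p.W2 l = p'.W2 l) (h3 : p.W3 l = p'.W3 l) (hξ : ξ l = ξ' l) :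
    p.block ξ l = p'.block ξ' l := by
  ext z r
  simp only [Params.block_apply, Params.unitTerm, gated_congr (congrArg (·.2.2) hξ) z, h1, h2, h3,
    hξ]

/-- Units enter the nonlinear path additively, so if only unit `i` changes, only its term survives
in the difference. -/
lemma Params.norm_block_sub_le {p p' : Params N} {ξ ξ' : Mask N} {l : Fin N.L}
    (h3 : p.W3 l = p'.W3 l) (hB : (ξ l).1 = (ξ' l).1) (h22 : (ξ l).2.2 = (ξ' l).2.2)
    (i : Fin (N.k l)) (z : Fin (N.d l) → ℝ)
    (hne : ∀ r, ∀ j ≠ i, p.unitTerm ξ l z r j = p'.unitTerm ξ' l z r j) {b : ℝ} (hb : 0 ≤ b)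
    (hi : ∀ r, |p.unitTerm ξ l z r i - p'.unitTerm ξ' l z r i| ≤ b) :
    ‖p.block ξ l z - p'.block ξ' l z‖ ≤ b := by
  refine (pi_norm_le_iff_of_nonneg hb).2 fun r => ?_
  have hg : gated ξ l z = gated ξ' l z := gated_congr h22 z
  have e : (p.block ξ l z - p'.block ξ' l z) r
      = bit (ξ l).1 * (p.unitTerm ξ l z r i - p'.unitTerm ξ' l z r i) := by
    rw [← Finset.sum_eq_single (f := fun j => p.unitTerm ξ l z r j - p'.unitTerm ξ' l z r j) i
      (fun j _ hj => by rw [hne r j hj, sub_self]) (fun h => absurd (Finset.mem_univ i) h),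
      Finset.sum_sub_distrib, Pi.sub_apply, Params.block_apply, Params.block_apply, h3, hB, hg]
    ring
  rw [e, Real.norm_eq_abs]
  exact (abs_bit_mul_le _ _).trans (hi r)

section Perturbation

variable (m : Model) (μ : Measure (E (N.d 0) × E (N.d N.L))) [IsProbabilityMeasure μ]
  {A : ℝ} (hA : N.LipschitzActivations A)
include hA

/-- Changing the fan-in weights of a unit. -/
lemma exists_maskCost_W1_le (hdata : DataMoments μ) (c : ℝ) (l : Fin N.L) :
    ∃ C : ℝ, 0 ≤ C ∧ ∀ p p' : Params N, p.WeightsLE c → p'.WeightsLE c →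
      p.W2 = p'.W2 → p.W3 = p'.W3 → (∀ l' ≠ l, p.W1 l' = p'.W1 l') →
      ∀ i, (∀ j ≠ i, p.W1 l j = p'.W1 l j) → ∀ ξ,
      |p.maskCost m μ ξ - p'.maskCost m μ ξ| ≤ C * ‖p.W1 l i - p'.W1 l i‖ := by
  have hA0 := hA.nonneg
  by_cases hc : 0 ≤ c
  swap
  · exact ⟨0, le_rfl, fun p _ hp => absurd hp.nonneg hc⟩
  obtain ⟨C, hC, hC'⟩ := exists_maskCost_sub_le m μ hA hdata c l
  refine ⟨C * (c * (A * (N.d l * A + 1))), by positivity, ?_⟩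
  intro p p' hp hp' h2 h3 h1 i hi ξ
  rw [mul_assoc]
  refine hC' p p' hp hp' ξ ξ _ (by positivity)
    -- The perturbation size `δ` is `c * (A * (N.d l * A + 1))` times the weight change: fan-out
    -- bound, Lipschitz constant of the activation, growth of the affine map.
    (fun l' hl' => Params.block_congr (h1 l' hl') (by rw [h2]) (by rw [h3]) rfl) fun z => ?_
  refine Params.norm_block_sub_le (by rw [h3]) rfl rfl i z
    (fun r j hj => by simp only [Params.unitTerm, h2, hi j hj]) (by positivity) fun r => ?_
  rw [Params.unitTerm, Params.unitTerm, h2, ← mul_sub, ← mul_sub, abs_mul]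
  have e1 : |N.a l (affine (p.W1 l i) (gated ξ l z)) - N.a l (affine (p'.W1 l i) (gated ξ l z))|
      ≤ A * (‖p.W1 l i - p'.W1 l i‖ * (N.d l * (A * ‖z‖) + 1)) := by
    refine (hA.a_sub l l.2 _ _).trans ?_
    gcongr
    rw [affine_sub_left]
    refine (abs_affine_le _ _).trans ?_
    gcongr
    exact norm_gated_le hA ξ l z
  refine (mul_le_mul ((E.abs_apply_le _ _).trans (hp'.W2_le l i)) ((abs_bit_mul_le _ _).trans e1)
    (abs_nonneg _) hc).trans ?_
  have : (N.d l * (A * ‖z‖) + 1 : ℝ) ≤ (N.d l * A + 1) * (1 + ‖z‖) := by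
    have : (0 : ℝ) ≤ N.d l * A := by positivity
    nlinarith [norm_nonneg z]
  calc _ ≤ c * (A * (‖p.W1 l i - p'.W1 l i‖ * ((N.d l * A + 1) * (1 + ‖z‖)))) := by gcongr
    _ = _ := by ring

/-- Changing the fan-out weights of a unit. -/
lemma exists_maskCost_W2_le (hdata : DataMoments μ) (c : ℝ) (l : Fin N.L) :
    ∃ C : ℝ, 0 ≤ C ∧ ∀ p p' : Params N, p.WeightsLE c → p'.WeightsLE c →
      p.W1 = p'.W1 → p.W3 = p'.W3 → (∀ l' ≠ l, p.W2 l' = p'.W2 l') →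
      ∀ i, (∀ j ≠ i, p.W2 l j = p'.W2 l j) → ∀ ξ,
      |p.maskCost m μ ξ - p'.maskCost m μ ξ| ≤ C * ‖p.W2 l i - p'.W2 l i‖ := by
  have hA0 := hA.nonneg
  by_cases hc : 0 ≤ c
  swap
  · exact ⟨0, le_rfl, fun p _ hp => absurd hp.nonneg hc⟩
  obtain ⟨C, hC, hC'⟩ := exists_maskCost_sub_le m μ hA hdata c l
  refine ⟨C * (c * (A * (N.d l * A + 1))), by positivity, ?_⟩
  intro p p' hp hp' h1 h3 h2 i hi ξ
  rw [mul_assoc]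
  refine hC' p p' hp hp' ξ ξ _ (by positivity)
    (fun l' hl' => Params.block_congr (by rw [h1]) (h2 l' hl') (by rw [h3]) rfl) fun z => ?_
  refine Params.norm_block_sub_le (by rw [h3]) rfl rfl i z
    (fun r j hj => by simp only [Params.unitTerm, h1, hi j hj]) (by positivity) fun r => ?_
  rw [Params.unitTerm, Params.unitTerm, h1, ← sub_mul, abs_mul]
  have e1 : |N.a l (affine (p'.W1 l i) (gated ξ l z))|
      ≤ A * (c * (N.d l * (A * ‖z‖) + 1)) := by
    refine (hA.abs_a_le l.2 _).trans ?_
    gcongr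
    refine (abs_affine_le _ _).trans ?_
    gcongr
    · exact hp'.W1_le l i
    · exact norm_gated_le hA ξ l z
  refine (mul_le_mul (E.abs_apply_le (p.W2 l i - p'.W2 l i) r) ((abs_bit_mul_le _ _).trans e1)
    (abs_nonneg _) (norm_nonneg _)).trans ?_
  have : (N.d l * (A * ‖z‖) + 1 : ℝ) ≤ (N.d l * A + 1) * (1 + ‖z‖) := by
    have : (0 : ℝ) ≤ N.d l * A := by positivity
    nlinarith [norm_nonneg z]
  calc _ ≤ ‖p.W2 l i - p'.W2 l i‖ * (A * (c * ((N.d l * A + 1) * (1 + ‖z‖)))) := by gcongr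
    _ = _ := by ring

/-- Flipping the binary variable of a unit. -/
lemma exists_maskCost_flipU_le (hdata : DataMoments μ) (c : ℝ) (l : Fin N.L) :
    ∃ C : ℝ, 0 ≤ C ∧ ∀ p : Params N, p.WeightsLE c → ∀ i ξ,
      |p.maskCost m μ (flipU l i ξ) - p.maskCost m μ ξ| ≤ C * ‖p.W1 l i‖ := by
  have hA0 := hA.nonneg
  by_cases hc : 0 ≤ c
  swap
  · exact ⟨0, le_rfl, fun p hp => absurd hp.nonneg hc⟩
  obtain ⟨C, hC, hC'⟩ := exists_maskCost_sub_le m μ hA hdata c l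
  refine ⟨C * (c * (A * (N.d l * A + 1))), by positivity, ?_⟩
  intro p hp i ξ
  rw [mul_assoc]
  refine hC' p p hp hp _ ξ _ (by positivity)
    (fun l' hl' => Params.block_congr rfl rfl rfl (by rw [flipU, Function.update_of_ne hl']))
    fun z => ?_
  have hg : gated (flipU l i ξ) l z = gated ξ l z := gated_congr (by simp [flipU]) z
  refine Params.norm_block_sub_le rfl (by simp [flipU]) (by simp [flipU]) i z
    (fun r j hj => by simp only [Params.unitTerm, hg]; simp [flipU, hj]) (by positivity)
    fun r => ?_
  rw [Params.unitTerm, Params.unitTerm, hg, ← mul_sub, ← sub_mul, abs_mul]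
  have e1 : |N.a l (affine (p.W1 l i) (gated ξ l z))|
      ≤ A * (‖p.W1 l i‖ * (N.d l * (A * ‖z‖) + 1)) := by
    refine (hA.abs_a_le l.2 _).trans ?_
    gcongr
    refine (abs_affine_le _ _).trans ?_
    gcongr
    exact norm_gated_le hA ξ l z
  have e2 : |bit ((flipU l i ξ l).2.1 i) - bit ((ξ l).2.1 i)| ≤ 1 := by
    simp only [flipU, Function.update_self]
    cases (ξ l).2.1 i <;> simp [bit]
  refine (mul_le_mul ((E.abs_apply_le _ _).trans (hp.W2_le l i))
    ((abs_mul _ _).le.trans (mul_le_mul e2 e1 (abs_nonneg _) zero_le_one))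
    (abs_nonneg _) hc).trans ?_
  have : (N.d l * (A * ‖z‖) + 1 : ℝ) ≤ (N.d l * A + 1) * (1 + ‖z‖) := by
    have : (0 : ℝ) ≤ N.d l * A := by positivity
    nlinarith [norm_nonneg z]
  calc _ ≤ c * (1 * (A * (‖p.W1 l i‖ * ((N.d l * A + 1) * (1 + ‖z‖))))) := by gcongr
    _ = _ := by ring

end Perturbation

lemma Params.maskCost_eq_of_block (m : Model) (μ : Measure (E (N.d 0) × E (N.d N.L)))
    {p p' : Params N} {ξ ξ' : Mask N} (h : ∀ l, p.block ξ l = p'.block ξ' l) :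
    p.maskCost m μ ξ = p'.maskCost m μ ξ' := by
  have hF : ∀ x n hn, p.features ξ x n hn = p'.features ξ' x n hn := by
    intro x n hn
    induction n with
    | zero => rfl
    | succ n ih =>
      change p.block ξ ⟨n, hn⟩ _ = p'.block ξ' ⟨n, hn⟩ _
      rw [ih, h]
  have hO : p.output ξ = p'.output ξ' := by
    ext x r
    simp only [Params.output, hF]
  simp only [Params.maskCost, hO]

lemma Params.maskCost_congr (m : Model) (μ : Measure (E (N.d 0) × E (N.d N.L)))
    {p p' : Params N} (h1 : p.W1 = p'.W1) (h2 : p.W2 = p'.W2) (h3 : p.W3 = p'.W3) (ξ : Mask N) :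
    p.maskCost m μ ξ = p'.maskCost m μ ξ :=
  Params.maskCost_eq_of_block m μ fun l =>
    Params.block_congr (by rw [h1]) (by rw [h2]) (by rw [h3]) rfl

/-! ### Dependence of the cost on the Bernoulli parameters. -/

/-- All Bernoulli parameters lie in the unit interval. -/
structure Params.ThetaMem (p : Params N) : Prop where
  θB_mem : ∀ l, p.θB l ∈ Icc (0 : ℝ) 1
  θ1_mem : ∀ l i, p.θ1 l i ∈ Icc (0 : ℝ) 1
  θ2_mem : ∀ l j, p.θ2 l j ∈ Icc (0 : ℝ) 1

lemma bern_nonneg {t : ℝ} (ht : t ∈ Icc (0 : ℝ) 1) (b : Bool) : 0 ≤ bern t b := by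
  cases b <;> simp [bern, ht.1, ht.2]

lemma bern_le_one {t : ℝ} (ht : t ∈ Icc (0 : ℝ) 1) (b : Bool) : bern t b ≤ 1 := by
  cases b <;> simp [bern, ht.1, ht.2]

lemma bit_mem (b : Bool) : bit b ∈ Icc (0 : ℝ) 1 := by cases b <;> simp [bit]

lemma Params.ThetaMem.maskProb_nonneg {p : Params N} (hp : p.ThetaMem) (ξ : Mask N) :
    0 ≤ p.maskProb ξ :=
  Finset.prod_nonneg fun l _ => mul_nonneg (mul_nonneg (bern_nonneg (hp.θB_mem l) _)
    (Finset.prod_nonneg fun i _ => bern_nonneg (hp.θ1_mem l i) _))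
    (Finset.prod_nonneg fun j _ => bern_nonneg (hp.θ2_mem l j) _)

lemma Params.ThetaMem.maskProb_le_one {p : Params N} (hp : p.ThetaMem) (ξ : Mask N) :
    p.maskProb ξ ≤ 1 := by
  have h1 : ∀ l, 0 ≤ ∏ i, bern (p.θ1 l i) ((ξ l).2.1 i) := fun l =>
    Finset.prod_nonneg fun i _ => bern_nonneg (hp.θ1_mem l i) _
  have h2 : ∀ l, 0 ≤ ∏ i, bern (p.θ2 l i) ((ξ l).2.2 i) := fun l =>
    Finset.prod_nonneg fun i _ => bern_nonneg (hp.θ2_mem l i) _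
  refine Finset.prod_le_one (fun l _ => mul_nonneg (mul_nonneg (bern_nonneg (hp.θB_mem l) _)
    (h1 l)) (h2 l)) fun l _ => ?_
  refine mul_le_one₀ (mul_le_one₀ (bern_le_one (hp.θB_mem l) _) (h1 l) ?_) (h2 l) ?_
  · exact Finset.prod_le_one (fun i _ => bern_nonneg (hp.θ1_mem l i) _)
      fun i _ => bern_le_one (hp.θ1_mem l i) _
  · exact Finset.prod_le_one (fun i _ => bern_nonneg (hp.θ2_mem l i) _)
      fun i _ => bern_le_one (hp.θ2_mem l i) _

/-- Replace the Bernoulli parameter of unit `i` of block `l`. -/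
def Params.setU (p : Params N) (l : Fin N.L) (i : Fin (N.k l)) (t : ℝ) : Params N :=
  { p with θ1 := Function.update p.θ1 l (Function.update (p.θ1 l) i t) }

/-- Replace the Bernoulli parameter of block `l`. -/
def Params.setB (p : Params N) (l : Fin N.L) (t : ℝ) : Params N :=
  { p with θB := Function.update p.θB l t }

lemma Params.costU_eq (m : Model) (μ : Measure (E (N.d 0) × E (N.d N.L))) (p : Params N)
    (l : Fin N.L) (i : Fin (N.k l)) (c : Bool) :
    p.costU m μ l i c = ((p.setB l 1).setU l i (bit c)).cost m μ := rfl

lemma Params.costB_eq (m : Model) (μ : Measure (E (N.d 0) × E (N.d N.L))) (p : Params N)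
    (l : Fin N.L) (b : Bool) : p.costB m μ l b = (p.setB l (bit b)).cost m μ := rfl

lemma Params.ThetaMem.setU {p : Params N} (hp : p.ThetaMem) (l : Fin N.L) (i : Fin (N.k l))
    {t : ℝ} (ht : t ∈ Icc (0 : ℝ) 1) : (p.setU l i t).ThetaMem := by
  refine ⟨hp.θB_mem, fun l' j => ?_, hp.θ2_mem⟩
  by_cases h : l' = l
  · subst h
    by_cases h' : j = i
    · subst h'; simpa [Params.setU] using ht
    · simpa [Params.setU, h'] using hp.θ1_mem l' j
  · simpa [Params.setU, h] using hp.θ1_mem l' j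

lemma Params.ThetaMem.setB {p : Params N} (hp : p.ThetaMem) (l : Fin N.L)
    {t : ℝ} (ht : t ∈ Icc (0 : ℝ) 1) : (p.setB l t).ThetaMem := by
  refine ⟨fun l' => ?_, hp.θ1_mem, hp.θ2_mem⟩
  by_cases h : l' = l
  · subst h; simpa [Params.setB] using ht
  · simpa [Params.setB, h] using hp.θB_mem l'

/-- The factor of the probability of a realization that belongs to block `l`. -/
def Params.blockProb (p : Params N) (l : Fin N.L) (ξ : Mask N) : ℝ :=
  bern (p.θB l) (ξ l).1 * (∏ i, bern (p.θ1 l i) ((ξ l).2.1 i)) *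
    ∏ j, bern (p.θ2 l j) ((ξ l).2.2 j)

lemma Params.maskProb_eq (p : Params N) (l : Fin N.L) (ξ : Mask N) :
    p.maskProb ξ = p.blockProb l ξ * ∏ l' ∈ Finset.univ.erase l, p.blockProb l' ξ :=
  (Finset.mul_prod_erase Finset.univ (fun l' => p.blockProb l' ξ) (Finset.mem_univ l)).symm

/-- The probability of the binary variables other than the one of unit `i` of block `l`. -/
def Params.restU (p : Params N) (l : Fin N.L) (i : Fin (N.k l)) (ξ : Mask N) : ℝ :=
  (bern (p.θB l) (ξ l).1 * (∏ j ∈ Finset.univ.erase i, bern (p.θ1 l j) ((ξ l).2.1 j)) *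
    ∏ j, bern (p.θ2 l j) ((ξ l).2.2 j)) * ∏ l' ∈ Finset.univ.erase l, p.blockProb l' ξ

/-- The probability of the binary variables other than `ξ_B` of block `l`. -/
def Params.restB (p : Params N) (l : Fin N.L) (ξ : Mask N) : ℝ :=
  ((∏ j, bern (p.θ1 l j) ((ξ l).2.1 j)) * ∏ j, bern (p.θ2 l j) ((ξ l).2.2 j)) *
    ∏ l' ∈ Finset.univ.erase l, p.blockProb l' ξ

lemma Params.maskProb_setU (p : Params N) (l : Fin N.L) (i : Fin (N.k l)) (t : ℝ) (ξ : Mask N) :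
    (p.setU l i t).maskProb ξ = bern t ((ξ l).2.1 i) * p.restU l i ξ := by
  rw [Params.maskProb_eq _ l, Params.restU, Params.blockProb,
    ← Finset.mul_prod_erase Finset.univ _ (Finset.mem_univ i)]
  have h1 : ∏ j ∈ Finset.univ.erase i, bern ((p.setU l i t).θ1 l j) ((ξ l).2.1 j)
      = ∏ j ∈ Finset.univ.erase i, bern (p.θ1 l j) ((ξ l).2.1 j) :=
    Finset.prod_congr rfl fun j hj => by simp [Params.setU, Finset.ne_of_mem_erase hj]
  have h2 : ∏ l' ∈ Finset.univ.erase l, (p.setU l i t).blockProb l' ξ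
      = ∏ l' ∈ Finset.univ.erase l, p.blockProb l' ξ :=
    Finset.prod_congr rfl fun l' hl' => by
      simp [Params.setU, Params.blockProb, Finset.ne_of_mem_erase hl']
  rw [h1, h2]
  simp only [Params.setU, Function.update_self]
  ring

lemma Params.maskProb_setB (p : Params N) (l : Fin N.L) (t : ℝ) (ξ : Mask N) :
    (p.setB l t).maskProb ξ = bern t (ξ l).1 * p.restB l ξ := by
  rw [Params.maskProb_eq _ l, Params.restB, Params.blockProb]
  have h2 : ∏ l' ∈ Finset.univ.erase l, (p.setB l t).blockProb l' ξ
      = ∏ l' ∈ Finset.univ.erase l, p.blockProb l' ξ :=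
    Finset.prod_congr rfl fun l' hl' => by
      simp [Params.setB, Params.blockProb, Finset.ne_of_mem_erase hl']
  rw [h2]
  simp only [Params.setB, Function.update_self]
  ring

lemma Params.restU_flipU (p : Params N) (l : Fin N.L) (i : Fin (N.k l)) (ξ : Mask N) :
    p.restU l i (flipU l i ξ) = p.restU l i ξ := by
  rw [Params.restU, Params.restU]
  congr 1
  · congr 1
    · congr 1
      · simp [flipU]
      · exact Finset.prod_congr rfl fun j hj => by simp [flipU, Finset.ne_of_mem_erase hj]
    · simp [flipU]
  · exact Finset.prod_congr rfl fun l' hl' => by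
      simp [Params.blockProb, flipU, Finset.ne_of_mem_erase hl']

lemma Params.restB_flipB (p : Params N) (l : Fin N.L) (ξ : Mask N) :
    p.restB l (flipB l ξ) = p.restB l ξ := by
  rw [Params.restB, Params.restB]
  congr 1
  · simp [flipB]
  · exact Finset.prod_congr rfl fun l' hl' => by
      simp [Params.blockProb, flipB, Finset.ne_of_mem_erase hl']

section Cost

variable (m : Model) (μ : Measure (E (N.d 0) × E (N.d N.L))) (p : Params N) (l : Fin N.L)

/-- Flipping the unit is a bijection of the realizations that carries the weights for parameter `0`
to those for parameter `1`. Reindexing by it couples the two expectations, leaving the mean effect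
of one flip. -/
lemma Params.cost_setU_sub (i : Fin (N.k l)) :
    (p.setU l i 1).cost m μ - (p.setU l i 0).cost m μ = ∑ ξ, (p.setU l i 0).maskProb ξ *
      (p.maskCost m μ (flipU l i ξ) - p.maskCost m μ ξ) := by
  have e : (p.setU l i 1).cost m μ
      = ∑ ξ, (p.setU l i 0).maskProb ξ * p.maskCost m μ (flipU l i ξ) := by
    rw [Params.cost_eq, ← Equiv.sum_comp (flipU_involutive l i).toPerm]
    refine Finset.sum_congr rfl fun ξ _ => ?_
    rw [Function.Involutive.coe_toPerm, Params.maskProb_setU, Params.maskProb_setU,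
      Params.restU_flipU, Params.maskCost_congr m μ (p := p.setU l i 1) (p' := p) rfl rfl rfl]
    congr 2
    simp only [flipU, Function.update_self]
    cases (ξ l).2.1 i <;> simp [bern]
  rw [e, Params.cost_eq, ← Finset.sum_sub_distrib]
  refine Finset.sum_congr rfl fun ξ _ => ?_
  rw [Params.maskCost_congr m μ (p := p.setU l i 0) (p' := p) rfl rfl rfl]
  ring

lemma Params.cost_setB_sub :
    (p.setB l 1).cost m μ - (p.setB l 0).cost m μ = ∑ ξ, (p.setB l 0).maskProb ξ *
      (p.maskCost m μ (flipB l ξ) - p.maskCost m μ ξ) := by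
  have e : (p.setB l 1).cost m μ
      = ∑ ξ, (p.setB l 0).maskProb ξ * p.maskCost m μ (flipB l ξ) := by
    rw [Params.cost_eq, ← Equiv.sum_comp (flipB_involutive l).toPerm]
    refine Finset.sum_congr rfl fun ξ _ => ?_
    rw [Function.Involutive.coe_toPerm, Params.maskProb_setB, Params.maskProb_setB,
      Params.restB_flipB, Params.maskCost_congr m μ (p := p.setB l 1) (p' := p) rfl rfl rfl]
    congr 2
    simp only [flipB, Function.update_self]
    cases (ξ l).1 <;> simp [bern]
  rw [e, Params.cost_eq, ← Finset.sum_sub_distrib]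
  refine Finset.sum_congr rfl fun ξ _ => ?_
  rw [Params.maskCost_congr m μ (p := p.setB l 0) (p' := p) rfl rfl rfl]
  ring

/-- The cost is affine in the parameter of a unit. -/
lemma Params.cost_setU (i : Fin (N.k l)) (t : ℝ) :
    (p.setU l i t).cost m μ - (p.setU l i 0).cost m μ
      = t * ((p.setU l i 1).cost m μ - (p.setU l i 0).cost m μ) := by
  simp only [Params.cost_eq, ← Finset.sum_sub_distrib, Finset.mul_sum]
  refine Finset.sum_congr rfl fun ξ _ => ?_
  simp only [Params.maskProb_setU]
  rw [Params.maskCost_congr m μ (p := p.setU l i t) (p' := p) rfl rfl rfl,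
    Params.maskCost_congr m μ (p := p.setU l i 0) (p' := p) rfl rfl rfl,
    Params.maskCost_congr m μ (p := p.setU l i 1) (p' := p) rfl rfl rfl]
  cases (ξ l).2.1 i <;> simp [bern] <;> ring

/-- Without the nonlinear path, the parameters of its units are irrelevant. -/
lemma Params.cost_setU_setB_zero (i : Fin (N.k l)) (t : ℝ) :
    ((p.setB l 0).setU l i t).cost m μ = ((p.setB l 0).setU l i 0).cost m μ := by
  rw [← sub_eq_zero, Params.cost_setU, Params.cost_setU_sub, Finset.sum_eq_zero, mul_zero]
  intro ξ _
  -- Either the nonlinear path is closed and the flip changes no block map, or the realization has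
  -- probability zero.
  cases h : (ξ l).1
  · have hJ : ∀ l', (p.setB l 0).block (flipU l i ξ) l' = (p.setB l 0).block ξ l' := by
      intro l'
      by_cases hl : l' = l
      · subst hl
        ext z r
        have hg : gated (flipU l' i ξ) l' z = gated ξ l' z := gated_congr (by simp [flipU]) z
        rw [Params.block_apply, Params.block_apply, hg]
        simp [flipU, h, bit]
      · exact Params.block_congr rfl rfl rfl (by rw [flipU, Function.update_of_ne hl])
    rw [Params.maskCost_eq_of_block m μ hJ, sub_self, mul_zero]
  · rw [Params.maskProb_setU]
    simp [Params.restU, Params.setB, h, bern]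

/-- Without units, the nonlinear path is irrelevant. -/
lemma Params.cost_setB_of_θ1_eq_zero (h1 : p.θ1 l = 0) :
    (p.setB l 1).cost m μ = (p.setB l 0).cost m μ := by
  rw [← sub_eq_zero, Params.cost_setB_sub, Finset.sum_eq_zero]
  intro ξ _
  -- Either all units are off, and opening the path adds nothing, or an active unit makes the
  -- probability vanish.
  by_cases h : ∀ i, (ξ l).2.1 i = false
  · have hJ : ∀ l', p.block (flipB l ξ) l' = p.block ξ l' := by
      intro l'
      by_cases hl : l' = l
      · subst hl
        ext z r
        have hg : gated (flipB l' ξ) l' z = gated ξ l' z := gated_congr (by simp [flipB]) z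
        rw [Params.block_apply, Params.block_apply, hg]
        simp [flipB, Params.unitTerm, h, bit]
      · exact Params.block_congr rfl rfl rfl (by rw [flipB, Function.update_of_ne hl])
    rw [Params.maskCost_eq_of_block m μ hJ, sub_self, mul_zero]
  · push Not at h
    obtain ⟨i, hi⟩ := h
    rw [Params.maskProb_setB, Params.restB,
      Finset.prod_eq_zero (Finset.mem_univ i) (by simp [h1, bern, hi])]
    simp

variable {p}

/-- Bounding each probability by `1` costs a factor equal to the number of realizations, which is
harmless since only the existence of constants matters. -/
lemma Params.ThetaMem.abs_sum_maskProb_mul_le (hp : p.ThetaMem) (f : Mask N → ℝ) {b : ℝ}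
    (hf : ∀ ξ, |f ξ| ≤ b) :
    |∑ ξ, p.maskProb ξ * f ξ| ≤ Fintype.card (Mask N) * b := by
  refine (Finset.abs_sum_le_sum_abs _ _).trans
    ((Finset.sum_le_card_nsmul _ _ b fun ξ _ => ?_).trans (le_of_eq (by simp)))
  rw [abs_mul, abs_of_nonneg (hp.maskProb_nonneg ξ)]
  exact (mul_le_of_le_one_left (abs_nonneg _) (hp.maskProb_le_one ξ)).trans (hf ξ)

end Cost

/-! ### Frobenius norms and the state of the block. -/

section Frob

variable {ι : Type*} [Fintype ι] {n : ℕ}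

lemma frob_nonneg (W : ι → E n) : 0 ≤ frob W := Real.sqrt_nonneg _

lemma frob_sq (W : ι → E n) : frob W ^ 2 = ∑ i, ‖W i‖ ^ 2 :=
  Real.sq_sqrt (Finset.sum_nonneg fun _ _ => sq_nonneg _)

lemma norm_le_frob (W : ι → E n) (i : ι) : ‖W i‖ ≤ frob W :=
  Real.le_sqrt_of_sq_le
    (Finset.single_le_sum (f := fun i => ‖W i‖ ^ 2) (fun _ _ => sq_nonneg _) (Finset.mem_univ i))

lemma norm_pi_le_frob (W : ι → E n) : ‖W‖ ≤ frob W :=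
  (pi_norm_le_iff_of_nonneg (frob_nonneg W)).2 (norm_le_frob W)

lemma frob_sq_le (W : ι → E n) : frob W ^ 2 ≤ Fintype.card ι * ‖W‖ ^ 2 := by
  rw [frob_sq]
  refine (Finset.sum_le_card_nsmul _ _ (‖W‖ ^ 2) fun i _ => ?_).trans (le_of_eq (by simp))
  have := norm_le_pi_norm W i
  gcongr

lemma frob_zero : frob (0 : ι → E n) = 0 := by simp [frob]

lemma continuous_frob : Continuous (frob : (ι → E n) → ℝ) := by
  unfold frob; fun_prop

end Frob

lemma continuous_w1 {l : Fin N.L} : Continuous (w1 : State N l → _) := continuous_fst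

lemma continuous_w2 {l : Fin N.L} : Continuous (w2 : State N l → _) :=
  continuous_fst.comp continuous_snd

lemma continuous_tB {l : Fin N.L} : Continuous (tB : State N l → ℝ) :=
  continuous_fst.comp (continuous_snd.comp continuous_snd)

lemma continuous_t1 {l : Fin N.L} : Continuous (t1 : State N l → _) :=
  continuous_snd.comp (continuous_snd.comp continuous_snd)

section Block

variable {l : Fin N.L} {p : Params N} {M : ℝ} {s : State N l} {r : ℝ}

lemma Params.BoundedBy.weightsLE_withBlock (hp : p.BoundedBy M) (h1 : frob (w1 s) ≤ r)
    (h2 : frob (w2 s) ≤ r) : (p.withBlock s).WeightsLE (max M r) := by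
  refine ⟨le_max_of_le_right ((frob_nonneg _).trans h1), fun l' i => ?_, fun l' i => ?_,
    fun l' i => le_max_of_le_left ((norm_le_frob _ i).trans (hp.W3_le l'))⟩
  · by_cases h : l' = l
    · subst h
      simpa [Params.withBlock] using Or.inr ((norm_le_frob _ i).trans h1)
    · simpa [Params.withBlock, h] using Or.inl ((norm_le_frob _ i).trans (hp.W1_le l'))
  · by_cases h : l' = l
    · subst h
      simpa [Params.withBlock] using Or.inr ((norm_le_frob _ i).trans h2)
    · simpa [Params.withBlock, h] using Or.inl ((norm_le_frob _ i).trans (hp.W2_le l'))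

lemma Params.BoundedBy.thetaMem_withBlock (hp : p.BoundedBy M) (hs : s ∈ box N l) :
    (p.withBlock s).ThetaMem := by
  refine ⟨fun l' => ?_, fun l' i => ?_, hp.θ2_mem⟩
  · by_cases h : l' = l
    · subst h; simpa [Params.withBlock] using hs.1
    · simpa [Params.withBlock, h] using hp.θB_mem l'
  · by_cases h : l' = l
    · subst h; simpa [Params.withBlock] using hs.2 i
    · simpa [Params.withBlock, h] using hp.θ1_mem l' i

end Block

/-! ### Existence of the sensitivity constants. -/

/-- Replace the fan-in weights of unit `i` of block `l`. -/
def Params.setW1 (p : Params N) (l : Fin N.L) (i : Fin (N.k l)) (w : E (N.d l + 1)) : Params N :=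
  { p with W1 := Function.update p.W1 l (Function.update (p.W1 l) i w) }

/-- Replace the fan-out weights of unit `i` of block `l`. -/
def Params.setW2 (p : Params N) (l : Fin N.L) (i : Fin (N.k l)) (w : E (N.d (l + 1))) :
    Params N :=
  { p with W2 := Function.update p.W2 l (Function.update (p.W2 l) i w) }

lemma Params.WeightsLE.setW1 {p : Params N} {c c' : ℝ} (hp : p.WeightsLE c) (l : Fin N.L)
    (i : Fin (N.k l)) {w : E (N.d l + 1)} (hw : ‖w‖ ≤ c') (hc : c ≤ c') :
    (p.setW1 l i w).WeightsLE c' := by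
  refine ⟨hp.nonneg.trans hc, fun l' j => ?_, fun l' j => (hp.W2_le l' j).trans hc,
    fun l' j => (hp.W3_le l' j).trans hc⟩
  by_cases h : l' = l
  · subst h
    by_cases h' : j = i
    · subst h'; simpa [Params.setW1] using hw
    · simpa [Params.setW1, h'] using (hp.W1_le l' j).trans hc
  · simpa [Params.setW1, h] using (hp.W1_le l' j).trans hc

lemma Params.WeightsLE.setW2 {p : Params N} {c c' : ℝ} (hp : p.WeightsLE c) (l : Fin N.L)
    (i : Fin (N.k l)) {w : E (N.d (l + 1))} (hw : ‖w‖ ≤ c') (hc : c ≤ c') :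
    (p.setW2 l i w).WeightsLE c' := by
  refine ⟨hp.nonneg.trans hc, fun l' j => (hp.W1_le l' j).trans hc, fun l' j => ?_,
    fun l' j => (hp.W3_le l' j).trans hc⟩
  by_cases h : l' = l
  · subst h
    by_cases h' : j = i
    · subst h'; simpa [Params.setW2] using hw
    · simpa [Params.setW2, h'] using (hp.W2_le l' j).trans hc
  · simpa [Params.setW2, h] using (hp.W2_le l' j).trans hc

/-- Differentiability is not needed: where it fails, `gradient` is zero by convention and the bound
is trivial. -/
lemma norm_gradient_le {n : ℕ} {f : E n → ℝ} {x : E n} {C : ℝ} (hC : 0 ≤ C)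
    (h : ∀ᶠ y in 𝓝 x, |f y - f x| ≤ C * ‖y - x‖) : ‖gradient f x‖ ≤ C := by
  rw [gradient, LinearIsometryEquiv.norm_map]
  exact norm_fderiv_le_of_lip' ℝ hC h

lemma SensitivityBounds.mono {m : Model} {μ : Measure (E (N.d 0) × E (N.d N.L))}
    {p : Params N} {l : Fin N.L} {r r' η η' κ κ' : ℝ} (h : SensitivityBounds m μ p l r η κ)
    (hr : r' ≤ r) (hη : η ≤ η') (hκ : κ ≤ κ') : SensitivityBounds m μ p l r' η' κ' := by
  intro s hs h1 h2 i
  obtain ⟨a, b, c⟩ := h s hs (h1.trans hr) (h2.trans hr) i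
  refine ⟨a.trans ?_, b.trans ?_, c.trans ?_⟩ <;> gcongr

section Existence

variable (m : Model) (μ : Measure (E (N.d 0) × E (N.d N.L))) [IsProbabilityMeasure μ]

omit [IsProbabilityMeasure μ] in
lemma cost_sub_le {p p' : Params N} (hp : p.ThetaMem)
    (hB : p.θB = p'.θB) (h1 : p.θ1 = p'.θ1) (h2 : p.θ2 = p'.θ2) {b : ℝ}
    (hb : ∀ ξ, |p.maskCost m μ ξ - p'.maskCost m μ ξ| ≤ b) :
    |p.cost m μ - p'.cost m μ| ≤ Fintype.card (Mask N) * b := by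
  have e : ∀ ξ, p'.maskProb ξ = p.maskProb ξ := fun ξ => by
    simp only [Params.maskProb, hB, h1, h2]
  simp only [Params.cost_eq, e, ← Finset.sum_sub_distrib, ← mul_sub]
  exact hp.abs_sum_maskProb_mul_le _ hb

variable {A : ℝ} (hA : N.LipschitzActivations A)
include hA

lemma exists_norm_gradW1_le (hdata : DataMoments μ) (c : ℝ) (l : Fin N.L) :
    ∃ C : ℝ, 0 ≤ C ∧ ∀ p : Params N, p.WeightsLE c → p.ThetaMem → ∀ i,
      ‖p.gradW1 m μ l i‖ ≤ C := by
  -- The radius `c + 1` leaves room for a unit neighbourhood of the current weights, on which the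
  -- Lipschitz bound is applied.
  obtain ⟨C, hC, hC'⟩ := exists_maskCost_W1_le m μ hA hdata (c + 1) l
  refine ⟨Fintype.card (Mask N) * C, by positivity, fun p hp hθ i => ?_⟩
  change ‖gradient (fun w => (p.setW1 l i w).costU m μ l i true) (p.W1 l i)‖ ≤ _
  refine norm_gradient_le (by positivity) ?_
  filter_upwards [Metric.closedBall_mem_nhds (p.W1 l i) one_pos] with w hw
  have hle : ∀ v, ‖v‖ ≤ c + 1 → (p.setW1 l i v).WeightsLE (c + 1) :=
    fun v hv => hp.setW1 l i hv (by linarith)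
  have hw' : ‖w‖ ≤ c + 1 := by
    have h1 := norm_sub_norm_le w (p.W1 l i)
    rw [← dist_eq_norm] at h1
    linarith [hp.W1_le l i, Metric.mem_closedBall.1 hw]
  have h0 : ‖p.W1 l i‖ ≤ c + 1 := (hp.W1_le l i).trans (by linarith)
  have hT' : (p.setW1 l i w).ThetaMem := ⟨hθ.θB_mem, hθ.θ1_mem, hθ.θ2_mem⟩
  have hT : (((p.setW1 l i w).setB l 1).setU l i (bit true)).ThetaMem :=
    (hT'.setB l (by simp)).setU l i (bit_mem _)
  rw [Params.costU_eq, Params.costU_eq, mul_assoc]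
  refine cost_sub_le m μ (p' := ((p.setW1 l i (p.W1 l i)).setB l 1).setU l i (bit true)) hT
    rfl rfl rfl fun ξ => ?_
  rw [Params.maskCost_congr m μ (p := ((p.setW1 l i w).setB l 1).setU l i (bit true))
      (p' := p.setW1 l i w) rfl rfl rfl,
    Params.maskCost_congr m μ (p := ((p.setW1 l i (p.W1 l i)).setB l 1).setU l i (bit true))
      (p' := p.setW1 l i (p.W1 l i)) rfl rfl rfl]
  have := hC' _ _ (hle w hw') (hle (p.W1 l i) h0) rfl rfl
    (fun l' hl' => by simp [Params.setW1, hl']) i (fun j hj => by simp [Params.setW1, hj]) ξ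
  have e : ∀ v, (p.setW1 l i v).W1 l i = v := fun v => by simp [Params.setW1]
  rwa [e, e] at this

lemma exists_norm_gradW2_le (hdata : DataMoments μ) (c : ℝ) (l : Fin N.L) :
    ∃ C : ℝ, 0 ≤ C ∧ ∀ p : Params N, p.WeightsLE c → p.ThetaMem → ∀ i,
      ‖p.gradW2 m μ l i‖ ≤ C := by
  obtain ⟨C, hC, hC'⟩ := exists_maskCost_W2_le m μ hA hdata (c + 1) l
  refine ⟨Fintype.card (Mask N) * C, by positivity, fun p hp hθ i => ?_⟩
  change ‖gradient (fun w => (p.setW2 l i w).costU m μ l i true) (p.W2 l i)‖ ≤ _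
  refine norm_gradient_le (by positivity) ?_
  filter_upwards [Metric.closedBall_mem_nhds (p.W2 l i) one_pos] with w hw
  have hle : ∀ v, ‖v‖ ≤ c + 1 → (p.setW2 l i v).WeightsLE (c + 1) :=
    fun v hv => hp.setW2 l i hv (by linarith)
  have hw' : ‖w‖ ≤ c + 1 := by
    have h1 := norm_sub_norm_le w (p.W2 l i)
    rw [← dist_eq_norm] at h1
    linarith [hp.W2_le l i, Metric.mem_closedBall.1 hw]
  have h0 : ‖p.W2 l i‖ ≤ c + 1 := (hp.W2_le l i).trans (by linarith)
  have hT' : (p.setW2 l i w).ThetaMem := ⟨hθ.θB_mem, hθ.θ1_mem, hθ.θ2_mem⟩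
  have hT : (((p.setW2 l i w).setB l 1).setU l i (bit true)).ThetaMem :=
    (hT'.setB l (by simp)).setU l i (bit_mem _)
  rw [Params.costU_eq, Params.costU_eq, mul_assoc]
  refine cost_sub_le m μ (p' := ((p.setW2 l i (p.W2 l i)).setB l 1).setU l i (bit true)) hT
    rfl rfl rfl fun ξ => ?_
  rw [Params.maskCost_congr m μ (p := ((p.setW2 l i w).setB l 1).setU l i (bit true))
      (p' := p.setW2 l i w) rfl rfl rfl,
    Params.maskCost_congr m μ (p := ((p.setW2 l i (p.W2 l i)).setB l 1).setU l i (bit true))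
      (p' := p.setW2 l i (p.W2 l i)) rfl rfl rfl]
  have := hC' _ _ (hle w hw') (hle (p.W2 l i) h0) rfl rfl
    (fun l' hl' => by simp [Params.setW2, hl']) i (fun j hj => by simp [Params.setW2, hj]) ξ
  have e : ∀ v, (p.setW2 l i v).W2 l i = v := fun v => by simp [Params.setW2]
  rwa [e, e] at this

lemma exists_costU_sub_le (hdata : DataMoments μ) (c : ℝ) (l : Fin N.L) :
    ∃ C : ℝ, 0 ≤ C ∧ ∀ p : Params N, p.WeightsLE c → p.ThetaMem → ∀ i,
      |p.costU m μ l i true - p.costU m μ l i false| ≤ C * ‖p.W1 l i‖ := by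
  obtain ⟨C, hC, hC'⟩ := exists_maskCost_flipU_le m μ hA hdata c l
  refine ⟨Fintype.card (Mask N) * C, by positivity, fun p hp hθ i => ?_⟩
  rw [Params.costU_eq, Params.costU_eq, mul_assoc]
  simp only [bit, if_true, Bool.false_eq_true, if_false]
  rw [Params.cost_setU_sub]
  refine Params.ThetaMem.abs_sum_maskProb_mul_le ((hθ.setB l (by simp)).setU l i (by simp)) _
    fun ξ => ?_
  exact hC' (p.setB l 1) ⟨hp.nonneg, hp.W1_le, hp.W2_le, hp.W3_le⟩ i ξ

/-- Cauchy–Schwarz turns the gradient bounds into the bounds on the inner products; the added `1`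
makes the constants strictly positive. -/
theorem exists_sensitivityBounds (hdata : DataMoments μ) (l : Fin N.L) (M r : ℝ) :
    ∃ η > 0, ∃ κ > 0, ∀ p : Params N, p.BoundedBy M → SensitivityBounds m μ p l r η κ := by
  obtain ⟨C1, h1, h1'⟩ := exists_norm_gradW1_le m μ hA hdata (max M r) l
  obtain ⟨C2, h2, h2'⟩ := exists_norm_gradW2_le m μ hA hdata (max M r) l
  obtain ⟨C3, h3, h3'⟩ := exists_costU_sub_le m μ hA hdata (max M r) l
  refine ⟨C1 + C2 + 1, by positivity, C3 + 1, by positivity, fun p hp s hs hs1 hs2 i => ?_⟩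
  have hW := hp.weightsLE_withBlock hs1 hs2
  have hθ := hp.thetaMem_withBlock hs
  have e1 := h1' _ hW hθ i
  have e2 := h2' _ hW hθ i
  have e3 := h3' _ hW hθ i
  have hw : (p.withBlock s).W1 l i = w1 s i := by simp [Params.withBlock]
  rw [hw] at e3
  refine ⟨(abs_real_inner_le_norm _ _).trans ?_, (abs_real_inner_le_norm _ _).trans ?_,
    e3.trans ?_⟩
  · rw [mul_comm]; gcongr; linarith
  · rw [mul_comm]; gcongr; linarith
  · gcongr
    · linarith
    · linarith [norm_nonneg (w2 s i)]

end Existence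

/-- Without active units `C¹` and `C⁰` agree, and `C⁰` ignores the unit parameters. So `C¹ - C⁰` is
the total change of `C¹` when the units are switched off one by one. By affinity, the step for unit
`i` changes it by `θ₁ᵢ` times the unit's cost difference. -/
lemma SensitivityBounds.abs_costB_sub_le {m : Model} {μ : Measure (E (N.d 0) × E (N.d N.L))}
    {p : Params N} {l : Fin N.L} {r η κ : ℝ} (h : SensitivityBounds m μ p l r η κ)
    {s : State N l} (hs : s ∈ box N l) (h1 : frob (w1 s) ≤ r) (h2 : frob (w2 s) ≤ r) :
    |(p.withBlock s).costB m μ l true - (p.withBlock s).costB m μ l false|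
      ≤ ∑ i, t1 s i * (κ * (‖w1 s i‖ + ‖w2 s i‖)) := by
  -- `σ S` is `s` with the units in `S` switched off. The weights are unchanged and the parameters
  -- stay in the box, so the sensitivity bounds hold at every intermediate state.
  let σ : Finset (Fin (N.k l)) → State N l := fun S =>
    (w1 s, w2 s, tB s, fun i => if i ∈ S then 0 else t1 s i)
  have hσ : ∀ S, σ S ∈ box N l := fun S => ⟨hs.1, fun i => by
    change (if i ∈ S then (0 : ℝ) else t1 s i) ∈ _
    split_ifs
    · simp
    · exact hs.2 i⟩
  have hset : ∀ (b : ℝ) (S : Finset (Fin (N.k l))) (i : Fin (N.k l)), i ∉ S →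
      ((p.withBlock (σ S)).setB l b).setU l i (t1 s i) = (p.withBlock (σ S)).setB l b ∧
      ((p.withBlock (σ S)).setB l b).setU l i 0 = (p.withBlock (σ (insert i S))).setB l b := by
    intro b S i hi
    have e1 : Function.update (t1 (σ S)) i (t1 s i) = t1 (σ S) := by
      rw [Function.update_eq_self_iff]
      simp [σ, t1, hi]
    have e2 : Function.update (t1 (σ S)) i 0 = t1 (σ (insert i S)) := by
      ext j
      by_cases hj : j = i
      · subst hj; simp [σ, t1]
      · simp [σ, t1, hj]
    constructor
    · simp only [Params.setU, Params.setB, Params.withBlock, Function.update_self,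
        Function.update_idem, e1]
    · simp only [Params.setU, Params.setB, Params.withBlock, Function.update_self,
        Function.update_idem, e2]
      rfl
  have key : ∀ S : Finset (Fin (N.k l)),
      |((p.withBlock (σ ∅)).setB l 1).cost m μ - ((p.withBlock (σ S)).setB l 1).cost m μ|
        ≤ ∑ i ∈ S, t1 s i * (κ * (‖w1 s i‖ + ‖w2 s i‖)) ∧
      ((p.withBlock (σ ∅)).setB l 0).cost m μ = ((p.withBlock (σ S)).setB l 0).cost m μ := by
    intro S
    induction S using Finset.induction_on with
    | empty => simp
    | insert i S hi ih =>
      obtain ⟨ih1, ih0⟩ := ih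
      constructor
      · rw [Finset.sum_insert hi]
        have e := ((p.withBlock (σ S)).setB l 1).cost_setU m μ l i (t1 s i)
        rw [(hset 1 S i hi).1, (hset 1 S i hi).2] at e
        have hb := (h (σ S) (hσ S) h1 h2 i).2.2
        rw [Params.costU_eq, Params.costU_eq] at hb
        simp only [bit, if_true, Bool.false_eq_true, if_false] at hb
        rw [(hset 1 S i hi).2] at hb
        have ht := (hs.2 i).1
        have := abs_sub_le (((p.withBlock (σ ∅)).setB l 1).cost m μ)
          (((p.withBlock (σ S)).setB l 1).cost m μ)
          (((p.withBlock (σ (insert i S))).setB l 1).cost m μ)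
        rw [e, abs_mul, abs_of_nonneg ht] at this
        have hb' := mul_le_mul_of_nonneg_left hb ht
        have hw1 : w1 (σ S) = w1 s := rfl
        have hw2 : w2 (σ S) = w2 s := rfl
        rw [hw1, hw2] at hb'
        linarith
      · rw [ih0, ← (hset 0 S i hi).1, Params.cost_setU_setB_zero, (hset 0 S i hi).2]
  have hempty : σ ∅ = s := by simp [σ, w1, w2, tB, t1]
  obtain ⟨k1, k0⟩ := key Finset.univ
  -- With all units off, `C⁰` is rewritten as `C¹`, so `k0` identifies `C⁰` at `s` with the endpoint
  -- of the telescoping estimate `k1`.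
  rw [← Params.cost_setB_of_θ1_eq_zero m μ (p.withBlock (σ Finset.univ)) l
    (by ext i; simp [Params.withBlock, σ, t1])] at k0
  rw [Params.costB_eq, Params.costB_eq]
  simp only [bit, if_true, Bool.false_eq_true, if_false]
  rw [hempty] at k1 k0
  rw [k0]
  exact k1

/-! ### Absolutely continuous curves and quadratic functions along them. -/

lemma intervalIntegrable_fun_sum {ι : Type*} [Fintype ι] {f : ι → ℝ → ℝ} {a b : ℝ}
    (h : ∀ i, IntervalIntegrable (f i) volume a b) :
    IntervalIntegrable (fun t => ∑ i, f i t) volume a b := by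
  have := IntervalIntegrable.sum Finset.univ fun i _ => h i
  rwa [Finset.sum_fn] at this

/-- `x` is an absolutely continuous curve on `[a, b]` with velocity `v`. -/
def HasVelocityOn {X : Type*} [NormedAddCommGroup X] [NormedSpace ℝ X] (x v : ℝ → X)
    (a b : ℝ) : Prop :=
  IntervalIntegrable v volume a b ∧ ∀ t ∈ Icc a b, x t = x a + ∫ s in a..t, v s

namespace HasVelocityOn

variable {X Y : Type*} [NormedAddCommGroup X] [NormedSpace ℝ X] [NormedAddCommGroup Y]
  [NormedSpace ℝ Y] {x v : ℝ → X} {a b : ℝ}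

lemma mono (h : HasVelocityOn x v a b) {c d : ℝ} (hac : a ≤ c) (hcd : c ≤ d) (hdb : d ≤ b) :
    HasVelocityOn x v c d := by
  have hi : ∀ s t, a ≤ s → s ≤ t → t ≤ b → IntervalIntegrable v volume s t :=
    fun s t h1 h2 h3 => h.1.mono_set (by
      rw [uIcc_of_le h2, uIcc_of_le (h1.trans (h2.trans h3))]; exact Icc_subset_Icc h1 h3)
  refine ⟨hi c d hac hcd hdb, fun t ht => ?_⟩
  rw [h.2 t ⟨hac.trans ht.1, ht.2.trans hdb⟩, h.2 c ⟨hac, hcd.trans hdb⟩, add_assoc,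
    intervalIntegral.integral_add_adjacent_intervals (hi a c le_rfl hac (hcd.trans hdb))
      (hi c t hac ht.1 (ht.2.trans hdb))]

lemma comp [CompleteSpace X] [CompleteSpace Y] (h : HasVelocityOn x v a b) (L : X →L[ℝ] Y) :
    HasVelocityOn (fun t => L (x t)) (fun t => L (v t)) a b := by
  refine ⟨⟨L.integrable_comp h.1.1, L.integrable_comp h.1.2⟩, fun t ht => ?_⟩
  have hi : IntervalIntegrable v volume a t := h.1.mono_set (by
    rw [uIcc_of_le ht.1, uIcc_of_le (ht.1.trans ht.2)]; exact Icc_subset_Icc_right ht.2)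
  dsimp only
  rw [h.2 t ht, map_add, L.intervalIntegral_comp_comm hi]

lemma continuousOn (h : HasVelocityOn x v a b) : ContinuousOn x (Icc a b) := by
  rcases le_or_gt a b with hab | hab
  · have h1 : ContinuousOn (fun t => x a + ∫ s in a..t, v s) (Icc a b) := by
      have := intervalIntegral.continuousOn_primitive_interval' h.1 left_mem_uIcc
      rw [uIcc_of_le hab] at this
      exact continuousOn_const.add this
    exact h1.congr h.2
  · rw [Icc_eq_empty hab.not_ge]; exact continuousOn_empty _

/-- Integration by parts for absolutely continuous functions; a pointwise chain rule would fail, as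
the velocity determines the derivative only almost everywhere. -/
lemma sq_sub_sq {u g : ℝ → ℝ} (hab : a ≤ b) (h : HasVelocityOn u g a b) :
    IntervalIntegrable (fun t => 2 * (u t * g t)) volume a b ∧
      u b ^ 2 - u a ^ 2 = ∫ t in a..b, 2 * (u t * g t) := by
  have hu : ContinuousOn u (uIcc a b) := by rw [uIcc_of_le hab]; exact h.continuousOn
  have hintg : IntervalIntegrable (fun t => 2 * (u t * g t)) volume a b :=
    (h.1.continuousOn_mul hu).const_mul 2
  refine ⟨hintg, ?_⟩
  -- The curve is controlled only on `[a, b]`, so the calculus is done for the primitive of its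
  -- velocity, which agrees with it there.
  set U : ℝ → ℝ := fun t => u a + ∫ s in a..t, g s with hU
  have hUac : AbsolutelyContinuousOnInterval U a b := by
    have hc : AbsolutelyContinuousOnInterval (fun _ : ℝ => u a) a b :=
      (LipschitzWith.const (u a)).lipschitzOnWith.absolutelyContinuousOnInterval
    exact hc.add (h.1.absolutelyContinuousOnInterval_intervalIntegral left_mem_uIcc)
  have hder : ∀ᵐ t, t ∈ uIcc a b → HasDerivAt U (g t) t := by
    filter_upwards [h.1.ae_hasDerivAt_integral] with t ht hmem
    exact (ht hmem a left_mem_uIcc).const_add (u a)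
  have key := hUac.integral_deriv_mul_eq_sub hUac
  have eb : U b = u b := (h.2 b ⟨hab, le_rfl⟩).symm
  have ea : U a = u a := (h.2 a ⟨le_rfl, hab⟩).symm
  rw [eb, ea] at key
  rw [sq, sq, ← key]
  refine intervalIntegral.integral_congr_ae ?_
  filter_upwards [hder] with t ht hmem
  have hm : t ∈ Icc a b := by rw [uIoc_of_le hab] at hmem; exact Ioc_subset_Icc_self hmem
  have hU' : U t = u t := (h.2 t hm).symm
  rw [(ht (by rwa [uIcc_of_le hab])).deriv, hU']
  ring

lemma normSq_sub_normSq {n : ℕ} {u g : ℝ → E n} (hab : a ≤ b) (h : HasVelocityOn u g a b) :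
    IntervalIntegrable (fun t => 2 * inner ℝ (u t) (g t)) volume a b ∧
      ‖u b‖ ^ 2 - ‖u a‖ ^ 2 = ∫ t in a..b, 2 * inner ℝ (u t) (g t) := by
  have hj : ∀ j : Fin n, _ := fun j =>
    sq_sub_sq hab (h.comp (EuclideanSpace.proj j : E n →L[ℝ] ℝ))
  change ∀ j : Fin n, IntervalIntegrable (fun t => 2 * (u t j * g t j)) volume a b ∧
    u b j ^ 2 - u a j ^ 2 = ∫ t in a..b, 2 * (u t j * g t j) at hj
  have e : (fun t => 2 * inner ℝ (u t) (g t)) = fun t => ∑ j, 2 * (u t j * g t j) := by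
    ext t
    rw [PiLp.inner_apply, Finset.mul_sum]
    exact Finset.sum_congr rfl fun j _ => by simp [mul_comm]
  rw [e]
  refine ⟨intervalIntegrable_fun_sum fun j => (hj j).1, ?_⟩
  rw [intervalIntegral.integral_finsetSum fun j _ => (hj j).1, EuclideanSpace.real_norm_sq_eq,
    EuclideanSpace.real_norm_sq_eq, ← Finset.sum_sub_distrib]
  exact Finset.sum_congr rfl fun j _ => (hj j).2

end HasVelocityOn

section Quad

variable {l : Fin N.L}

/-- A weighted sum of the squares of the components of the state. -/
def quad (c1 c2 cB : ℝ) (cU : Fin (N.k l) → ℝ) (s : State N l) : ℝ :=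
  c1 * frob (w1 s) ^ 2 + c2 * frob (w2 s) ^ 2 + cB * tB s ^ 2 + ∑ i, cU i * t1 s i ^ 2

/-- Half of the derivative of `quad` in the direction `v`. -/
def quadDeriv (c1 c2 cB : ℝ) (cU : Fin (N.k l) → ℝ) (s v : State N l) : ℝ :=
  c1 * ∑ i, inner ℝ (w1 s i) (w1 v i) + c2 * ∑ i, inner ℝ (w2 s i) (w2 v i)
    + cB * (tB s * tB v) + ∑ i, cU i * (t1 s i * t1 v i)

lemma continuous_quad (c1 c2 cB : ℝ) (cU : Fin (N.k l) → ℝ) :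
    Continuous (quad (N := N) c1 c2 cB cU) := by
  have h1 := (continuous_frob (ι := Fin (N.k l))).comp (continuous_w1 (N := N) (l := l))
  have h2 := (continuous_frob (ι := Fin (N.k l))).comp (continuous_w2 (N := N) (l := l))
  have h3 := continuous_tB (N := N) (l := l)
  have h4 : ∀ i, Continuous fun s : State N l => t1 s i := fun i =>
    (continuous_apply i).comp continuous_t1
  unfold quad
  exact (((continuous_const.mul (h1.pow 2)).add (continuous_const.mul (h2.pow 2))).add
    (continuous_const.mul (h3.pow 2))).add
    (continuous_finsetSum _ fun i _ => continuous_const.mul ((h4 i).pow 2))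

/-- Integrated chain rule for every diagonal quadratic function of the state, assembled component by
component. The four weights are kept free so that all Lyapunov functions below are instances. -/
lemma HasVelocityOn.quad_sub_quad {x v : ℝ → State N l} {a b : ℝ} (hab : a ≤ b)
    (h : HasVelocityOn x v a b) (c1 c2 cB : ℝ) (cU : Fin (N.k l) → ℝ) :
    IntervalIntegrable (fun t => 2 * quadDeriv c1 c2 cB cU (x t) (v t)) volume a b ∧
      quad c1 c2 cB cU (x b) - quad c1 c2 cB cU (x a)
        = ∫ t in a..b, 2 * quadDeriv c1 c2 cB cU (x t) (v t) := by
  have k1 : ∀ i, _ := fun i => HasVelocityOn.normSq_sub_normSq hab (h.comp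
    ((ContinuousLinearMap.proj (R := ℝ) (φ := fun _ : Fin (N.k l) => E (N.d l + 1)) i).comp
      (ContinuousLinearMap.fst ℝ _ _)))
  have k2 : ∀ i, _ := fun i => HasVelocityOn.normSq_sub_normSq hab (h.comp
    ((ContinuousLinearMap.proj (R := ℝ) (φ := fun _ : Fin (N.k l) => E (N.d (l + 1))) i).comp
      ((ContinuousLinearMap.fst ℝ _ _).comp (ContinuousLinearMap.snd ℝ _ _))))
  have k3 := HasVelocityOn.sq_sub_sq hab (h.comp ((ContinuousLinearMap.fst ℝ _ _).comp
      ((ContinuousLinearMap.snd ℝ _ _).comp (ContinuousLinearMap.snd ℝ _ _))))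
  have k4 : ∀ i, _ := fun i => HasVelocityOn.sq_sub_sq hab (h.comp
    ((ContinuousLinearMap.proj (R := ℝ) (φ := fun _ : Fin (N.k l) => ℝ) i).comp
      ((ContinuousLinearMap.snd ℝ _ _).comp
      ((ContinuousLinearMap.snd ℝ _ _).comp (ContinuousLinearMap.snd ℝ _ _)))))
  change ∀ i, IntervalIntegrable (fun t => 2 * inner ℝ (w1 (x t) i) (w1 (v t) i)) volume a b ∧
    ‖w1 (x b) i‖ ^ 2 - ‖w1 (x a) i‖ ^ 2 = ∫ t in a..b, 2 * inner ℝ (w1 (x t) i) (w1 (v t) i) at k1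
  change ∀ i, IntervalIntegrable (fun t => 2 * inner ℝ (w2 (x t) i) (w2 (v t) i)) volume a b ∧
    ‖w2 (x b) i‖ ^ 2 - ‖w2 (x a) i‖ ^ 2 = ∫ t in a..b, 2 * inner ℝ (w2 (x t) i) (w2 (v t) i) at k2
  change IntervalIntegrable (fun t => 2 * (tB (x t) * tB (v t))) volume a b ∧
    tB (x b) ^ 2 - tB (x a) ^ 2 = ∫ t in a..b, 2 * (tB (x t) * tB (v t)) at k3
  change ∀ i, IntervalIntegrable (fun t => 2 * (t1 (x t) i * t1 (v t) i)) volume a b ∧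
    t1 (x b) i ^ 2 - t1 (x a) i ^ 2 = ∫ t in a..b, 2 * (t1 (x t) i * t1 (v t) i) at k4
  have e : (fun t => 2 * quadDeriv c1 c2 cB cU (x t) (v t)) = fun t =>
      c1 * (∑ i, 2 * inner ℝ (w1 (x t) i) (w1 (v t) i))
      + c2 * (∑ i, 2 * inner ℝ (w2 (x t) i) (w2 (v t) i))
      + cB * (2 * (tB (x t) * tB (v t))) + ∑ i, cU i * (2 * (t1 (x t) i * t1 (v t) i)) := by
    ext t
    simp only [quadDeriv, ← Finset.mul_sum, mul_left_comm _ (2 : ℝ)]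
    ring
  have s1 : IntervalIntegrable (fun t => ∑ i, 2 * inner ℝ (w1 (x t) i) (w1 (v t) i)) volume a b :=
    intervalIntegrable_fun_sum fun i => (k1 i).1
  have s2 : IntervalIntegrable (fun t => ∑ i, 2 * inner ℝ (w2 (x t) i) (w2 (v t) i)) volume a b :=
    intervalIntegrable_fun_sum fun i => (k2 i).1
  have s4 : IntervalIntegrable (fun t => ∑ i, cU i * (2 * (t1 (x t) i * t1 (v t) i)))
      volume a b := intervalIntegrable_fun_sum fun i => (k4 i).1.const_mul (cU i)
  have i1 := s1.const_mul c1
  have i2 := s2.const_mul c2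
  have i3 := k3.1.const_mul cB
  rw [e]
  refine ⟨((i1.add i2).add i3).add s4, ?_⟩
  rw [intervalIntegral.integral_add ((i1.add i2).add i3) s4,
    intervalIntegral.integral_add (i1.add i2) i3, intervalIntegral.integral_add i1 i2,
    intervalIntegral.integral_const_mul, intervalIntegral.integral_const_mul,
    intervalIntegral.integral_const_mul,
    intervalIntegral.integral_finsetSum fun i _ => (k1 i).1,
    intervalIntegral.integral_finsetSum fun i _ => (k2 i).1,
    intervalIntegral.integral_finsetSum fun i _ => (k4 i).1.const_mul (cU i), ← k3.2]
  simp only [intervalIntegral.integral_const_mul]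
  have k4' : ∀ i, 2 * ∫ t in a..b, t1 (x t) i * t1 (v t) i = t1 (x b) i ^ 2 - t1 (x a) i ^ 2 :=
    fun i => by rw [(k4 i).2, intervalIntegral.integral_const_mul]
  have k1' : ∀ i, 2 * ∫ t in a..b, inner ℝ (w1 (x t) i) (w1 (v t) i)
      = ‖w1 (x b) i‖ ^ 2 - ‖w1 (x a) i‖ ^ 2 :=
    fun i => by rw [(k1 i).2, intervalIntegral.integral_const_mul]
  have k2' : ∀ i, 2 * ∫ t in a..b, inner ℝ (w2 (x t) i) (w2 (v t) i)
      = ‖w2 (x b) i‖ ^ 2 - ‖w2 (x a) i‖ ^ 2 :=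
    fun i => by rw [(k2 i).2, intervalIntegral.integral_const_mul]
  simp only [k1', k2', k4', mul_sub, Finset.sum_sub_distrib, quad, frob_sq]
  ring

lemma HasVelocityOn.quad_sub_le {x v : ℝ → State N l} {a b : ℝ} (hab : a ≤ b)
    (h : HasVelocityOn x v a b) (c1 c2 cB : ℝ) (cU : Fin (N.k l) → ℝ) {g : ℝ → ℝ}
    (hg : IntervalIntegrable g volume a b)
    (hle : ∀ t ∈ Icc a b, quadDeriv c1 c2 cB cU (x t) (v t) ≤ g t) :
    quad c1 c2 cB cU (x b) - quad c1 c2 cB cU (x a) ≤ 2 * ∫ t in a..b, g t := by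
  obtain ⟨h1, h2⟩ := h.quad_sub_quad hab c1 c2 cB cU
  rw [h2, ← intervalIntegral.integral_const_mul]
  exact intervalIntegral.integral_mono_on hab h1 (hg.const_mul 2) fun t ht => by
    linarith [hle t ht]

lemma HasVelocityOn.quad_le {x v : ℝ → State N l} {a b : ℝ} (hab : a ≤ b)
    (h : HasVelocityOn x v a b) (c1 c2 cB : ℝ) (cU : Fin (N.k l) → ℝ)
    (hle : ∀ t ∈ Icc a b, quadDeriv c1 c2 cB cU (x t) (v t) ≤ 0) :
    quad c1 c2 cB cU (x b) ≤ quad c1 c2 cB cU (x a) := by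
  have := h.quad_sub_le hab c1 c2 cB cU (g := fun _ => 0) (by simp) hle
  simp at this
  linarith

end Quad

/-! ### Differential inequalities for the projected field. -/

/-- In `θ²` the projection never hurts: at `0` it is multiplied by zero, and at `1` it pushes
inwards. -/
lemma mul_projected_le {θ g : ℝ} (hθ : θ ∈ Icc (0 : ℝ) 1) :
    θ * (-g - projTerm θ g) ≤ -(θ * g) := by
  unfold projTerm
  split_ifs with h0 h1
  · simp [h0]
  · subst h1
    linarith [le_max_right (-g) 0]
  · linarith

/-- The states with Bernoulli parameters in `[0, 1]` and weights of norm at most `r`. -/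
def weightBall (N : Net) (l : Fin N.L) (r : ℝ) : Set (State N l) :=
  {s | s ∈ box N l ∧ frob (w1 s) ≤ r ∧ frob (w2 s) ≤ r}

lemma weightBall.norm_add_norm_le {l : Fin N.L} {r : ℝ} {s : State N l} (hs : s ∈ weightBall N l r) (i : Fin (N.k l)) :
    ‖w1 s i‖ + ‖w2 s i‖ ≤ 2 * r := by
  linarith [(norm_le_frob _ i).trans hs.2.1, (norm_le_frob _ i).trans hs.2.2]

section FieldBounds

variable {m : Model} {μ : Measure (E (N.d 0) × E (N.d N.L))} {H : Hyper} {p : Params N}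
  {l : Fin N.L} {r η κ : ℝ} {s : State N l}

lemma SensitivityBounds.inner_w1_field_le (hS : SensitivityBounds m μ p l r η κ)
    (hs : s ∈ weightBall N l r) (i : Fin (N.k l)) :
    inner ℝ (w1 s i) (w1 (field m μ H p s) i)
      ≤ tB s * t1 s i * (η * ‖w1 s i‖) - H.lam * ‖w1 s i‖ ^ 2 := by
  obtain ⟨h1, -, -⟩ := hS s hs.1 hs.2.1 hs.2.2 i
  have ht : 0 ≤ tB s * t1 s i := mul_nonneg hs.1.1.1 (hs.1.2 i).1
  change inner ℝ (w1 s i) (-(tB s * t1 s i) • (p.withBlock s).gradW1 m μ l i - H.lam • w1 s i)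
    ≤ _
  rw [inner_sub_right, inner_smul_right, inner_smul_right, real_inner_self_eq_norm_sq]
  have := mul_le_mul_of_nonneg_left ((neg_le_abs _).trans h1) ht
  linarith

lemma SensitivityBounds.inner_w2_field_le (hS : SensitivityBounds m μ p l r η κ)
    (hs : s ∈ weightBall N l r) (i : Fin (N.k l)) :
    inner ℝ (w2 s i) (w2 (field m μ H p s) i)
      ≤ tB s * t1 s i * (η * ‖w2 s i‖) - H.lam * ‖w2 s i‖ ^ 2 := by
  obtain ⟨-, h1, -⟩ := hS s hs.1 hs.2.1 hs.2.2 i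
  have ht : 0 ≤ tB s * t1 s i := mul_nonneg hs.1.1.1 (hs.1.2 i).1
  change inner ℝ (w2 s i) (-(tB s * t1 s i) • (p.withBlock s).gradW2 m μ l i - H.lam • w2 s i)
    ≤ _
  rw [inner_sub_right, inner_smul_right, inner_smul_right, real_inner_self_eq_norm_sq]
  have := mul_le_mul_of_nonneg_left ((neg_le_abs _).trans h1) ht
  linarith

lemma SensitivityBounds.le_lossB (hS : SensitivityBounds m μ p l r η κ) (hH : H.Valid) {Rm : ℝ}
    (hR : Rm ≤ p.R H l) (hs : s ∈ weightBall N l r) :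
    ∑ i, t1 s i * (Rm - κ * (‖w1 s i‖ + ‖w2 s i‖)) ≤ lossB m μ H (p.withBlock s) l := by
  have h1 := (neg_le_of_abs_le (hS.abs_costB_sub_le hs.1 hs.2.1 hs.2.2))
  have h2 : ∑ i, |(p.withBlock s).θ1 l i| = ∑ i, t1 s i :=
    Finset.sum_congr rfl fun i _ => by
      simp [Params.withBlock, abs_of_nonneg (hs.1.2 i).1]
  have h3 : (p.withBlock s).R H l = p.R H l := rfl
  have h4 : 0 ≤ H.nu * H.α := mul_nonneg hH.nu_pos.le hH.α_nonneg
  have h5 : 0 ≤ ∑ i, t1 s i := Finset.sum_nonneg fun i _ => (hs.1.2 i).1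
  have h6 := mul_le_mul_of_nonneg_left hR h5
  rw [lossB, h2, h3]
  simp only [mul_sub, Finset.sum_sub_distrib, ← Finset.sum_mul]
  linarith

lemma SensitivityBounds.le_lossU (hS : SensitivityBounds m μ p l r η κ) {Rm : ℝ}
    (hR : Rm ≤ p.R H l) (hs : s ∈ weightBall N l r) (i : Fin (N.k l)) :
    tB s * (Rm - κ * (‖w1 s i‖ + ‖w2 s i‖)) ≤ lossU m μ H (p.withBlock s) l i := by
  obtain ⟨-, -, h1⟩ := hS s hs.1 hs.2.1 hs.2.2 i
  have h2 : (p.withBlock s).θB l = tB s := by simp [Params.withBlock]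
  have h3 : (p.withBlock s).R H l = p.R H l := rfl
  rw [lossU, h2, h3]
  refine mul_le_mul_of_nonneg_left ?_ hs.1.1.1
  linarith [neg_le_of_abs_le h1]

/-- The master inequality. The gradient terms, the `θ_B` equation and the `θ₁ᵢ` equation all carry
the same factor `θ_B θ₁ᵢ`, so each unit can be balanced on its own: growth of its weights, at rate
`η`, against the gain from the regularization. -/
lemma SensitivityBounds.quadDeriv_field_le (hS : SensitivityBounds m μ p l r η κ) (hH : H.Valid)
    {Rm : ℝ} (hR : Rm ≤ p.R H l) (hs : s ∈ weightBall N l r) {c1 c2 cB : ℝ}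
    {cU : Fin (N.k l) → ℝ} (h1 : 0 ≤ c1) (h2 : 0 ≤ c2) (hB : 0 ≤ cB) (hU : ∀ i, 0 ≤ cU i) :
    quadDeriv c1 c2 cB cU s (field m μ H p s) ≤
      ∑ i, tB s * t1 s i * (η * (c1 * ‖w1 s i‖ + c2 * ‖w2 s i‖)
        - (cB + cU i) * (Rm - κ * (‖w1 s i‖ + ‖w2 s i‖)))
      - H.lam * (c1 * frob (w1 s) ^ 2 + c2 * frob (w2 s) ^ 2) := by
  have e1 := mul_le_mul_of_nonneg_left
    (Finset.sum_le_sum fun i (_ : i ∈ Finset.univ) => hS.inner_w1_field_le (H := H) hs i) h1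
  have e2 := mul_le_mul_of_nonneg_left
    (Finset.sum_le_sum fun i (_ : i ∈ Finset.univ) => hS.inner_w2_field_le (H := H) hs i) h2
  have e3 : tB s * tB (field m μ H p s)
      ≤ -(tB s * ∑ i, t1 s i * (Rm - κ * (‖w1 s i‖ + ‖w2 s i‖))) := by
    refine (mul_projected_le hs.1.1).trans (neg_le_neg ?_)
    exact mul_le_mul_of_nonneg_left (hS.le_lossB hH hR hs) hs.1.1.1
  have e4 : ∀ i ∈ (Finset.univ : Finset (Fin (N.k l))), cU i * (t1 s i * t1 (field m μ H p s) i)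
      ≤ cU i * -(t1 s i * (tB s * (Rm - κ * (‖w1 s i‖ + ‖w2 s i‖)))) := fun i _ => by
    refine mul_le_mul_of_nonneg_left ((mul_projected_le (hs.1.2 i)).trans (neg_le_neg ?_)) (hU i)
    exact mul_le_mul_of_nonneg_left (hS.le_lossU hR hs i) (hs.1.2 i).1
  have e3' := mul_le_mul_of_nonneg_left e3 hB
  have e4' := Finset.sum_le_sum e4
  refine (add_le_add (add_le_add (add_le_add e1 e2) e3') e4').trans (le_of_eq ?_)
  rw [frob_sq, frob_sq]
  simp only [Finset.mul_sum, mul_add, ← Finset.sum_neg_distrib, ← Finset.sum_add_distrib,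
    ← Finset.sum_sub_distrib]
  exact Finset.sum_congr rfl fun i _ => by ring

end FieldBounds

/-- The standing assumptions on the evolution `P` of the rest of the network, on the constants
`Rm`, `η`, `κ`, and on the radius `r = Rm / (4 (η + κ))`. -/
structure Regime (m : Model) (μ : Measure (E (N.d 0) × E (N.d N.L))) (H : Hyper) (l : Fin N.L)
    (P : ℝ → Params N) (Rm r η κ : ℝ) : Prop where
  valid : H.Valid
  η_pos : 0 < η
  κ_pos : 0 < κ
  r_pos : 0 < r
  r_eq : (η + κ) * r = Rm / 4
  R_ge : ∀ t, 0 ≤ t → Rm ≤ (P t).R H l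
  sens : ∀ t, 0 ≤ t → SensitivityBounds m μ (P t) l r η κ

/-- The rate at which the Lyapunov function decreases. -/
def dissipation (H : Hyper) {l : Fin N.L} (Rm : ℝ) (s : State N l) : ℝ :=
  Rm / 2 * (tB s * ∑ i, t1 s i) + H.lam * (frob (w1 s) ^ 2 + frob (w2 s) ^ 2)

lemma continuous_dissipation (H : Hyper) {l : Fin N.L} (Rm : ℝ) :
    Continuous (dissipation (N := N) (l := l) H Rm) := by
  have h1 := (continuous_frob (ι := Fin (N.k l))).comp (continuous_w1 (N := N) (l := l))
  have h2 := (continuous_frob (ι := Fin (N.k l))).comp (continuous_w2 (N := N) (l := l))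
  have h3 := continuous_tB (N := N) (l := l)
  have h4 : ∀ i, Continuous fun s : State N l => t1 s i := fun i =>
    (continuous_apply i).comp continuous_t1
  unfold dissipation
  exact (continuous_const.mul (h3.mul (continuous_finsetSum _ fun i _ => h4 i))).add
    (continuous_const.mul ((h1.pow 2).add (h2.pow 2)))

namespace Regime

variable {m : Model} {μ : Measure (E (N.d 0) × E (N.d N.L))} {H : Hyper} {l : Fin N.L}
  {P : ℝ → Params N} {Rm r η κ : ℝ} (h : Regime m μ H l P Rm r η κ)
include h

lemma Rm_pos : 0 < Rm := by
  have := mul_pos (add_pos h.η_pos h.κ_pos) h.r_pos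
  linarith [h.r_eq]

/-- Both norms are at most `r`, and `2 κ r ≤ 2 (η + κ) r = Rm / 2`. -/
lemma half_le {s : State N l} (hs : s ∈ weightBall N l r) (i : Fin (N.k l)) :
    Rm / 2 ≤ Rm - κ * (‖w1 s i‖ + ‖w2 s i‖) := by
  have h1 := mul_le_mul_of_nonneg_left (weightBall.norm_add_norm_le hs i) h.κ_pos.le
  have h2 := mul_pos h.η_pos h.r_pos
  linarith [h.r_eq]

lemma lossB_nonneg {t : ℝ} (ht : 0 ≤ t) {s : State N l} (hs : s ∈ weightBall N l r) :
    0 ≤ lossB m μ H ((P t).withBlock s) l := by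
  refine le_trans (Finset.sum_nonneg fun i _ => ?_)
    ((h.sens t ht).le_lossB h.valid (h.R_ge t ht) hs)
  exact mul_nonneg (hs.1.2 i).1 ((half_pos h.Rm_pos).le.trans (h.half_le hs i))

lemma lossU_nonneg {t : ℝ} (ht : 0 ≤ t) {s : State N l} (hs : s ∈ weightBall N l r)
    (i : Fin (N.k l)) : 0 ≤ lossU m μ H ((P t).withBlock s) l i :=
  le_trans (mul_nonneg hs.1.1.1 ((half_pos h.Rm_pos).le.trans (h.half_le hs i)))
    ((h.sens t ht).le_lossU (h.R_ge t ht) hs i)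

/-- Per unit the bracket is at most `(η + κ) * 2 r - Rm = -Rm / 2`; this is what the radius `r` is
chosen for. -/
lemma quadDeriv_lyap_le {t : ℝ} (ht : 0 ≤ t) {s : State N l} (hs : s ∈ weightBall N l r) :
    quadDeriv 1 1 1 0 s (field m μ H (P t) s) ≤ -dissipation H Rm s := by
  refine ((h.sens t ht).quadDeriv_field_le h.valid (h.R_ge t ht) hs zero_le_one zero_le_one
    zero_le_one fun _ => le_rfl).trans ?_
  rw [dissipation, Finset.mul_sum, Finset.mul_sum, neg_add, ← Finset.sum_neg_distrib]
  refine add_le_add (Finset.sum_le_sum fun i _ => ?_) (le_of_eq (by ring))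
  have h0 : 0 ≤ tB s * t1 s i := mul_nonneg hs.1.1.1 (hs.1.2 i).1
  have h1 := mul_le_mul_of_nonneg_left (weightBall.norm_add_norm_le hs i) (add_pos h.η_pos h.κ_pos).le
  have h2 : η * (1 * ‖w1 s i‖ + 1 * ‖w2 s i‖)
      - (1 + (0 : Fin (N.k l) → ℝ) i) * (Rm - κ * (‖w1 s i‖ + ‖w2 s i‖)) ≤ -(Rm / 2) := by
    rw [Pi.zero_apply]
    linarith [h.r_eq]
  exact (mul_le_mul_of_nonneg_left h2 h0).trans (le_of_eq (by ring))

lemma dissipation_nonneg {s : State N l} (hs : s ∈ box N l) : 0 ≤ dissipation H Rm s := by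
  have h1 := h.Rm_pos
  have h2 := h.valid.lam_pos
  have h3 : 0 ≤ tB s * ∑ i, t1 s i :=
    mul_nonneg hs.1.1 (Finset.sum_nonneg fun i _ => (hs.2 i).1)
  unfold dissipation
  positivity

/-- Weights zero on `W₁`, `W₂` leave only the gain from the regularization, so each Bernoulli
parameter separately is nonincreasing. -/
lemma quadDeriv_theta_le {t : ℝ} (ht : 0 ≤ t) {s : State N l} (hs : s ∈ weightBall N l r)
    {cB : ℝ} {cU : Fin (N.k l) → ℝ} (hB : 0 ≤ cB) (hU : ∀ i, 0 ≤ cU i) :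
    quadDeriv 0 0 cB cU s (field m μ H (P t) s) ≤ 0 := by
  refine ((h.sens t ht).quadDeriv_field_le h.valid (h.R_ge t ht) hs le_rfl le_rfl hB hU).trans ?_
  simp only [zero_mul, add_zero, mul_zero, zero_sub, sub_zero]
  refine Finset.sum_nonpos fun i _ => ?_
  have h0 : 0 ≤ tB s * t1 s i := mul_nonneg hs.1.1.1 (hs.1.2 i).1
  have h1 := (half_pos h.Rm_pos).le.trans (h.half_le hs i)
  have := mul_nonneg h0 (mul_nonneg (add_nonneg hB (hU i)) h1)
  linarith

/-- The unit parameters, weighted by a large constant, control the growth of the weights. -/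
lemma quadDeriv_units_le {t : ℝ} (ht : 0 ≤ t) {s : State N l} (hs : s ∈ weightBall N l r) :
    quadDeriv 1 1 0 (fun _ => 4 * η * r / Rm) s (field m μ H (P t) s) ≤ 0 := by
  have hR := h.Rm_pos
  have hη := h.η_pos
  have hr := h.r_pos
  refine ((h.sens t ht).quadDeriv_field_le h.valid (h.R_ge t ht) hs zero_le_one zero_le_one
    le_rfl fun _ => by positivity).trans ?_
  have h2 := h.valid.lam_pos
  have h3 : 0 ≤ H.lam * (1 * frob (w1 s) ^ 2 + 1 * frob (w2 s) ^ 2) := by positivity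
  rw [sub_nonpos]
  refine le_trans (Finset.sum_nonpos fun i _ => ?_) h3
  have h0 : 0 ≤ tB s * t1 s i := mul_nonneg hs.1.1.1 (hs.1.2 i).1
  refine mul_nonpos_of_nonneg_of_nonpos h0 ?_
  have h4 := mul_le_mul_of_nonneg_left (weightBall.norm_add_norm_le hs i) hη.le
  have h5 : 4 * η * r / Rm * (Rm / 2) ≤ 4 * η * r / Rm * (Rm - κ * (‖w1 s i‖ + ‖w2 s i‖)) :=
    mul_le_mul_of_nonneg_left (h.half_le hs i) (by positivity)
  -- The weight `4 η r / Rm` is chosen so that a gain of at least `Rm / 2` per unit offsets the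
  -- gradient growth, at most `2 η r`.
  have h6 : 4 * η * r / Rm * (Rm / 2) = 2 * η * r := by field_simp; ring
  linarith

end Regime

/-! ### Continuous induction and monotone quantities along trajectories. -/

lemma exists_Icc_forall_mem_of_isOpen {X : Type*} [TopologicalSpace X] {x : ℝ → X} {a b s : ℝ}
    (hx : ContinuousOn x (Icc a b)) (hs : s ∈ Ico a b) {U : Set X} (hU : IsOpen U)
    (hxs : x s ∈ U) : ∃ u, s < u ∧ u ≤ b ∧ ∀ τ ∈ Icc s u, x τ ∈ U := by
  have h1 : ∀ᶠ τ in 𝓝[≥] s, x τ ∈ U := by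
    have h2 : ContinuousWithinAt x (Icc s b) s :=
      (hx s ⟨hs.1, hs.2.le⟩).mono (Icc_subset_Icc_left hs.1)
    have h3 := h2.eventually_mem (hU.mem_nhds hxs)
    rwa [nhdsWithin_Icc_eq_nhdsGE hs.2] at h3
  obtain ⟨u, hu, hsub⟩ := mem_nhdsGE_iff_exists_Icc_subset.1 h1
  exact ⟨min u b, lt_min hu hs.2, min_le_right _ _,
    fun τ hτ => hsub ⟨hτ.1, hτ.2.trans (min_le_left _ _)⟩⟩

/-- Continuous induction to the right on an interval. -/
lemma forall_mem_of_continuation {X : Type*} [TopologicalSpace X] {x : ℝ → X} {a b : ℝ}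
    (hx : ContinuousOn x (Icc a b)) {C : Set X} (hC : IsClosed C) (ha : x a ∈ C)
    (hstep : ∀ s ∈ Ico a b, x s ∈ C → ∃ u, s < u ∧ ∀ τ ∈ Ioo s u, τ ≤ b → x τ ∈ C) :
    ∀ t ∈ Icc a b, x t ∈ C := by
  have hcl : IsClosed ({t | x t ∈ C} ∩ Icc a b) := by
    have := hx.preimage_isClosed_of_isClosed isClosed_Icc hC
    rwa [inter_comm] at this
  refine hcl.Icc_subset_of_forall_mem_nhdsWithin ha ?_
  rintro s ⟨hs, hs'⟩
  obtain ⟨u, hu, hu'⟩ := hstep s hs' hs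
  have : Ioo s (min u b) ∈ 𝓝[>] s := Ioo_mem_nhdsGT (lt_min hu hs'.2)
  filter_upwards [this] with τ hτ
  exact hu' τ ⟨hτ.1, hτ.2.trans_le (min_le_left _ _)⟩ (hτ.2.le.trans (min_le_right _ _))

/-- A quantity that does not increase while it stays below a level cannot reach that level. -/
lemma le_of_nonincreasing_below {y : ℝ → ℝ} {a b d : ℝ} (hy : ContinuousOn y (Icc a b))
    (ha : y a < d) (hstep : ∀ s t, a ≤ s → s ≤ t → t ≤ b → (∀ τ ∈ Icc s t, y τ < d) → y t ≤ y s) :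
    ∀ t ∈ Icc a b, y t ≤ y a := by
  refine forall_mem_of_continuation hy isClosed_Iic self_mem_Iic fun s hs hys => ?_
  -- The value is strictly below `d`, so by continuity it stays there for a short time, during which
  -- `hstep` applies.
  obtain ⟨u, hu, hub, hu'⟩ := exists_Icc_forall_mem_of_isOpen hy hs isOpen_Iio
    (lt_of_le_of_lt hys ha)
  refine ⟨u, hu, fun τ hτ _ => ?_⟩
  exact (hstep s τ hs.1 hτ.1.le (hτ.2.le.trans hub)
    fun σ hσ => hu' σ ⟨hσ.1, hσ.2.trans hτ.2.le⟩).trans hys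

lemma IsSolutionOn.hasVelocityOn {X : Type*} [NormedAddCommGroup X] [NormedSpace ℝ X]
    {f : ℝ → X → X} {B : Set X} {x : ℝ → X} {a b : ℝ} (h : IsSolutionOn f B x a b) :
    HasVelocityOn x (fun t => f t (x t)) a b := h.2

section QuadValues

variable {l : Fin N.L}

lemma quad_lyap (s : State N l) :
    quad 1 1 1 0 s = frob (w1 s) ^ 2 + frob (w2 s) ^ 2 + tB s ^ 2 := by
  simp [quad]

lemma quad_tB (s : State N l) : quad 0 0 1 0 s = tB s ^ 2 := by simp [quad]

lemma quad_t1 (s : State N l) (i : Fin (N.k l)) :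
    quad 0 0 0 (Pi.single i 1) s = t1 s i ^ 2 := by
  simp [quad, Pi.single_apply]

lemma quad_units (c : ℝ) (s : State N l) :
    quad 1 1 0 (fun _ => c) s = frob (w1 s) ^ 2 + frob (w2 s) ^ 2 + c * ∑ i, t1 s i ^ 2 := by
  simp [quad, Finset.mul_sum]

lemma mem_DB_iff {Rm r η κ : ℝ} (hr : r = Rm / (4 * (η + κ))) (s : State N l) :
    s ∈ DB N l Rm η κ ↔ s ∈ box N l ∧ quad 1 1 1 0 s ≤ r ^ 2 := by
  have e : Rm ^ 2 / (16 * (η + κ) ^ 2) = r ^ 2 := by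
    rw [hr, div_pow]; ring
  rw [quad_lyap, DB, mem_ofPred_eq, lyap, e]
  constructor
  · rintro ⟨h1, h2⟩; exact ⟨h1, by linarith⟩
  · rintro ⟨h1, h2⟩; exact ⟨h1, by linarith⟩

end QuadValues

lemma isClosed_box {l : Fin N.L} : IsClosed (box N l) := by
  have h4 : ∀ i, Continuous fun s : State N l => t1 s i := fun i =>
    (continuous_apply i).comp continuous_t1
  have e : box N l = tB ⁻¹' Icc (0 : ℝ) 1 ∩ ⋂ i, (fun s : State N l => t1 s i) ⁻¹' Icc 0 1 := by
    ext s; simp [box]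
  rw [e]
  exact (isClosed_Icc.preimage continuous_tB).inter
    (isClosed_iInter fun i => isClosed_Icc.preimage (h4 i))

namespace Regime

variable {m : Model} {μ : Measure (E (N.d 0) × E (N.d N.L))} {H : Hyper} {l : Fin N.L}
  {P : ℝ → Params N} {Rm r η κ : ℝ} (h : Regime m μ H l P Rm r η κ)
include h

lemma radius_eq : r = Rm / (4 * (η + κ)) := by
  have := add_pos h.η_pos h.κ_pos
  have := h.r_eq
  field_simp
  linarith

omit h in
lemma mem_weightBall_of_quad_le (hr : 0 < r) {s : State N l} (hs : s ∈ box N l)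
    (hq : quad 1 1 1 0 s ≤ r ^ 2) : s ∈ weightBall N l r := by
  rw [quad_lyap] at hq
  refine ⟨hs, ?_, ?_⟩
  · exact abs_le_of_sq_le_sq' (by nlinarith [sq_nonneg (frob (w2 s)), sq_nonneg (tB s)]) hr.le |>.2
  · exact abs_le_of_sq_le_sq' (by nlinarith [sq_nonneg (frob (w1 s)), sq_nonneg (tB s)]) hr.le |>.2

section Trajectory

variable {x : ℝ → State N l} {a b : ℝ} (ha : 0 ≤ a) (hab : a ≤ b)
  (hx : HasVelocityOn x (fun t => field m μ H (P t) (x t)) a b)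
  (hQ : ∀ t ∈ Icc a b, x t ∈ weightBall N l r)
include ha hab hx hQ

lemma lyap_sub_le : quad 1 1 1 0 (x b) - quad 1 1 1 0 (x a)
    ≤ 2 * ∫ t in a..b, -dissipation H Rm (x t) := by
  refine hx.quad_sub_le hab 1 1 1 0 ?_ fun t ht =>
    h.quadDeriv_lyap_le (ha.trans ht.1) (hQ t ht)
  refine ContinuousOn.intervalIntegrable ?_
  rw [uIcc_of_le hab]
  exact ((continuous_dissipation H Rm).comp_continuousOn hx.continuousOn).neg

lemma lyap_le : quad 1 1 1 0 (x b) ≤ quad 1 1 1 0 (x a) :=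
  hx.quad_le hab 1 1 1 0 fun t ht => (h.quadDeriv_lyap_le (ha.trans ht.1) (hQ t ht)).trans
    (neg_nonpos.2 (h.dissipation_nonneg (hQ t ht).1))

lemma units_le : quad 1 1 0 (fun _ => 4 * η * r / Rm) (x b)
    ≤ quad 1 1 0 (fun _ => 4 * η * r / Rm) (x a) :=
  hx.quad_le hab _ _ _ _ fun t ht => h.quadDeriv_units_le (ha.trans ht.1) (hQ t ht)

lemma tB_le : tB (x b) ≤ tB (x a) := by
  have := hx.quad_le hab 0 0 1 0 fun t ht =>
    h.quadDeriv_theta_le (ha.trans ht.1) (hQ t ht) zero_le_one fun _ => le_rfl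
  rw [quad_tB, quad_tB] at this
  exact (abs_le_of_sq_le_sq' this (hQ a ⟨le_rfl, hab⟩).1.1.1).2

lemma t1_le (i : Fin (N.k l)) : t1 (x b) i ≤ t1 (x a) i := by
  have := hx.quad_le hab 0 0 0 (Pi.single i 1) fun t ht =>
    h.quadDeriv_theta_le (ha.trans ht.1) (hQ t ht) le_rfl fun j => by
      by_cases hj : j = i
      · subst hj; simp
      · simp [hj]
  rw [quad_t1, quad_t1] at this
  exact (abs_le_of_sq_le_sq' this ((hQ a ⟨le_rfl, hab⟩).1.2 i).1).2

end Trajectory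

end Regime

/-! ### Invariance of `D_B` and of `E_B`. -/

/-- Near a state on the boundary of the weight ball with `θ_B` small, the norms of the weights
decrease. -/
lemma SensitivityBounds.quadDeriv_weights_nonpos {m : Model}
    {μ : Measure (E (N.d 0) × E (N.d N.L))} {H : Hyper} {p : Params N} {l : Fin N.L}
    {r η κ : ℝ} {s : State N l} (hS : SensitivityBounds m μ p l r η κ)
    (hη : 0 ≤ η) (hs : s ∈ weightBall N l r) {c1 c2 : ℝ} (h1 : 0 ≤ c1)
    (h2 : 0 ≤ c2) (hlt : tB s * (N.k l * (η * (c1 * r + c2 * r)))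
      ≤ H.lam * (c1 * frob (w1 s) ^ 2 + c2 * frob (w2 s) ^ 2)) :
    quadDeriv c1 c2 0 0 s (field m μ H p s) ≤ 0 := by
  have e1 := mul_le_mul_of_nonneg_left
    (Finset.sum_le_sum fun i (_ : i ∈ Finset.univ) => hS.inner_w1_field_le (H := H) hs i) h1
  have e2 := mul_le_mul_of_nonneg_left
    (Finset.sum_le_sum fun i (_ : i ∈ Finset.univ) => hS.inner_w2_field_le (H := H) hs i) h2
  have e3 : quadDeriv c1 c2 0 0 s (field m μ H p s)
      ≤ (∑ i, tB s * t1 s i * (η * (c1 * ‖w1 s i‖ + c2 * ‖w2 s i‖)))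
        - H.lam * (c1 * frob (w1 s) ^ 2 + c2 * frob (w2 s) ^ 2) := by
    simp only [quadDeriv, zero_mul, add_zero, Pi.zero_apply, Finset.sum_const_zero]
    refine (add_le_add e1 e2).trans (le_of_eq ?_)
    rw [frob_sq, frob_sq]
    simp only [Finset.mul_sum, mul_add, ← Finset.sum_add_distrib, ← Finset.sum_sub_distrib]
    exact Finset.sum_congr rfl fun i _ => by ring
  have e4 : ∀ i ∈ (Finset.univ : Finset (Fin (N.k l))),
      tB s * t1 s i * (η * (c1 * ‖w1 s i‖ + c2 * ‖w2 s i‖))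
        ≤ tB s * (η * (c1 * r + c2 * r)) := fun i _ => by
    have b1 := (norm_le_frob _ i).trans hs.2.1
    have b2 := (norm_le_frob _ i).trans hs.2.2
    have b3 := hs.1.1.1
    have b4 := hs.1.2 i
    have b5 : tB s * t1 s i ≤ tB s := mul_le_of_le_one_right b3 b4.2
    have b6 := b4.1
    gcongr
  have e5 := (Finset.sum_le_card_nsmul _ _ _ e4).trans (le_of_eq (by simp; ring :
    _ = tB s * (N.k l * (η * (c1 * r + c2 * r)))))
  linarith

namespace Regime

variable {m : Model} {μ : Measure (E (N.d 0) × E (N.d N.L))} {H : Hyper} {l : Fin N.L}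
  {P : ℝ → Params N} {Rm r η κ : ℝ} (h : Regime m μ H l P Rm r η κ)
include h

/-- Right after leaving a state of `D_B`, the weights still have norm at most `r`. -/
lemma exists_forall_mem_weightBall {η' κ' : ℝ} (hη' : 0 ≤ η')
    (hS' : ∀ t, 0 ≤ t → SensitivityBounds m μ (P t) l (r + 1) η' κ') {x : ℝ → State N l}
    {a b : ℝ} (ha : 0 ≤ a) (hbox : ∀ t ∈ Icc a b, x t ∈ box N l)
    (hx : HasVelocityOn x (fun t => field m μ H (P t) (x t)) a b) {s : ℝ} (hs : s ∈ Ico a b)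
    (hq : quad 1 1 1 0 (x s) ≤ r ^ 2) :
    ∃ u, s < u ∧ u ≤ b ∧ ∀ τ ∈ Icc s u, x τ ∈ weightBall N l r := by
  have hr := h.r_pos
  have hlam := h.valid.lam_pos
  have c1 : Continuous fun s : State N l => frob (w1 s) := continuous_frob.comp continuous_w1
  have c2 : Continuous fun s : State N l => frob (w2 s) := continuous_frob.comp continuous_w2
  have c3 := continuous_tB (N := N) (l := l)
  have hxs := mem_weightBall_of_quad_le hr (hbox s ⟨hs.1, hs.2.le⟩) hq
  rw [quad_lyap] at hq
  -- Away from the sphere of radius `r`, continuity suffices. A state of `D_B` on the sphere has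
  -- spent its whole budget on one weight matrix, so the other one and `θ_B` vanish.
  rcases hxs.2.1.lt_or_eq with h1 | h1
  · rcases hxs.2.2.lt_or_eq with h2 | h2
    · obtain ⟨u, hu, hub, hu'⟩ := exists_Icc_forall_mem_of_isOpen hx.continuousOn hs
        ((isOpen_lt c1 continuous_const).inter (isOpen_lt c2 continuous_const)) ⟨h1, h2⟩
      exact ⟨u, hu, hub, fun τ hτ => ⟨hbox τ ⟨hs.1.trans hτ.1, hτ.2.trans hub⟩,
        (hu' τ hτ).1.le, (hu' τ hτ).2.le⟩⟩
    · have hB0 : tB (x s) = 0 := by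
        rw [h2] at hq
        have := sq_nonneg (frob (w1 (x s)))
        exact pow_eq_zero_iff two_ne_zero |>.1 (le_antisymm (by linarith) (sq_nonneg _))
      -- Since `θ_B = 0` and `‖W₂‖ = r > 0` at time `s`, weight decay dominates the gradient term
      -- nearby. The bounds on the larger ball of radius `r + 1` are needed because the bound `r` on
      -- `‖W₂‖` is yet to be shown.
      obtain ⟨u, hu, hub, hu'⟩ := exists_Icc_forall_mem_of_isOpen hx.continuousOn hs
        (((isOpen_lt c1 continuous_const).inter (isOpen_lt c2 continuous_const)).inter
          (isOpen_lt (c3.mul continuous_const) (continuous_const.mul (c2.pow 2))))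
        (U := ({y | frob (w1 y) < r} ∩ {y | frob (w2 y) < r + 1}) ∩
          {y | tB y * (N.k l * (η' * (0 * (r + 1) + 1 * (r + 1)))) < H.lam * frob (w2 y) ^ 2})
        ⟨⟨h1, by rw [mem_ofPred_eq, h2]; linarith⟩, by
          rw [mem_ofPred_eq, hB0, h2, zero_mul]; positivity⟩
      refine ⟨u, hu, hub, fun τ hτ => ⟨hbox τ ⟨hs.1.trans hτ.1, hτ.2.trans hub⟩,
        (hu' τ hτ).1.1.le, ?_⟩⟩
      have hv := hx.mono hs.1 hτ.1 (hτ.2.trans hub)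
      have := hv.quad_le hτ.1 0 1 0 0 fun σ hσ => by
        have hσ' := hu' σ ⟨hσ.1, hσ.2.trans hτ.2⟩
        have hlt := hσ'.2
        rw [mem_ofPred_eq] at hlt
        refine (hS' σ (ha.trans (hs.1.trans hσ.1))).quadDeriv_weights_nonpos hη'
          ⟨hbox σ ⟨hs.1.trans hσ.1, hσ.2.trans (hτ.2.trans hub)⟩,
            hσ'.1.1.le.trans (by linarith), hσ'.1.2.le⟩ le_rfl zero_le_one ?_
        linarith
      simp only [quad, zero_mul, one_mul, zero_add, add_zero, Pi.zero_apply,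
        Finset.sum_const_zero] at this
      rw [h2] at this
      exact (abs_le_of_sq_le_sq' this hr.le).2
  · have hB0 : tB (x s) = 0 := by
      rw [h1] at hq
      have := sq_nonneg (frob (w2 (x s)))
      exact pow_eq_zero_iff two_ne_zero |>.1 (le_antisymm (by linarith) (sq_nonneg _))
    have h2 : frob (w2 (x s)) < r := by
      rw [h1] at hq
      have h3 : frob (w2 (x s)) = 0 := pow_eq_zero_iff two_ne_zero |>.1
        (le_antisymm (by linarith [sq_nonneg (tB (x s))]) (sq_nonneg _))
      rwa [h3]
    -- The same argument with the roles of `W₁` and `W₂` exchanged.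
    obtain ⟨u, hu, hub, hu'⟩ := exists_Icc_forall_mem_of_isOpen hx.continuousOn hs
      (((isOpen_lt c2 continuous_const).inter (isOpen_lt c1 continuous_const)).inter
        (isOpen_lt (c3.mul continuous_const) (continuous_const.mul (c1.pow 2))))
      (U := ({y | frob (w2 y) < r} ∩ {y | frob (w1 y) < r + 1}) ∩
        {y | tB y * (N.k l * (η' * (1 * (r + 1) + 0 * (r + 1)))) < H.lam * frob (w1 y) ^ 2})
      ⟨⟨h2, by rw [mem_ofPred_eq, h1]; linarith⟩, by
        rw [mem_ofPred_eq, hB0, h1, zero_mul]; positivity⟩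
    refine ⟨u, hu, hub, fun τ hτ => ⟨hbox τ ⟨hs.1.trans hτ.1, hτ.2.trans hub⟩, ?_,
      (hu' τ hτ).1.1.le⟩⟩
    have hv := hx.mono hs.1 hτ.1 (hτ.2.trans hub)
    have := hv.quad_le hτ.1 1 0 0 0 fun σ hσ => by
      have hσ' := hu' σ ⟨hσ.1, hσ.2.trans hτ.2⟩
      have hlt := hσ'.2
      rw [mem_ofPred_eq] at hlt
      refine (hS' σ (ha.trans (hs.1.trans hσ.1))).quadDeriv_weights_nonpos hη'
        ⟨hbox σ ⟨hs.1.trans hσ.1, hσ.2.trans (hτ.2.trans hub)⟩, hσ'.1.2.le,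
          hσ'.1.1.le.trans (by linarith)⟩ zero_le_one le_rfl ?_
      linarith
    simp only [quad, zero_mul, one_mul, add_zero, Pi.zero_apply,
      Finset.sum_const_zero] at this
    rw [h1] at this
    exact (abs_le_of_sq_le_sq' this hr.le).2

/-- Solutions that start in `D_B` stay in `D_B`. -/
lemma quad_le_of_start {η' κ' : ℝ} (hη' : 0 ≤ η')
    (hS' : ∀ t, 0 ≤ t → SensitivityBounds m μ (P t) l (r + 1) η' κ') {x : ℝ → State N l}
    {a b : ℝ} (ha : 0 ≤ a) (hbox : ∀ t ∈ Icc a b, x t ∈ box N l)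
    (hx : HasVelocityOn x (fun t => field m μ H (P t) (x t)) a b)
    (hq : quad 1 1 1 0 (x a) ≤ r ^ 2) : ∀ t ∈ Icc a b, quad 1 1 1 0 (x t) ≤ r ^ 2 := by
  refine forall_mem_of_continuation (C := {y | quad 1 1 1 0 y ≤ r ^ 2}) hx.continuousOn
    (isClosed_le (continuous_quad _ _ _ _) continuous_const) hq fun s hs hqs => ?_
  obtain ⟨u, hu, hub, hu'⟩ := h.exists_forall_mem_weightBall hη' hS' ha hbox hx hs hqs
  refine ⟨u, hu, fun τ hτ _ => ?_⟩
  exact (h.lyap_le (ha.trans hs.1) hτ.1.le (hx.mono hs.1 hτ.1.le (hτ.2.le.trans hub))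
    fun σ hσ => hu' σ ⟨hσ.1, hσ.2.trans hτ.2.le⟩).trans hqs

/-- With zero weights the level condition of `D_B` becomes `θ_B ≤ r`, and the product condition
splits `E_B` into its two pieces. -/
lemma mem_EB_iff {s : State N l} : s ∈ EB N l Rm η κ ↔
    s ∈ box N l ∧ tB s ≤ r ∧ w1 s = 0 ∧ w2 s = 0 ∧ (tB s = 0 ∨ t1 s = 0) := by
  have hr := h.r_pos
  rw [EB, mem_ofPred_eq, mem_DB_iff h.radius_eq, quad_lyap]
  constructor
  · rintro ⟨⟨hb, hq⟩, h1, h2, h3⟩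
    refine ⟨hb, ?_, h1, h2, ?_⟩
    · rw [h1, h2, frob_zero, frob_zero] at hq
      exact (abs_le_of_sq_le_sq' (by linarith) hr.le).2
    · rcases mul_eq_zero.1 h3 with h4 | h4
      · right
        ext i
        exact abs_eq_zero.1 ((Finset.sum_eq_zero_iff_of_nonneg fun i _ => abs_nonneg _).1 h4 i
          (Finset.mem_univ i))
      · exact Or.inl h4
  · rintro ⟨hb, hq, h1, h2, h3⟩
    refine ⟨⟨hb, ?_⟩, h1, h2, ?_⟩
    · rw [h1, h2, frob_zero, frob_zero]
      have := pow_le_pow_left₀ hb.1.1 hq 2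
      linarith
    · rcases h3 with h3 | h3
      · rw [h3, mul_zero]
      · simp [h3]

/-- On each piece a nonnegative quadratic function vanishes initially and cannot increase: `Λ_B` if
`θ_B = 0`, the function weighted with the unit parameters if `θ₁ = 0`. -/
theorem invariant_EB {η' κ' : ℝ} (hη' : 0 ≤ η')
    (hS' : ∀ t, 0 ≤ t → SensitivityBounds m μ (P t) l (r + 1) η' κ') :
    Invariant (fun t => field m μ H (P t)) (box N l) (EB N l Rm η κ) := by
  intro t₀ T x ht₀ hsol hstart t ht
  have hv := hsol.hasVelocityOn
  have hbox := hsol.1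
  have hR := h.Rm_pos
  have hη := h.η_pos
  have hr := h.r_pos
  have hq := ((mem_DB_iff h.radius_eq _).1 hstart.1).2
  have hall := h.quad_le_of_start hη' hS' ht₀ hbox hv hq
  have hQ : ∀ τ ∈ Icc t₀ T, x τ ∈ weightBall N l r := fun τ hτ =>
    mem_weightBall_of_quad_le hr (hbox τ hτ) (hall τ hτ)
  have hvt := hv.mono le_rfl ht.1 ht.2
  have hQt : ∀ τ ∈ Icc t₀ t, x τ ∈ weightBall N l r := fun τ hτ => hQ τ ⟨hτ.1, hτ.2.trans ht.2⟩
  rw [h.mem_EB_iff] at hstart ⊢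
  obtain ⟨hb0, hr0, h1, h2, h3⟩ := hstart
  have hfrob : ∀ {n : ℕ} (W : Fin (N.k l) → E n), frob W ^ 2 ≤ 0 → W = 0 := fun W hW => by
    have h0 : frob W = 0 := pow_eq_zero_iff two_ne_zero |>.1 (le_antisymm hW (sq_nonneg _))
    exact norm_le_zero_iff.1 ((norm_pi_le_frob W).trans h0.le)
  refine ⟨hbox t ht, (h.tB_le ht₀ ht.1 hvt hQt).trans hr0, ?_⟩
  rcases h3 with h3 | h3
  · have key := h.lyap_le ht₀ ht.1 hvt hQt
    rw [quad_lyap, quad_lyap, h1, h2, h3, frob_zero, frob_zero] at key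
    have s1 := sq_nonneg (frob (w1 (x t)))
    have s2 := sq_nonneg (frob (w2 (x t)))
    have s3 := sq_nonneg (tB (x t))
    exact ⟨hfrob _ (by linarith), hfrob _ (by linarith),
      Or.inl (pow_eq_zero_iff two_ne_zero |>.1 (le_antisymm (by linarith) s3))⟩
  · have key := h.units_le ht₀ ht.1 hvt hQt
    have ht1 : t1 (x t) = 0 := by
      ext i
      have := h.t1_le ht₀ ht.1 hvt hQt i
      rw [h3] at this
      exact le_antisymm this ((hbox t ht).2 i).1
    rw [quad_units, quad_units, h1, h2, h3, ht1, frob_zero, frob_zero] at key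
    simp only [Pi.zero_apply, ne_eq, OfNat.ofNat_ne_zero, not_false_eq_true, zero_pow,
      Finset.sum_const_zero, mul_zero, add_zero] at key
    have s1 := sq_nonneg (frob (w1 (x t)))
    have s2 := sq_nonneg (frob (w2 (x t)))
    exact ⟨hfrob _ (by linarith), hfrob _ (by linarith), Or.inr ht1⟩

end Regime

/-! ### Stability and attraction. -/

lemma exists_tendsto_of_nonincreasing {f : ℝ → ℝ} {a : ℝ}
    (hf : ∀ s t, a ≤ s → s ≤ t → f t ≤ f s) (h0 : ∀ t, a ≤ t → 0 ≤ f t) :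
    ∃ L, 0 ≤ L ∧ Tendsto f atTop (𝓝 L) := by
  have hanti : Antitone fun t => f (max t a) := fun s t hst =>
    hf _ _ (le_max_right _ _) (max_le_max_right a hst)
  have hbdd : BddBelow (range fun t => f (max t a)) :=
    ⟨0, by rintro _ ⟨t, rfl⟩; exact h0 _ (le_max_right _ _)⟩
  have h1 := tendsto_atTop_ciInf hanti hbdd
  refine ⟨_, le_ciInf fun t => h0 _ (le_max_right _ _), h1.congr' ?_⟩
  filter_upwards [eventually_ge_atTop a] with t ht
  rw [max_eq_left ht]

section StateNorm

variable {l : Fin N.L}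

lemma dist_state_le {s s' : State N l} {c : ℝ} (h1 : ‖w1 s - w1 s'‖ ≤ c)
    (h2 : ‖w2 s - w2 s'‖ ≤ c) (h3 : |tB s - tB s'| ≤ c) (h4 : ‖t1 s - t1 s'‖ ≤ c) :
    dist s s' ≤ c := by
  rw [Prod.dist_eq, Prod.dist_eq, Prod.dist_eq, dist_eq_norm, dist_eq_norm, dist_eq_norm,
    dist_eq_norm]
  exact max_le h1 (max_le h2 (max_le h3 h4))

lemma norm_w1_sub_le (s s' : State N l) : ‖w1 s - w1 s'‖ ≤ dist s s' := by
  rw [Prod.dist_eq, ← dist_eq_norm]; exact le_max_left _ _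

lemma norm_w2_sub_le (s s' : State N l) : ‖w2 s - w2 s'‖ ≤ dist s s' := by
  rw [Prod.dist_eq, Prod.dist_eq, ← dist_eq_norm]
  exact le_max_of_le_right (le_max_left _ _)

lemma abs_tB_sub_le (s s' : State N l) : |tB s - tB s'| ≤ dist s s' := by
  rw [Prod.dist_eq, Prod.dist_eq, Prod.dist_eq, ← Real.dist_eq]
  exact le_max_of_le_right (le_max_of_le_right (le_max_left _ _))

lemma norm_t1_sub_le (s s' : State N l) : ‖t1 s - t1 s'‖ ≤ dist s s' := by
  rw [Prod.dist_eq, Prod.dist_eq, Prod.dist_eq, ← dist_eq_norm]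
  exact le_max_of_le_right (le_max_of_le_right (le_max_right _ _))

end StateNorm

namespace Regime

variable {m : Model} {μ : Measure (E (N.d 0) × E (N.d N.L))} {H : Hyper} {l : Fin N.L}
  {P : ℝ → Params N} {Rm r η κ : ℝ} (h : Regime m μ H l P Rm r η κ)
include h

/-- The comparison point sets the weights and `θ_B` to zero and keeps `θ₁`. -/
lemma infDist_le_of_tB {s : State N l} (hs : s ∈ box N l) {c : ℝ} (h1 : frob (w1 s) ≤ c)
    (h2 : frob (w2 s) ≤ c) (h3 : tB s ≤ c) : Metric.infDist s (EB N l Rm η κ) ≤ c := by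
  have hc : 0 ≤ c := (frob_nonneg _).trans h1
  have hmem : ((0, 0, 0, t1 s) : State N l) ∈ EB N l Rm η κ := by
    rw [h.mem_EB_iff]
    exact ⟨⟨by simp [tB], hs.2⟩, h.r_pos.le, rfl, rfl, Or.inl rfl⟩
  refine (Metric.infDist_le_dist_of_mem hmem).trans (dist_state_le ?_ ?_ ?_ ?_)
  · exact (sub_zero (w1 s)).symm ▸ (norm_pi_le_frob _).trans h1
  · exact (sub_zero (w2 s)).symm ▸ (norm_pi_le_frob _).trans h2
  · change |tB s - 0| ≤ c
    rwa [sub_zero, abs_of_nonneg hs.1.1]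
  · change ‖t1 s - t1 s‖ ≤ c
    rwa [sub_self, norm_zero]

/-- The comparison point sets the weights and `θ₁` to zero and cuts `θ_B` off at `r`, the largest
value `E_B` admits. The slack `r + c` matters for starting points outside `D_B`. -/
lemma infDist_le_of_t1 {s : State N l} (hs : s ∈ box N l) {c : ℝ} (h1 : frob (w1 s) ≤ c)
    (h2 : frob (w2 s) ≤ c) (h3 : tB s ≤ r + c) (h4 : ∀ i, t1 s i ≤ c) :
    Metric.infDist s (EB N l Rm η κ) ≤ c := by
  have hc : 0 ≤ c := (frob_nonneg _).trans h1
  have hmem : ((0, 0, min (tB s) r, 0) : State N l) ∈ EB N l Rm η κ := by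
    rw [h.mem_EB_iff]
    exact ⟨⟨⟨le_min hs.1.1 h.r_pos.le, (min_le_left _ _).trans hs.1.2⟩, fun i => by simp [t1]⟩,
      min_le_right _ _, rfl, rfl, Or.inr rfl⟩
  refine (Metric.infDist_le_dist_of_mem hmem).trans (dist_state_le ?_ ?_ ?_ ?_)
  · exact (sub_zero (w1 s)).symm ▸ (norm_pi_le_frob _).trans h1
  · exact (sub_zero (w2 s)).symm ▸ (norm_pi_le_frob _).trans h2
  · change |tB s - min (tB s) r| ≤ c
    rw [abs_of_nonneg (sub_nonneg.2 (min_le_left _ _))]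
    rcases min_cases (tB s) r with ⟨e, _⟩ | ⟨e, _⟩ <;> rw [e] <;> linarith
  · change ‖t1 s - 0‖ ≤ c
    rw [sub_zero]
    refine (pi_norm_le_iff_of_nonneg hc).2 fun i => ?_
    rw [Real.norm_eq_abs, abs_of_nonneg (hs.2 i).1]
    exact h4 i

/-- Depending on the piece of `E_B` near which the solution starts, one of the two quadratic
functions is small and stays so. Its level below `r ^ 2` also keeps the solution in the weight ball,
where the estimates hold, even if it starts outside `D_B`. -/
theorem stable_EB : Stable (fun t => field m μ H (P t)) (box N l) (EB N l Rm η κ) := by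
  intro ε hε
  have hR := h.Rm_pos
  have hη := h.η_pos
  have hr := h.r_pos
  set c := 4 * η * r / Rm with hc
  have hc0 : 0 ≤ c := by positivity
  -- Both functions are at most `A * δ ^ 2` initially: `N.k l * δ ^ 2` for each weight matrix, `δ ^
  -- 2` for `θ_B`, `c * N.k l * δ ^ 2` for `θ₁`.
  set A : ℝ := 2 * N.k l + 1 + c * N.k l with hA
  have hA1 : 1 ≤ A := by
    have : (0 : ℝ) ≤ 2 * N.k l + c * N.k l := by positivity
    linarith
  -- `ρ` bounds the final distance, hence `ε / 2`; being below `r`, it keeps solutions in the weight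
  -- ball.
  set ρ := min (ε / 2) (r / 2) with hρ
  have hρ0 : 0 < ρ := lt_min (half_pos hε) (half_pos hr)
  set δ := ρ / A with hδ
  have hδ0 : 0 < δ := by positivity
  have hδρ : δ ≤ ρ := div_le_self hρ0.le hA1
  have hAδ : A * δ ^ 2 ≤ ρ ^ 2 := by
    have : A * δ = ρ := by rw [hδ]; field_simp
    calc A * δ ^ 2 = (A * δ) * δ := by ring
      _ = ρ * δ := by rw [this]
      _ ≤ ρ ^ 2 := by rw [sq]; gcongr
  have hρr : ρ < r := (min_le_right _ _).trans_lt (half_lt_self hr)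
  have hρε : ρ < ε := (min_le_left _ _).trans_lt (half_lt_self hε)
  refine ⟨δ, hδ0, fun t₀ T x ht₀ hsol hx0 t ht => ?_⟩
  have hv := hsol.hasVelocityOn
  have hbox := hsol.1
  have hab : t₀ ≤ T := ht.1.trans ht.2
  have hne : (EB N l Rm η κ).Nonempty := ⟨0, by
    rw [h.mem_EB_iff]
    exact ⟨⟨by simp [tB], fun i => by simp [t1]⟩, hr.le, rfl, rfl, Or.inl rfl⟩⟩
  obtain ⟨e, he, hde⟩ := (Metric.infDist_lt_iff hne).1 hx0
  rw [h.mem_EB_iff] at he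
  obtain ⟨-, her, he1, he2, he3⟩ := he
  have hb0 := hbox t₀ ⟨le_rfl, hab⟩
  have d1 := (norm_w1_sub_le (x t₀) e).trans hde.le
  have d2 := (norm_w2_sub_le (x t₀) e).trans hde.le
  have d3 := (abs_tB_sub_le (x t₀) e).trans hde.le
  have d4 := (norm_t1_sub_le (x t₀) e).trans hde.le
  rw [he1, sub_zero] at d1
  rw [he2, sub_zero] at d2
  have f1 : frob (w1 (x t₀)) ^ 2 ≤ N.k l * δ ^ 2 := (frob_sq_le _).trans (by
    rw [Fintype.card_fin]; gcongr)
  have f2 : frob (w2 (x t₀)) ^ 2 ≤ N.k l * δ ^ 2 := (frob_sq_le _).trans (by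
    rw [Fintype.card_fin]; gcongr)
  have hk : (0 : ℝ) ≤ N.k l * δ ^ 2 := by positivity
  have hck : 0 ≤ c * (N.k l * δ ^ 2) := by positivity
  have hρr2 : ρ ^ 2 < r ^ 2 := by gcongr
  have hsub : ∀ τ ∈ Icc t₀ T, ∀ d, 0 ≤ d → frob (w1 (x τ)) ^ 2 + frob (w2 (x τ)) ^ 2 ≤ d ^ 2 →
      frob (w1 (x τ)) ≤ d ∧ frob (w2 (x τ)) ≤ d := fun τ _ d hd hle =>
    ⟨(abs_le_of_sq_le_sq' (by linarith [sq_nonneg (frob (w2 (x τ)))]) hd).2,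
      (abs_le_of_sq_le_sq' (by linarith [sq_nonneg (frob (w1 (x τ)))]) hd).2⟩
  rcases he3 with he3 | he3
  · rw [he3, sub_zero, abs_of_nonneg hb0.1.1] at d3
    have hstart : quad 1 1 1 0 (x t₀) ≤ ρ ^ 2 := by
      rw [quad_lyap]
      have : tB (x t₀) ^ 2 ≤ δ ^ 2 := pow_le_pow_left₀ hb0.1.1 d3 2
      refine le_trans ?_ hAδ
      rw [hA]
      linarith
    have key := le_of_nonincreasing_below (y := fun t => quad 1 1 1 0 (x t))
      ((continuous_quad 1 1 1 0).comp_continuousOn hv.continuousOn) (hstart.trans_lt hρr2)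
      fun s t hs hst htT hlt => h.lyap_le (ht₀.trans hs) hst (hv.mono hs hst htT) fun τ hτ =>
        mem_weightBall_of_quad_le hr (hbox τ ⟨hs.trans hτ.1, hτ.2.trans htT⟩) (hlt τ hτ).le
    have hq := (key t ht).trans hstart
    rw [quad_lyap] at hq
    have hw := hsub t ht ρ hρ0.le (by linarith [sq_nonneg (tB (x t))])
    have hB := (abs_le_of_sq_le_sq' (by
      linarith [sq_nonneg (frob (w1 (x t))), sq_nonneg (frob (w2 (x t)))] :
      tB (x t) ^ 2 ≤ ρ ^ 2) hρ0.le).2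
    exact (h.infDist_le_of_tB (hbox t ht) hw.1 hw.2 hB).trans_lt hρε
  -- Here `θ_B` may be as large as `r + δ`, so `Λ_B` gives nothing; `θ_B` is controlled by
  -- monotonicity alone.
  · rw [he3, sub_zero] at d4
    have d4' : ∀ i, t1 (x t₀) i ≤ δ := fun i =>
      (le_abs_self _).trans ((abs_apply_le_norm _ i).trans d4)
    have hnn : ∀ τ, 0 ≤ c * ∑ i, t1 (x τ) i ^ 2 := fun τ => by positivity
    have hstart : quad 1 1 0 (fun _ => c) (x t₀) ≤ ρ ^ 2 := by
      rw [quad_units]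
      have : ∑ i, t1 (x t₀) i ^ 2 ≤ N.k l * δ ^ 2 :=
        (Finset.sum_le_card_nsmul _ _ (δ ^ 2) fun i _ =>
          pow_le_pow_left₀ (hb0.2 i).1 (d4' i) 2).trans (le_of_eq (by simp))
      have := mul_le_mul_of_nonneg_left this hc0
      refine le_trans ?_ hAδ
      rw [hA]
      linarith [sq_nonneg δ]
    have hQ' : ∀ τ ∈ Icc t₀ T, quad 1 1 0 (fun _ => c) (x τ) < r ^ 2 →
        x τ ∈ weightBall N l r := fun τ hτ hlt => by
      rw [quad_units] at hlt
      have := hsub τ hτ r hr.le (by linarith [hnn τ])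
      exact ⟨hbox τ hτ, this.1, this.2⟩
    have key := le_of_nonincreasing_below (y := fun t => quad 1 1 0 (fun _ => c) (x t))
      ((continuous_quad 1 1 0 fun _ => c).comp_continuousOn hv.continuousOn)
      (hstart.trans_lt hρr2)
      fun s t hs hst htT hlt => h.units_le (ht₀.trans hs) hst (hv.mono hs hst htT) fun τ hτ =>
        hQ' τ ⟨hs.trans hτ.1, hτ.2.trans htT⟩ (hlt τ hτ)
    have hQ : ∀ τ ∈ Icc t₀ t, x τ ∈ weightBall N l r := fun τ hτ =>
      hQ' τ ⟨hτ.1, hτ.2.trans ht.2⟩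
        (((key τ ⟨hτ.1, hτ.2.trans ht.2⟩).trans hstart).trans_lt hρr2)
    have hvt := hv.mono le_rfl ht.1 ht.2
    have hq := (key t ht).trans hstart
    rw [quad_units] at hq
    have hw := hsub t ht ρ hρ0.le (by linarith [hnn t])
    have hB := h.tB_le ht₀ ht.1 hvt hQ
    have h1 := fun i => (h.t1_le ht₀ ht.1 hvt hQ i).trans ((d4' i).trans hδρ)
    refine (h.infDist_le_of_t1 (hbox t ht) hw.1 hw.2 ?_ h1).trans_lt hρε
    linarith [(abs_le.1 d3).2]

/-- Solutions in `D_B` approach `E_B`. -/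
theorem tendsto_infDist {η' κ' : ℝ} (hη' : 0 ≤ η')
    (hS' : ∀ t, 0 ≤ t → SensitivityBounds m μ (P t) l (r + 1) η' κ') {x : ℝ → State N l}
    {a : ℝ} (ha : 0 ≤ a)
    (hsol : ∀ T ≥ a, IsSolutionOn (fun t => field m μ H (P t)) (box N l) x a T)
    (hstart : x a ∈ DB N l Rm η κ) :
    Tendsto (fun t => Metric.infDist (x t) (EB N l Rm η κ)) atTop (𝓝 0) := by
  have hR := h.Rm_pos
  have hr := h.r_pos
  have hlam := h.valid.lam_pos
  have hq := ((mem_DB_iff h.radius_eq _).1 hstart).2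
  have hbox : ∀ t, a ≤ t → x t ∈ box N l := fun t ht => (hsol t ht).1 t ⟨ht, le_rfl⟩
  have hall : ∀ t, a ≤ t → quad 1 1 1 0 (x t) ≤ r ^ 2 := fun t ht =>
    h.quad_le_of_start hη' hS' ha (hsol t ht).1 (hsol t ht).hasVelocityOn hq t ⟨ht, le_rfl⟩
  have hQ : ∀ t, a ≤ t → x t ∈ weightBall N l r := fun t ht =>
    mem_weightBall_of_quad_le hr (hbox t ht) (hall t ht)
  have hv : ∀ s t, a ≤ s → s ≤ t →
      HasVelocityOn x (fun t => field m μ H (P t) (x t)) s t := fun s t hs hst =>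
    (hsol t (hs.trans hst)).hasVelocityOn.mono hs hst le_rfl
  have hQI : ∀ s t, a ≤ s → ∀ τ ∈ Icc s t, x τ ∈ weightBall N l r := fun s t hs τ hτ =>
    hQ τ (hs.trans hτ.1)
  obtain ⟨Y, hY0, hY⟩ := exists_tendsto_of_nonincreasing (f := fun t => quad 1 1 1 0 (x t))
    (a := a) (fun s t hs hst => h.lyap_le (ha.trans hs) hst (hv s t hs hst) (hQI s t hs))
    fun t _ => by rw [quad_lyap]; positivity
  obtain ⟨B, hB0, hB⟩ := exists_tendsto_of_nonincreasing (f := fun t => tB (x t))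
    (a := a) (fun s t hs hst => h.tB_le (ha.trans hs) hst (hv s t hs hst) (hQI s t hs))
    fun t ht => (hbox t ht).1.1
  obtain ⟨S, hS0, hS⟩ := exists_tendsto_of_nonincreasing (f := fun t => ∑ i, t1 (x t) i)
    (a := a) (fun s t hs hst => Finset.sum_le_sum fun i _ =>
      h.t1_le (ha.trans hs) hst (hv s t hs hst) (hQI s t hs) i)
    fun t ht => Finset.sum_nonneg fun i _ => ((hbox t ht).2 i).1
  have hU : Tendsto (fun t => frob (w1 (x t)) ^ 2 + frob (w2 (x t)) ^ 2) atTop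
      (𝓝 (Y - B ^ 2)) := by
    refine (hY.sub (hB.pow 2)).congr fun t => ?_
    rw [quad_lyap]; ring
  have hU0 : 0 ≤ Y - B ^ 2 := ge_of_tendsto' hU fun t => by positivity
  have hD : Tendsto (fun t => dissipation H Rm (x t)) atTop
      (𝓝 (Rm / 2 * (B * S) + H.lam * (Y - B ^ 2))) :=
    ((hB.mul hS).const_mul _).add (hU.const_mul _)
  set D := Rm / 2 * (B * S) + H.lam * (Y - B ^ 2) with hDdef
  have hBS : 0 ≤ Rm / 2 * (B * S) := by positivity
  have hlU : 0 ≤ H.lam * (Y - B ^ 2) := mul_nonneg hlam.le hU0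
  -- If the limit `D` of the dissipation were positive, `2 Λ_B` would eventually fall at rate at
  -- least `D`.
  have hDzero : D = 0 := by
    by_contra hne
    have hDpos : 0 < D := lt_of_le_of_ne (add_nonneg hBS hlU) (Ne.symm hne)
    obtain ⟨T₀, hT₀⟩ := eventually_atTop.1
      ((hD.eventually (lt_mem_nhds (half_lt_self hDpos))).and (eventually_ge_atTop a))
    have hT₀a : a ≤ T₀ := (hT₀ T₀ le_rfl).2
    set y₀ := quad 1 1 1 0 (x T₀) with hy₀
    have hy₀0 : 0 ≤ y₀ := by rw [hy₀, quad_lyap]; positivity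
    -- By this time `2 Λ_B`, which is `y₀` at `T₀`, has lost `y₀ + 1` and is negative.
    set t := T₀ + (y₀ + 1) / D with ht
    have hle : T₀ ≤ t := by rw [ht]; linarith [div_nonneg (by linarith : 0 ≤ y₀ + 1) hDpos.le]
    have h1 := h.lyap_sub_le (ha.trans hT₀a) hle (hv T₀ t hT₀a hle) (hQI T₀ t hT₀a)
    have hcont : ContinuousOn (fun τ => -dissipation H Rm (x τ)) (uIcc T₀ t) := by
      rw [uIcc_of_le hle]
      exact ((continuous_dissipation H Rm).comp_continuousOn
        (hv T₀ t hT₀a hle).continuousOn).neg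
    have h2 : ∫ τ in T₀..t, -dissipation H Rm (x τ) ≤ ∫ _ in T₀..t, -(D / 2) :=
      intervalIntegral.integral_mono_on hle hcont.intervalIntegrable (by simp) fun τ hτ => by
        linarith [(hT₀ τ hτ.1).1]
    rw [intervalIntegral.integral_const, smul_eq_mul] at h2
    have h3 : 0 ≤ quad 1 1 1 0 (x t) := by rw [quad_lyap]; positivity
    have h4 : (t - T₀) * D = y₀ + 1 := by rw [ht]; field_simp; ring
    linarith
  have hU' : Y - B ^ 2 = 0 := by
    have : H.lam * (Y - B ^ 2) = 0 := by linarith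
    exact (mul_eq_zero.1 this).resolve_left hlam.ne'
  have hBS' : B * S = 0 := by
    have : Rm / 2 * (B * S) = 0 := by linarith
    exact (mul_eq_zero.1 this).resolve_left (by positivity)
  rw [hU'] at hU
  have hsqrt : Tendsto (fun t => √(frob (w1 (x t)) ^ 2 + frob (w2 (x t)) ^ 2)) atTop (𝓝 0) := by
    simpa [Function.comp_def] using (Real.continuous_sqrt.tendsto 0).comp hU
  have hw : ∀ t, frob (w1 (x t)) ≤ √(frob (w1 (x t)) ^ 2 + frob (w2 (x t)) ^ 2) ∧
      frob (w2 (x t)) ≤ √(frob (w1 (x t)) ^ 2 + frob (w2 (x t)) ^ 2) := fun t =>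
    ⟨Real.le_sqrt_of_sq_le (by linarith [sq_nonneg (frob (w2 (x t)))]),
      Real.le_sqrt_of_sq_le (by linarith [sq_nonneg (frob (w1 (x t)))])⟩
  have hnonneg : ∀ᶠ t in atTop, 0 ≤ Metric.infDist (x t) (EB N l Rm η κ) :=
    Eventually.of_forall fun t => Metric.infDist_nonneg
  -- Either `θ_B` or `‖θ₁‖₁` tends to zero; each case approaches its own piece of `E_B`.
  rcases mul_eq_zero.1 hBS' with hz | hz
  · rw [hz] at hB
    have hlim := hsqrt.add hB
    rw [add_zero] at hlim
    refine squeeze_zero' hnonneg ?_ hlim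
    filter_upwards [eventually_ge_atTop a] with t ht
    have hb := (hbox t ht).1.1
    have hs := Real.sqrt_nonneg (frob (w1 (x t)) ^ 2 + frob (w2 (x t)) ^ 2)
    exact h.infDist_le_of_tB (hbox t ht) ((hw t).1.trans (by linarith))
      ((hw t).2.trans (by linarith)) (by linarith)
  · rw [hz] at hS
    have hlim := hsqrt.add hS
    rw [add_zero] at hlim
    refine squeeze_zero' hnonneg ?_ hlim
    filter_upwards [eventually_ge_atTop a] with t ht
    have hb : 0 ≤ ∑ i, t1 (x t) i := Finset.sum_nonneg fun i _ => ((hbox t ht).2 i).1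
    have hs := Real.sqrt_nonneg (frob (w1 (x t)) ^ 2 + frob (w2 (x t)) ^ 2)
    have hBr : tB (x t) ≤ r := (abs_le_of_sq_le_sq' (by
      have := hall t ht
      rw [quad_lyap] at this
      linarith [sq_nonneg (frob (w1 (x t))), sq_nonneg (frob (w2 (x t)))]) hr.le).2
    refine h.infDist_le_of_t1 (hbox t ht) ((hw t).1.trans (by linarith))
      ((hw t).2.trans (by linarith)) (by linarith) fun i => ?_
    have := Finset.single_le_sum (f := fun i => t1 (x t) i)
      (fun i _ => ((hbox t ht).2 i).1) (Finset.mem_univ i)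
    linarith

end Regime

/-! ### Existence for Carathéodory equations with a Lipschitz right-hand side. -/

/-- A family of functions that is locally Lipschitz, uniformly in the parameter, is uniformly
Lipschitz on compact convex sets. -/
lemma LocallyLipschitzUniformly.exists_lipschitzOnWith {X : Type*} [NormedAddCommGroup X]
    [NormedSpace ℝ X] {f : ℝ → X → X} {B S : Set X} (hf : LocallyLipschitzUniformly f B)
    (hS : IsCompact S) (hconv : Convex ℝ S) (hSB : S ⊆ B) :
    ∃ K : ℝ≥0, ∀ t, 0 ≤ t → LipschitzOnWith K (f t) S := by
  have hf' : ∀ s ∈ S, ∃ U ∈ 𝓝 s, ∃ K : ℝ≥0, ∀ t, 0 ≤ t → LipschitzOnWith K (f t) (U ∩ B) :=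
    fun s hs => hf s (hSB hs)
  choose! U hU K hK using hf'
  obtain ⟨F, hFS, hF⟩ := hS.elim_nhds_subcover (fun s => interior (U s))
    fun s hs => interior_mem_nhds.2 (hU s hs)
  -- Points closer than the Lebesgue number share a Lipschitz neighbourhood. Distant points are
  -- joined by a segment in the convex set, cut into steps of length at most `δ / 2`.
  obtain ⟨δ, hδ, hδ'⟩ := lebesgue_number_lemma_of_metric (c := fun s : F => interior (U s)) hS
    (fun _ => isOpen_interior) (fun s hs => by
      obtain ⟨i, hi, his⟩ := mem_iUnion₂.1 (hF hs)
      exact mem_iUnion.2 ⟨⟨i, hi⟩, his⟩)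
  refine ⟨F.sup K, fun t ht => LipschitzOnWith.of_dist_le_mul ?_⟩
  have hnear : ∀ x ∈ S, ∀ y ∈ S, dist x y < δ → dist (f t x) (f t y) ≤ F.sup K * dist x y := by
    intro x hx y hy hxy
    obtain ⟨i, hi⟩ := hδ' x hx
    have hx' := interior_subset (hi (Metric.mem_ball_self hδ))
    have hy' := interior_subset (hi (Metric.mem_ball.2 (by rwa [dist_comm])))
    refine ((hK i (hFS i i.2) t ht).dist_le_mul x ⟨hx', hSB hx⟩ y ⟨hy', hSB hy⟩).trans ?_
    gcongr
    exact Finset.le_sup (f := K) i.2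
  have hchain : ∀ n : ℕ, ∀ x ∈ S, ∀ y ∈ S, dist x y ≤ n * (δ / 2) →
      dist (f t x) (f t y) ≤ F.sup K * dist x y := by
    intro n
    induction n with
    | zero =>
      intro x _ y _ hxy
      have : x = y := dist_le_zero.1 (by simpa using hxy)
      simp [this]
    | succ n ih =>
      intro x hx y hy hxy
      have hn : (0 : ℝ) < n + 1 := by positivity
      set c : ℝ := 1 / (n + 1) with hc
      have hc0 : 0 ≤ c := by positivity
      have hc1 : c ≤ 1 := by rw [hc, div_le_one hn]; linarith [(Nat.cast_nonneg n : (0 : ℝ) ≤ n)]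
      have hcn : 1 - c = n * c := by rw [hc]; field_simp; ring
      push_cast at hxy
      have hcd : c * dist x y ≤ δ / 2 := by
        rw [hc, one_div, inv_mul_le_iff₀ hn]; exact hxy
      set z := AffineMap.lineMap x y c with hz
      have hzS : z ∈ S := hconv.lineMap_mem hx hy ⟨hc0, hc1⟩
      have h1 : dist x z = c * dist x y := by
        rw [hz, dist_left_lineMap, Real.norm_of_nonneg hc0]
      have h2 : dist z y = (1 - c) * dist x y := by
        rw [hz, dist_lineMap_right, Real.norm_of_nonneg (by linarith)]
      have e1 := hnear x hx z hzS (by rw [h1]; linarith)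
      have e2 := ih z hzS y hy (by
        rw [h2, hcn, mul_assoc]; gcongr)
      have := dist_triangle (f t x) (f t z) (f t y)
      rw [h1] at e1
      rw [h2] at e2
      linarith
  intro x hx y hy
  obtain ⟨n, hn⟩ := exists_nat_ge (dist x y / (δ / 2))
  exact hchain n x hx y hy (by rwa [div_le_iff₀ (by positivity)] at hn)

section Picard

variable {X : Type*} [NormedAddCommGroup X] [NormedSpace ℝ X] [SecondCountableTopology X]
  [MeasurableSpace X] [BorelSpace X]

omit [NormedSpace ℝ X] in
/-- A Carathéodory function composed with a continuous curve. -/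
lemma stronglyMeasurable_comp_curve {g : ℝ → X → X} (hm : ∀ x, StronglyMeasurable fun t => g t x)
    (hc : ∀ t, Continuous (g t)) {w : ℝ → X} (hw : Continuous w) :
    StronglyMeasurable fun t => g t (w t) := by
  have := stronglyMeasurable_uncurry_of_continuous_of_stronglyMeasurable
    (u := fun (t : X) (s : ℝ) => g s t) hc hm
  exact this.comp_measurable (hw.measurable.prodMk measurable_id)

omit [NormedSpace ℝ X] in
lemma intervalIntegrable_comp_curve {g : ℝ → X → X} {K C : ℝ}
    (hm : ∀ x, StronglyMeasurable fun t => g t x) (hc : ∀ t, Continuous (g t))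
    (hb : ∀ t x, ‖g t x‖ ≤ C + K * ‖x‖) {w : ℝ → X} (hw : Continuous w) (a b : ℝ) :
    IntervalIntegrable (fun t => g t (w t)) volume a b := by
  have h1 : IntervalIntegrable (fun t => C + K * ‖w t‖) volume a b :=
    (continuous_const.add (continuous_const.mul hw.norm)).intervalIntegrable a b
  exact h1.mono_fun' (stronglyMeasurable_comp_curve hm hc hw).aestronglyMeasurable
    (Eventually.of_forall fun t => hb t (w t))

/-- Global existence for differential equations that are Lipschitz in the state and measurable in
time. -/
theorem exists_global_solution [CompleteSpace X] {g : ℝ → X → X} {K : ℝ≥0} {C : ℝ}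
    (hC : 0 ≤ C) (hm : ∀ x, StronglyMeasurable fun t => g t x)
    (hK : ∀ t, LipschitzWith K (g t)) (h0 : ∀ t, ‖g t 0‖ ≤ C) (t₀ : ℝ) (x₀ : X) :
    ∃ y : ℝ → X, Continuous y ∧ (∀ a b, IntervalIntegrable (fun t => g t (y t)) volume a b) ∧
      ∀ t, t₀ ≤ t → y t = x₀ + ∫ s in t₀..t, g s (y s) := by
  have hc : ∀ t, Continuous (g t) := fun t => (hK t).continuous
  have hb : ∀ t x, ‖g t x‖ ≤ C + K * ‖x‖ := fun t x => by
    have h1 := (hK t).dist_le_mul x 0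
    rw [dist_eq_norm, dist_zero_right] at h1
    have h2 := norm_sub_norm_le (g t x) (g t 0)
    linarith [h0 t]
  -- This gives `K / Λ ≤ 1 / 2`, the contraction factor, and keeps `Λ` positive even if `K = 0`.
  set Λ : ℝ := 2 * K + 1 with hΛ
  have hΛ0 : 0 < Λ := by positivity
  have hintg : ∀ (w : ℝ → X), Continuous w → ∀ a b,
      IntervalIntegrable (fun t => g t (w t)) volume a b :=
    fun w hw a b => intervalIntegrable_comp_curve hm hc hb hw a b
  have hexp : ∀ t, t₀ ≤ t → ∫ s in t₀..t, Real.exp (Λ * (s - t₀)) ≤ Real.exp (Λ * (t - t₀)) / Λ := by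
    intro t _
    have hd : ∀ s ∈ uIcc t₀ t, HasDerivAt (fun s => Real.exp (Λ * (s - t₀)) / Λ)
        (Real.exp (Λ * (s - t₀))) s := fun s _ => by
      have h1 : HasDerivAt (fun s => Λ * (s - t₀)) (Λ * 1) s :=
        ((hasDerivAt_id s).sub_const t₀).const_mul Λ
      have h2 := h1.exp.div_const Λ
      rwa [mul_one, mul_div_cancel_right₀ _ hΛ0.ne'] at h2
    rw [intervalIntegral.integral_eq_sub_of_hasDerivAt hd
      (Continuous.intervalIntegrable (by fun_prop) _ _)]
    have : 0 ≤ Real.exp (Λ * (t₀ - t₀)) / Λ := by positivity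
    linarith
  -- The unknown is `z t = exp (-Λ (t - t₀)) • y t`. Its sup norm is the exponentially weighted norm
  -- in which one contraction covers the whole half-line; `max t t₀` freezes `raw z` at `x₀` before
  -- `t₀`.
  let lift : BoundedContinuousFunction ℝ X → ℝ → X := fun z s => Real.exp (Λ * (s - t₀)) • z s
  have hlift : ∀ z, Continuous (lift z) := fun z =>
    Continuous.smul (by fun_prop) z.continuous
  let raw : BoundedContinuousFunction ℝ X → ℝ → X := fun z t =>
    Real.exp (-(Λ * (max t t₀ - t₀))) • (x₀ + ∫ s in t₀..(max t t₀), g s (lift z s))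
  have hraw_cont : ∀ z, Continuous (raw z) := fun z => by
    have h1 : Continuous fun t => ∫ s in t₀..t, g s (lift z s) :=
      intervalIntegral.continuous_primitive (hintg _ (hlift z)) t₀
    have h2 : Continuous fun t : ℝ => max t t₀ := by fun_prop
    exact Continuous.smul (by fun_prop) (continuous_const.add (h1.comp h2))
  have hraw_bdd : ∀ z t, ‖raw z t‖ ≤ ‖x₀‖ + (C + K * ‖z‖) / Λ := fun z t => by
    set τ := max t t₀
    have hτ : t₀ ≤ τ := le_max_right _ _
    have hE : 1 ≤ Real.exp (Λ * (τ - t₀)) := Real.one_le_exp (mul_nonneg hΛ0.le (by linarith))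
    have h1 : ‖∫ s in t₀..τ, g s (lift z s)‖
        ≤ ∫ s in t₀..τ, (C + K * ‖z‖) * Real.exp (Λ * (s - t₀)) := by
      refine intervalIntegral.norm_integral_le_of_norm_le hτ (ae_of_all _ fun s hs => ?_)
        (Continuous.intervalIntegrable (by fun_prop) _ _)
      have hEs : 1 ≤ Real.exp (Λ * (s - t₀)) :=
        Real.one_le_exp (mul_nonneg hΛ0.le (by linarith [hs.1]))
      refine (hb s _).trans ?_
      have : ‖lift z s‖ ≤ Real.exp (Λ * (s - t₀)) * ‖z‖ := by
        rw [norm_smul, Real.norm_of_nonneg (Real.exp_pos _).le]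
        gcongr
        exact z.norm_coe_le_norm s
      have h3 := mul_le_mul_of_nonneg_left this K.2
      have h4 : C ≤ C * Real.exp (Λ * (s - t₀)) := le_mul_of_one_le_right hC hEs
      change C + (K : ℝ) * _ ≤ _
      change (K : ℝ) * _ ≤ (K : ℝ) * _ at h3
      linarith
    rw [intervalIntegral.integral_const_mul] at h1
    have h2 := mul_le_mul_of_nonneg_left (hexp τ hτ)
      (by positivity : 0 ≤ C + K * ‖z‖)
    change ‖Real.exp (-(Λ * (τ - t₀))) • (x₀ + ∫ s in t₀..τ, g s (lift z s))‖ ≤ _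
    rw [norm_smul, Real.norm_of_nonneg (Real.exp_pos _).le, Real.exp_neg,
      inv_mul_le_iff₀ (Real.exp_pos _)]
    refine (norm_add_le _ _).trans ?_
    have h5 : ‖x₀‖ ≤ Real.exp (Λ * (τ - t₀)) * ‖x₀‖ :=
      le_mul_of_one_le_left (norm_nonneg _) hE
    calc _ ≤ Real.exp (Λ * (τ - t₀)) * ‖x₀‖
          + (C + K * ‖z‖) * (Real.exp (Λ * (τ - t₀)) / Λ) := add_le_add h5 (h1.trans h2)
      _ = _ := by ring
  let T : BoundedContinuousFunction ℝ X → BoundedContinuousFunction ℝ X := fun z =>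
    BoundedContinuousFunction.ofNormedAddCommGroup (raw z) (hraw_cont z) _ (hraw_bdd z)
  have hT : ContractingWith (1 / 2) T := by
    refine ⟨by norm_num, LipschitzWith.of_dist_le_mul fun z z' => ?_⟩
    refine (BoundedContinuousFunction.dist_le (by positivity)).2 fun t => ?_
    set τ := max t t₀
    have hτ : t₀ ≤ τ := le_max_right _ _
    change dist (Real.exp (-(Λ * (τ - t₀))) • (x₀ + ∫ s in t₀..τ, g s (lift z s)))
      (Real.exp (-(Λ * (τ - t₀))) • (x₀ + ∫ s in t₀..τ, g s (lift z' s))) ≤ _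
    rw [dist_smul₀, dist_add_left, dist_eq_norm, ← intervalIntegral.integral_sub
      (hintg _ (hlift z) _ _) (hintg _ (hlift z') _ _), Real.norm_of_nonneg (Real.exp_pos _).le,
      Real.exp_neg, inv_mul_le_iff₀ (Real.exp_pos _)]
    have h1 : ‖∫ s in t₀..τ, (g s (lift z s) - g s (lift z' s))‖
        ≤ ∫ s in t₀..τ, (K * dist z z') * Real.exp (Λ * (s - t₀)) := by
      refine intervalIntegral.norm_integral_le_of_norm_le hτ (ae_of_all _ fun s hs => ?_)
        (Continuous.intervalIntegrable (by fun_prop) _ _)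
      have h2 := (hK s).dist_le_mul (lift z s) (lift z' s)
      rw [dist_eq_norm, dist_smul₀, Real.norm_of_nonneg (Real.exp_pos _).le] at h2
      have h3 := BoundedContinuousFunction.dist_coe_le_dist (f := z) (g := z') s
      refine h2.trans ?_
      calc _ ≤ (K : ℝ) * (Real.exp (Λ * (s - t₀)) * dist z z') := by gcongr
        _ = _ := by ring
    rw [intervalIntegral.integral_const_mul] at h1
    have h2 := mul_le_mul_of_nonneg_left (hexp τ hτ)
      (by positivity : 0 ≤ K * dist z z')
    refine (h1.trans h2).trans ?_
    have h3 : (K : ℝ) / Λ ≤ 1 / 2 := by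
      rw [div_le_iff₀ hΛ0, hΛ]; linarith
    have h4 : ((1 / 2 : ℝ≥0) : ℝ) = 1 / 2 := by simp
    rw [h4]
    calc _ = Real.exp (Λ * (τ - t₀)) * (K / Λ * dist z z') := by ring
      _ ≤ _ := by gcongr
  set z := ContractingWith.fixedPoint T hT
  have hz : T z = z := hT.fixedPoint_isFixedPt
  refine ⟨lift z, hlift z, hintg _ (hlift z), fun t ht => ?_⟩
  have h1 : z t = raw z t := by
    conv_lhs => rw [← hz]
    rfl
  change Real.exp (Λ * (t - t₀)) • z t = _
  rw [h1]
  change Real.exp (Λ * (t - t₀)) • (Real.exp (-(Λ * (max t t₀ - t₀))) •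
    (x₀ + ∫ s in t₀..(max t t₀), g s (lift z s))) = _
  rw [max_eq_left ht, smul_smul, ← Real.exp_add, add_neg_cancel, Real.exp_zero, one_smul]

end Picard

/-- The exceptional times form a countable union of finite sets, and a function continuous off a
countable set is measurable. -/
lemma PiecewiseContinuous.measurable {X : Type*} [NormedAddCommGroup X] [MeasurableSpace X]
    [BorelSpace X] {f : ℝ → X} (hf : PiecewiseContinuous f) :
    Measurable fun t => if 0 ≤ t then f t else 0 := by
  choose S hS _ using fun n : ℕ => hf n
  set D : Set ℝ := ⋃ n, (S n : Set ℝ) with hD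
  have hDc : D.Countable := countable_iUnion fun n => (S n).countable_toSet
  have hcont : ContinuousOn f (Ici 0 \ D) := by
    rintro t ⟨ht, htD⟩
    obtain ⟨n, hn⟩ := exists_nat_ge t
    refine (hS n t ⟨ht, hn⟩ fun h => htD (mem_iUnion.2 ⟨n, h⟩)).mono sdiff_subset
  classical
  have hm : Measurable ((Ici 0 \ D).piecewise f 0) :=
    hcont.measurable_piecewise continuousOn_const (measurableSet_Ici.diff hDc.measurableSet)
  refine hm.measurable_of_countable_ne (hDc.mono fun t ht => ?_)
  by_contra htD
  refine ht ?_
  by_cases h0 : 0 ≤ t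
  · rw [piecewise_eq_of_mem _ _ _ (show t ∈ Ici 0 \ D from ⟨h0, htD⟩), if_pos h0]
  · rw [piecewise_eq_of_notMem _ _ _ (fun h => h0 h.1), if_neg h0, Pi.zero_apply]

/-! ### Retraction of the state space onto the weight ball. -/

section Frob

variable {ι : Type*} [Fintype ι] {n : ℕ}

lemma frob_eq_norm (W : ι → E n) : frob W = ‖(WithLp.toLp 2 W : PiLp 2 fun _ : ι => E n)‖ := by
  rw [PiLp.norm_eq_of_L2, frob]

lemma frob_add_le (W V : ι → E n) : frob (W + V) ≤ frob W + frob V := by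
  simp only [frob_eq_norm, WithLp.toLp_add]
  exact norm_add_le _ _

lemma frob_smul (c : ℝ) (W : ι → E n) : frob (c • W) = |c| * frob W := by
  simp only [frob_eq_norm, WithLp.toLp_smul, norm_smul, Real.norm_eq_abs]

lemma abs_frob_sub_le (W V : ι → E n) : |frob W - frob V| ≤ frob (W - V) := by
  simp only [frob_eq_norm, WithLp.toLp_sub]
  exact abs_norm_sub_norm_le _ _

lemma frob_le_sqrt_mul (W : ι → E n) : frob W ≤ √(Fintype.card ι) * ‖W‖ := by
  refine (abs_le_of_sq_le_sq' ?_ (by positivity)).2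
  rw [mul_pow, Real.sq_sqrt (by positivity)]
  exact frob_sq_le W

/-- The radial retraction onto the ball of radius `r` for the Frobenius norm. -/
def retract (r : ℝ) (W : ι → E n) : ι → E n := (r / max r (frob W)) • W

variable {r : ℝ} (hr : 0 < r)
include hr

lemma retract_factor (W : ι → E n) : 0 < r / max r (frob W) ∧ r / max r (frob W) ≤ 1 := by
  have : 0 < max r (frob W) := lt_max_of_lt_left hr
  exact ⟨by positivity, (div_le_one this).2 (le_max_left _ _)⟩

lemma frob_retract_le (W : ι → E n) : frob (retract r W) ≤ r := by
  have hm : 0 < max r (frob W) := lt_max_of_lt_left hr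
  rw [retract, frob_smul, abs_of_pos (retract_factor hr W).1, div_mul_eq_mul_div,
    div_le_iff₀ hm]
  gcongr
  exact le_max_right _ _

lemma retract_eq_self {W : ι → E n} (hW : frob W ≤ r) : retract r W = W := by
  rw [retract, max_eq_left hW, div_self hr.ne', one_smul]

/-- Split into scaling the difference and changing the scaling factor. The second part is measured
in the Frobenius norm, whose comparison with the sup norm costs the square root. -/
lemma norm_retract_sub_le (W V : ι → E n) :
    ‖retract r W - retract r V‖ ≤ (1 + √(Fintype.card ι)) * ‖W - V‖ := by
  set A := max r (frob W)
  set B := max r (frob V)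
  have hA : 0 < A := lt_max_of_lt_left hr
  have hB : 0 < B := lt_max_of_lt_left hr
  have e : retract r W - retract r V = (r / A) • (W - V) + (r / A - r / B) • V := by
    simp only [retract, smul_sub, sub_smul, A, B]; abel
  have h1 : ‖(r / A) • (W - V)‖ ≤ ‖W - V‖ := by
    rw [norm_smul, Real.norm_of_nonneg (by positivity)]
    exact mul_le_of_le_one_left (norm_nonneg _) (retract_factor hr W).2
  have hAB : |B - A| ≤ frob (W - V) := by
    rw [abs_sub_comm]
    have := abs_frob_sub_le W V
    have h2 : |A - B| ≤ |frob W - frob V| := by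
      have := abs_max_sub_max_le_max r (frob W) r (frob V)
      simpa [A, B] using this
    exact h2.trans this
  have h2 : ‖(r / A - r / B) • V‖ ≤ frob (W - V) := by
    have e2 : r / A - r / B = (r / A) * ((B - A) / B) := by field_simp
    rw [norm_smul, e2, Real.norm_eq_abs, abs_mul, abs_of_pos (retract_factor hr W).1, abs_div,
      abs_of_pos hB]
    have hV : ‖V‖ ≤ B := (norm_pi_le_frob V).trans (le_max_right _ _)
    calc r / A * (|B - A| / B) * ‖V‖ ≤ 1 * (|B - A| / B) * B := by
          gcongr
          exact (retract_factor hr W).2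
      _ = |B - A| := by field_simp
      _ ≤ _ := hAB
  rw [e]
  refine (norm_add_le _ _).trans ?_
  have := frob_le_sqrt_mul (W - V)
  linarith

end Frob

/-- The retraction of the line onto the unit interval. -/
def clamp (t : ℝ) : ℝ := max 0 (min 1 t)

lemma clamp_mem (t : ℝ) : clamp t ∈ Icc (0 : ℝ) 1 :=
  ⟨le_max_left _ _, max_le zero_le_one (min_le_left _ _)⟩

lemma abs_clamp_sub_le (s t : ℝ) : |clamp s - clamp t| ≤ |s - t| := by
  have := ((LipschitzWith.id (α := ℝ)).const_min 1).const_max 0 |>.dist_le_mul s t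
  simpa [Real.dist_eq, clamp] using this

lemma clamp_of_le {t : ℝ} (ht : t ≤ 1) : clamp t = max t 0 := by
  rw [clamp, min_eq_right ht, max_comm]

section Trunc

variable {l : Fin N.L}

/-- A Lipschitz retraction of the state space onto `weightBall N l r`. -/
def trunc (r : ℝ) (s : State N l) : State N l :=
  (retract r (w1 s), retract r (w2 s), clamp (tB s), fun i => clamp (t1 s i))

lemma trunc_mem {r : ℝ} (hr : 0 < r) (s : State N l) : trunc r s ∈ weightBall N l r :=
  ⟨⟨clamp_mem _, fun _ => clamp_mem _⟩, frob_retract_le hr _, frob_retract_le hr _⟩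

lemma lipschitzWith_trunc {r : ℝ} (hr : 0 < r) :
    LipschitzWith (1 + NNReal.sqrt (N.k l)) (trunc (N := N) (l := l) r) := by
  refine LipschitzWith.of_dist_le_mul fun s s' => ?_
  have hc : ((1 + NNReal.sqrt (N.k l) : ℝ≥0) : ℝ) = 1 + √(N.k l) := by simp
  have h0 : dist s s' ≤ (1 + √(N.k l)) * dist s s' :=
    le_mul_of_one_le_left dist_nonneg (by linarith [Real.sqrt_nonneg (N.k l : ℝ)])
  rw [hc]
  refine dist_state_le ?_ ?_ ?_ ?_
  · refine (norm_retract_sub_le hr _ _).trans ?_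
    rw [Fintype.card_fin]
    gcongr
    exact norm_w1_sub_le s s'
  · refine (norm_retract_sub_le hr _ _).trans ?_
    rw [Fintype.card_fin]
    gcongr
    exact norm_w2_sub_le s s'
  · exact ((abs_clamp_sub_le _ _).trans (abs_tB_sub_le s s')).trans h0
  · refine le_trans ((pi_norm_le_iff_of_nonneg dist_nonneg).2 fun i => ?_) h0
    exact (abs_clamp_sub_le _ _).trans
      ((abs_apply_le_norm (t1 s - t1 s') i).trans (norm_t1_sub_le s s'))

lemma isCompact_weightBall (r : ℝ) : IsCompact (weightBall N l r) := by
  refine Metric.isCompact_of_isClosed_isBounded ?_ ?_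
  · exact isClosed_box.inter ((isClosed_le (continuous_frob.comp continuous_w1)
      continuous_const).inter (isClosed_le (continuous_frob.comp continuous_w2) continuous_const))
  · refine (Metric.isBounded_closedBall (x := (0 : State N l)) (r := max r 1)).subset ?_
    rintro s ⟨hb, h1, h2⟩
    refine Metric.mem_closedBall.2 (dist_state_le ?_ ?_ ?_ ?_)
    · exact (sub_zero (w1 s)).symm ▸ ((norm_pi_le_frob _).trans h1).trans (le_max_left _ _)
    · exact (sub_zero (w2 s)).symm ▸ ((norm_pi_le_frob _).trans h2).trans (le_max_left _ _)
    · change |tB s - 0| ≤ _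
      rw [sub_zero, abs_of_nonneg hb.1.1]
      exact hb.1.2.trans (le_max_right _ _)
    · change ‖t1 s - 0‖ ≤ _
      rw [sub_zero]
      refine (pi_norm_le_iff_of_nonneg (le_max_of_le_right zero_le_one)).2 fun i => ?_
      rw [Real.norm_eq_abs, abs_of_nonneg (hb.2 i).1]
      exact (hb.2 i).2.trans (le_max_right _ _)

lemma convex_weightBall (r : ℝ) : Convex ℝ (weightBall N l r) := by
  rintro s ⟨hb, h1, h2⟩ s' ⟨hb', h1', h2'⟩ a b ha hb0 hab
  have hfrob : ∀ {n : ℕ} (W V : Fin (N.k l) → E n), frob W ≤ r → frob V ≤ r →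
      frob (a • W + b • V) ≤ r := fun W V hW hV => by
    refine (frob_add_le _ _).trans ?_
    rw [frob_smul, frob_smul, abs_of_nonneg ha, abs_of_nonneg hb0]
    have := mul_le_mul_of_nonneg_left hW ha
    have := mul_le_mul_of_nonneg_left hV hb0
    have : a * r + b * r = r := by rw [← add_mul, hab, one_mul]
    linarith
  exact ⟨⟨convex_Icc _ _ hb.1 hb'.1 ha hb0 hab,
    fun i => convex_Icc _ _ (hb.2 i) (hb'.2 i) ha hb0 hab⟩, hfrob _ _ h1 h1', hfrob _ _ h2 h2'⟩

end Trunc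

/-! ### Stopping at zero. -/

/-- The positive part of a nonincreasing curve stops when the curve reaches zero. -/
lemma HasVelocityOn.max_zero {u g : ℝ → ℝ} {a b : ℝ} (h : HasVelocityOn u g a b)
    (hg : ∀ t ∈ Icc a b, g t ≤ 0) (h0 : 0 ≤ u a)
    (hi : IntervalIntegrable (fun t => if 0 < u t then g t else 0) volume a b) :
    HasVelocityOn (fun t => max (u t) 0) (fun t => if 0 < u t then g t else 0) a b := by
  refine ⟨hi, fun t ht => ?_⟩
  have hanti : ∀ s t, a ≤ s → s ≤ t → t ≤ b → u t ≤ u s := fun s t hs hst htb => by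
    have h1 := h.mono hs hst htb
    rw [h1.2 t ⟨hst, le_rfl⟩]
    have := intervalIntegral.integral_mono_on hst h1.1 (by simp : IntervalIntegrable
      (fun _ => (0 : ℝ)) volume s t) fun τ hτ => hg τ ⟨hs.trans hτ.1, hτ.2.trans htb⟩
    simp at this
    linarith
  dsimp only
  rw [max_eq_left h0]
  rcases le_or_gt (u t) 0 with hut | hut
  -- The curve hits zero first at `τ`. Before `τ` the velocity is not switched off; after `τ` the
  -- curve stays nonpositive and the switched velocity vanishes.
  · have hcl : IsClosed {s ∈ Icc a t | u s ≤ 0} :=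
      (h.continuousOn.mono (Icc_subset_Icc_right ht.2)).preimage_isClosed_of_isClosed
        isClosed_Icc isClosed_Iic
    have hne : {s ∈ Icc a t | u s ≤ 0}.Nonempty := ⟨t, ⟨ht.1, le_rfl⟩, hut⟩
    have hbd : BddBelow {s ∈ Icc a t | u s ≤ 0} := ⟨a, fun s hs => hs.1.1⟩
    obtain ⟨hτ, huτ⟩ := hcl.csInf_mem hne hbd
    set τ := sInf {s ∈ Icc a t | u s ≤ 0} with hτdef
    have hpos : ∀ s, a ≤ s → s < τ → 0 < u s := fun s hs hsτ => by
      by_contra hcon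
      exact absurd (csInf_le hbd ⟨⟨hs, hsτ.le.trans hτ.2⟩, not_lt.1 hcon⟩) (not_le.2 hsτ)
    have huτ0 : u τ = 0 := by
      refine le_antisymm huτ ?_
      rcases hτ.1.eq_or_lt with he | hlt
      · rwa [← he]
      · have hc : ContinuousWithinAt u (Ico a τ) τ :=
          (h.continuousOn τ ⟨hτ.1, hτ.2.trans ht.2⟩).mono
            (Ico_subset_Icc_self.trans (Icc_subset_Icc_right (hτ.2.trans ht.2)))
        have hcls : τ ∈ closure (Ico a τ) := by
          rw [closure_Ico hlt.ne]; exact ⟨hτ.1, le_rfl⟩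
        have := mem_closure_iff_nhdsWithin_neBot.1 hcls
        exact ge_of_tendsto hc (eventually_mem_nhdsWithin.mono fun s hs => (hpos s hs.1 hs.2).le)
    have hiτ : ∀ c d, a ≤ c → c ≤ d → d ≤ b →
        IntervalIntegrable (fun t => if 0 < u t then g t else 0) volume c d :=
      fun c d h1 h2 h3 => hi.mono_set (by
        rw [uIcc_of_le h2, uIcc_of_le (h1.trans (h2.trans h3))]; exact Icc_subset_Icc h1 h3)
    rw [← intervalIntegral.integral_add_adjacent_intervals
      (hiτ a τ le_rfl hτ.1 (hτ.2.trans ht.2)) (hiτ τ t hτ.1 hτ.2 ht.2)]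
    have i1 : ∫ s in a..τ, (if 0 < u s then g s else 0) = ∫ s in a..τ, g s := by
      rw [intervalIntegral.integral_of_le hτ.1, intervalIntegral.integral_of_le hτ.1,
        integral_Ioc_eq_integral_Ioo, integral_Ioc_eq_integral_Ioo]
      exact setIntegral_congr_fun measurableSet_Ioo fun s hs => if_pos (hpos s hs.1.le hs.2)
    have i2 : ∫ s in τ..t, (if 0 < u s then g s else 0) = 0 := by
      rw [intervalIntegral.integral_congr (g := fun _ => (0 : ℝ))]
      · simp
      · intro s hs
        rw [uIcc_of_le hτ.2] at hs
        have := hanti τ s hτ.1 hs.1 (hs.2.trans ht.2)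
        exact if_neg (not_lt.2 (by linarith))
    have := h.2 τ ⟨hτ.1, hτ.2.trans ht.2⟩
    rw [i1, i2, max_eq_right hut]
    linarith
  · rw [max_eq_left hut.le, h.2 t ht]
    congr 1
    refine intervalIntegral.integral_congr fun s hs => ?_
    rw [uIcc_of_le ht.1] at hs
    exact (if_pos (hut.trans_le (hanti s t hs.1 hs.2 ht.2))).symm

lemma measurable_w1 {l : Fin N.L} : Measurable (w1 : State N l → _) := continuous_w1.measurable

lemma measurable_w2 {l : Fin N.L} : Measurable (w2 : State N l → _) := continuous_w2.measurable

lemma measurable_tB {l : Fin N.L} : Measurable (tB : State N l → ℝ) := continuous_tB.measurable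

lemma measurable_t1 {l : Fin N.L} : Measurable (t1 : State N l → _) := continuous_t1.measurable

/-- The velocity `v` with the components of `θ_B`, `θ_1` switched off where these are not
positive. -/
def stopped {l : Fin N.L} (y v : State N l) : State N l :=
  (w1 v, w2 v, if 0 < tB y then tB v else 0, fun i => if 0 < t1 y i then t1 v i else 0)

/-- The state with `θ_B`, `θ_1` replaced by their positive parts. -/
def positivePart {l : Fin N.L} (y : State N l) : State N l :=
  (w1 y, w2 y, max (tB y) 0, fun i => max (t1 y i) 0)

lemma norm_stopped_le {l : Fin N.L} (y v : State N l) : ‖stopped y v‖ ≤ ‖v‖ := by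
  have h1 := norm_w1_sub_le v 0
  have h2 := norm_w2_sub_le v 0
  have h3 := abs_tB_sub_le v 0
  have h4 := norm_t1_sub_le v 0
  rw [dist_zero_right] at h1 h2 h3 h4
  rw [← dist_zero_right]
  refine dist_state_le h1 h2 ?_ ?_
  · change |(if 0 < tB y then tB v else 0) - 0| ≤ ‖v‖
    split_ifs
    · exact h3
    · simp
  · refine (pi_norm_le_iff_of_nonneg (norm_nonneg _)).2 fun i => ?_
    change |(if 0 < t1 y i then t1 v i else 0) - 0| ≤ ‖v‖
    split_ifs
    · exact (abs_apply_le_norm (t1 v - t1 0) i).trans h4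
    · simp

lemma measurable_stopped {l : Fin N.L} {y v : ℝ → State N l} (hy : Continuous y)
    (hv : Measurable v) : Measurable fun t => stopped (y t) (v t) := by
  have hB : Measurable fun t => tB (y t) := measurable_tB.comp hy.measurable
  have h1 : ∀ i, Measurable fun t => t1 (y t) i := fun i =>
    (measurable_pi_apply i).comp (measurable_t1.comp hy.measurable)
  refine (measurable_w1.comp hv).prodMk ((measurable_w2.comp hv).prodMk (Measurable.prodMk ?_ ?_))
  · exact Measurable.ite (measurableSet_lt measurable_const hB) (measurable_tB.comp hv)
      measurable_const
  · exact measurable_pi_lambda _ fun i => Measurable.ite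
      (measurableSet_lt measurable_const (h1 i))
      ((measurable_pi_apply i).comp (measurable_t1.comp hv)) measurable_const

/-- If `θ_B`, `θ_1` do not increase, then their positive parts stop at zero. -/
lemma HasVelocityOn.positivePart {l : Fin N.L} {y v : ℝ → State N l} {a b : ℝ}
    (h : HasVelocityOn y v a b) (hy : Continuous y) (hv : Measurable v)
    (hvB : ∀ t ∈ Icc a b, tB (v t) ≤ 0) (hv1 : ∀ t ∈ Icc a b, ∀ i, t1 (v t) i ≤ 0)
    (hB : 0 ≤ tB (y a)) (h1 : ∀ i, 0 ≤ t1 (y a) i) :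
    HasVelocityOn (fun t => ResPrune.positivePart (y t)) (fun t => stopped (y t) (v t)) a b := by
  have hintg : IntervalIntegrable (fun t => stopped (y t) (v t)) volume a b :=
    h.1.mono_fun (measurable_stopped hy hv).aestronglyMeasurable
      (Eventually.of_forall fun t => norm_stopped_le _ _)
  refine ⟨hintg, fun t ht => ?_⟩
  have hintg' : IntervalIntegrable (fun t => stopped (y t) (v t)) volume a t :=
    hintg.mono_set (by
      rw [uIcc_of_le ht.1, uIcc_of_le (ht.1.trans ht.2)]; exact Icc_subset_Icc_right ht.2)
  let L1 : State N l →L[ℝ] _ := ContinuousLinearMap.fst ℝ _ _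
  let L2 : State N l →L[ℝ] _ :=
    (ContinuousLinearMap.fst ℝ _ _).comp (ContinuousLinearMap.snd ℝ _ _)
  let LB : State N l →L[ℝ] ℝ := (ContinuousLinearMap.fst ℝ _ _).comp
    ((ContinuousLinearMap.snd ℝ _ _).comp (ContinuousLinearMap.snd ℝ _ _))
  let LU : Fin (N.k l) → State N l →L[ℝ] ℝ := fun i =>
    (ContinuousLinearMap.proj (R := ℝ) (φ := fun _ : Fin (N.k l) => ℝ) i).comp
      ((ContinuousLinearMap.snd ℝ _ _).comp
      ((ContinuousLinearMap.snd ℝ _ _).comp (ContinuousLinearMap.snd ℝ _ _)))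
  have e1 := (h.comp L1).2 t ht
  have e2 := (h.comp L2).2 t ht
  have eB := ((h.comp LB).max_zero hvB hB
    ⟨LB.integrable_comp hintg.1, LB.integrable_comp hintg.2⟩).2 t ht
  have eU := fun i => ((h.comp (LU i)).max_zero (fun t ht => hv1 t ht i) (h1 i)
    ⟨(LU i).integrable_comp hintg.1, (LU i).integrable_comp hintg.2⟩).2 t ht
  refine Prod.ext ?_ (Prod.ext ?_ (Prod.ext ?_ (funext fun i => ?_)))
  · refine e1.trans ?_
    exact congrArg (L1 (y a) + ·) (L1.intervalIntegral_comp_comm hintg')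
  · refine e2.trans ?_
    exact congrArg (L2 (y a) + ·) (L2.intervalIntegral_comp_comm hintg')
  · refine eB.trans ?_
    exact congrArg (max (tB (y a)) 0 + ·) (LB.intervalIntegral_comp_comm hintg')
  · refine (eU i).trans ?_
    exact congrArg (max (t1 (y a) i) 0 + ·) ((LU i).intervalIntegral_comp_comm hintg')

lemma HasVelocityOn.congr {X : Type*} [NormedAddCommGroup X] [NormedSpace ℝ X] {x v v' : ℝ → X}
    {a b : ℝ} (hab : a ≤ b) (h : HasVelocityOn x v a b) (hv : ∀ t ∈ Icc a b, v t = v' t) :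
    HasVelocityOn x v' a b := by
  refine ⟨h.1.congr fun t ht => hv t ?_, fun t ht => ?_⟩
  · rw [uIoc_of_le hab] at ht; exact Ioc_subset_Icc_self ht
  · rw [h.2 t ht]
    congr 1
    refine intervalIntegral.integral_congr fun s hs => hv s ?_
    rw [uIcc_of_le ht.1] at hs
    exact Icc_subset_Icc_right ht.2 hs

/-- For `g ≥ 0` the projection acts only at `θ = 0`, where it cancels the velocity; at `θ = 1` it is
zero. -/
lemma stopped_eq_projected {θ u g : ℝ} (hθ : θ = max u 0) (hg : 0 ≤ g) :
    (if 0 < u then -g else 0) = -g - projTerm θ g := by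
  unfold projTerm
  by_cases hu : 0 < u
  · rw [if_pos hu, hθ, max_eq_left hu.le, if_neg hu.ne']
    split_ifs
    · rw [max_eq_right (neg_nonpos.2 hg), sub_zero]
    · rw [sub_zero]
  · rw [if_neg hu, hθ, max_eq_right (not_lt.1 hu), if_pos rfl, max_eq_left hg]
    ring

/-! ### Existence of solutions of the projected system. -/

namespace Regime

variable {m : Model} {μ : Measure (E (N.d 0) × E (N.d N.L))} {H : Hyper} {l : Fin N.L}
  {P : ℝ → Params N} {Rm r η κ : ℝ} (h : Regime m μ H l P Rm r η κ)
include h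

/-- At the zero state all terms carry a vanishing factor except the constant `ν α`. This supplies
the bound uniform in time required by the global existence theorem. -/
lemma norm_freeField_zero_le {t : ℝ} (ht : 0 ≤ t) :
    ‖freeField m μ H (P t) (0 : State N l)‖ ≤ H.nu * H.α := by
  have hα : 0 ≤ H.nu * H.α := mul_nonneg h.valid.nu_pos.le h.valid.α_nonneg
  have hbox : (0 : State N l) ∈ box N l := ⟨by simp [tB], fun i => by simp [t1]⟩
  have h1 : frob (w1 (0 : State N l)) ≤ r := frob_zero.le.trans h.r_pos.le
  have h2 : frob (w2 (0 : State N l)) ≤ r := frob_zero.le.trans h.r_pos.le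
  have hcost := (h.sens t ht).abs_costB_sub_le hbox h1 h2
  have ht0 : ∀ i, t1 (0 : State N l) i = 0 := fun _ => rfl
  simp only [ht0, zero_mul, Finset.sum_const_zero] at hcost
  have hcost' := abs_nonpos_iff.1 hcost
  have hB : lossB m μ H ((P t).withBlock (0 : State N l)) l = H.nu * H.α := by
    have : ∑ i, |((P t).withBlock (0 : State N l)).θ1 l i| = 0 :=
      Finset.sum_eq_zero fun i _ => by simp [Params.withBlock, t1]
    rw [lossB, hcost', this]
    ring
  have hU : ∀ i, lossU m μ H ((P t).withBlock (0 : State N l)) l i = 0 := fun i => by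
    simp [lossU, Params.withBlock, tB]
  rw [← dist_zero_right]
  refine dist_state_le ?_ ?_ ?_ ?_
  · refine (norm_le_zero_iff.2 ?_).trans hα
    ext i j
    simp [freeField, w1, tB]
  · refine (norm_le_zero_iff.2 ?_).trans hα
    ext i j
    simp [freeField, w2, tB]
  · change |-lossB m μ H ((P t).withBlock (0 : State N l)) l - 0| ≤ _
    rw [hB, sub_zero, abs_neg, abs_of_nonneg hα]
  · refine (pi_norm_le_iff_of_nonneg hα).2 fun i => ?_
    change |-lossU m μ H ((P t).withBlock (0 : State N l)) l i - 0| ≤ _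
    rw [hU]
    simpa using hα

/-- The decrease of the Lyapunov function for the system with truncated state. -/
lemma quadDeriv_stopped_nonpos {t : ℝ} (ht : 0 ≤ t) {y : State N l}
    (hB : clamp (tB y) = max (tB y) 0) (h1 : frob (w1 y) ≤ 2 * r) (h2 : frob (w2 y) ≤ 2 * r) :
    quadDeriv 1 1 1 0 (positivePart y)
      (stopped y (freeField m μ H (P t) (trunc r y))) ≤ 0 := by
  have hr := h.r_pos
  have hz := trunc_mem hr y
  set z := trunc r y with hzdef
  have hlam := h.valid.lam_pos
  obtain ⟨hc1, hc1'⟩ := retract_factor hr (w1 y)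
  obtain ⟨hc2, hc2'⟩ := retract_factor hr (w2 y)
  have hz1 : ∀ i, w1 z i = (r / max r (frob (w1 y))) • w1 y i := fun _ => rfl
  have hz2 : ∀ i, w2 z i = (r / max r (frob (w2 y))) • w2 y i := fun _ => rfl
  set c1 := r / max r (frob (w1 y))
  set c2 := r / max r (frob (w2 y))
  have hn1 : ∀ i, ‖w1 z i‖ ≤ ‖w1 y i‖ := fun i => by
    rw [hz1, norm_smul, Real.norm_of_nonneg hc1.le]
    exact mul_le_of_le_one_left (norm_nonneg _) hc1'
  have hn2 : ∀ i, ‖w2 z i‖ ≤ ‖w2 y i‖ := fun i => by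
    rw [hz2, norm_smul, Real.norm_of_nonneg hc2.le]
    exact mul_le_of_le_one_left (norm_nonneg _) hc2'
  have hθ : ∀ i, 0 ≤ tB z * t1 z i := fun i => mul_nonneg hz.1.1.1 (hz.1.2 i).1
  have b1 : ∀ i, inner ℝ (w1 y i) (w1 (freeField m μ H (P t) z) i)
      ≤ tB z * t1 z i * (η * ‖w1 y i‖) := fun i => by
    obtain ⟨hs, -, -⟩ := h.sens t ht z hz.1 hz.2.1 hz.2.2 i
    rw [hz1, real_inner_smul_left, norm_smul, abs_mul, Real.norm_of_nonneg hc1.le,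
      abs_of_pos hc1, mul_left_comm] at hs
    -- The retraction multiplies all fan-in weights by one positive factor, and the sensitivity
    -- bound is homogeneous in them, so it transfers from `z` to `y`.
    have hs' := le_of_mul_le_mul_left hs hc1
    change inner ℝ (w1 y i)
      (-(tB z * t1 z i) • ((P t).withBlock z).gradW1 m μ l i - H.lam • w1 z i) ≤ _
    rw [hz1, inner_sub_right, inner_smul_right, inner_smul_right, inner_smul_right,
      real_inner_self_eq_norm_sq]
    have k1 := mul_le_mul_of_nonneg_left ((neg_le_abs _).trans hs') (hθ i)
    have k2 : 0 ≤ H.lam * (c1 * ‖w1 y i‖ ^ 2) := by positivity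
    linarith
  have b2 : ∀ i, inner ℝ (w2 y i) (w2 (freeField m μ H (P t) z) i)
      ≤ tB z * t1 z i * (η * ‖w2 y i‖) := fun i => by
    obtain ⟨-, hs, -⟩ := h.sens t ht z hz.1 hz.2.1 hz.2.2 i
    rw [hz2, real_inner_smul_left, norm_smul, abs_mul, Real.norm_of_nonneg hc2.le,
      abs_of_pos hc2, mul_left_comm] at hs
    have hs' := le_of_mul_le_mul_left hs hc2
    change inner ℝ (w2 y i)
      (-(tB z * t1 z i) • ((P t).withBlock z).gradW2 m μ l i - H.lam • w2 z i) ≤ _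
    rw [hz2, inner_sub_right, inner_smul_right, inner_smul_right, inner_smul_right,
      real_inner_self_eq_norm_sq]
    have k1 := mul_le_mul_of_nonneg_left ((neg_le_abs _).trans hs') (hθ i)
    have k2 : 0 ≤ H.lam * (c2 * ‖w2 y i‖ ^ 2) := by positivity
    linarith
  have b3 : tB (positivePart y) * tB (stopped y (freeField m μ H (P t) z))
      ≤ ∑ i, tB z * t1 z i * (κ * (‖w1 y i‖ + ‖w2 y i‖) - Rm) := by
    have k1 := (h.sens t ht).le_lossB h.valid (h.R_ge t ht) hz
    have k2 := mul_le_mul_of_nonneg_left k1 hz.1.1.1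
    have k3 : tB (positivePart y) * tB (stopped y (freeField m μ H (P t) z))
        = -(tB z * lossB m μ H ((P t).withBlock z) l) := by
      change max (tB y) 0 * (if 0 < tB y then -lossB m μ H ((P t).withBlock z) l else 0)
        = -(clamp (tB y) * _)
      rw [hB]
      split_ifs with hpos
      · ring
      · rw [max_eq_right (not_lt.1 hpos)]; ring
    rw [k3]
    refine (neg_le_neg k2).trans ?_
    rw [Finset.mul_sum, ← Finset.sum_neg_distrib]
    refine Finset.sum_le_sum fun i _ => ?_
    have k4 : κ * (‖w1 z i‖ + ‖w2 z i‖) - Rm ≤ κ * (‖w1 y i‖ + ‖w2 y i‖) - Rm := by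
      have := h.κ_pos
      have := hn1 i
      have := hn2 i
      gcongr
    have := mul_le_mul_of_nonneg_left k4 (hθ i)
    linarith
  have e : quadDeriv 1 1 1 0 (positivePart y) (stopped y (freeField m μ H (P t) z))
      = ∑ i, inner ℝ (w1 y i) (w1 (freeField m μ H (P t) z) i)
        + ∑ i, inner ℝ (w2 y i) (w2 (freeField m μ H (P t) z) i)
        + tB (positivePart y) * tB (stopped y (freeField m μ H (P t) z)) := by
    simp only [quadDeriv, one_mul, Pi.zero_apply, zero_mul, Finset.sum_const_zero, add_zero]
    rfl
  rw [e]
  refine (add_le_add (add_le_add (Finset.sum_le_sum fun i _ => b1 i)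
    (Finset.sum_le_sum fun i _ => b2 i)) b3).trans ?_
  rw [← Finset.sum_add_distrib, ← Finset.sum_add_distrib]
  refine Finset.sum_nonpos fun i _ => ?_
  -- Even at norms up to `2 r` the bracket is nonpositive, because `(η + κ) * 4 r = Rm`.
  have k5 := mul_le_mul_of_nonneg_left (add_le_add ((norm_le_frob _ i).trans h1)
    ((norm_le_frob _ i).trans h2)) (add_pos h.η_pos h.κ_pos).le
  have k6 : η * ‖w1 y i‖ + η * ‖w2 y i‖ + (κ * (‖w1 y i‖ + ‖w2 y i‖) - Rm) ≤ 0 := by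
    linarith [h.r_eq]
  have := mul_nonpos_of_nonneg_of_nonpos (hθ i) k6
  linarith

/-- The candidate is the positive part of a solution of the retracted, unprojected equation. Once it
is known to remain in the weight ball, the retraction acts on the auxiliary curve exactly as the
positive part does, and stopping equals projecting. -/
theorem exists_solution
    (hpc : ∀ s ∈ box N l, PiecewiseContinuous fun t => freeField m μ H (P t) s)
    (hlip : LocallyLipschitzUniformly (fun t => freeField m μ H (P t)) (box N l))
    {t₀ : ℝ} (ht₀ : 0 ≤ t₀) {s : State N l} (hs : s ∈ DB N l Rm η κ) :
    ∃ x : ℝ → State N l, x t₀ = s ∧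
      ∀ T ≥ t₀, IsSolutionOn (fun t => field m μ H (P t)) (box N l) x t₀ T := by
  have hr := h.r_pos
  obtain ⟨hsb, hsq⟩ := (mem_DB_iff h.radius_eq _).1 hs
  obtain ⟨K, hK⟩ := hlip.exists_lipschitzOnWith (isCompact_weightBall r) (convex_weightBall r)
    fun _ hy => hy.1
  set g : ℝ → State N l → State N l := fun t y =>
    if 0 ≤ t then freeField m μ H (P t) (trunc r y) else 0 with hg
  have hgpos : ∀ t, 0 ≤ t → ∀ y, g t y = freeField m μ H (P t) (trunc r y) :=
    fun t ht y => if_pos ht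
  have htrunc0 : trunc r (0 : State N l) = 0 := by
    have e : retract r (0 : Fin (N.k l) → E (N.d l + 1)) = 0 := smul_zero _
    have e' : retract r (0 : Fin (N.k l) → E (N.d (l + 1))) = 0 := smul_zero _
    have e2 : clamp 0 = 0 := by simp [clamp]
    exact Prod.ext e (Prod.ext e' (Prod.ext e2 (funext fun _ => e2)))
  have hm : ∀ y, StronglyMeasurable fun t => g t y := fun y =>
    (hpc _ (trunc_mem hr y).1).measurable.stronglyMeasurable
  have hgK : ∀ t, LipschitzWith (K * (1 + NNReal.sqrt (N.k l))) (g t) := fun t => by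
    by_cases ht : 0 ≤ t
    · have := (hK t ht).comp (lipschitzWith_trunc (N := N) (l := l) hr).lipschitzOnWith
        (s := univ) fun y _ => trunc_mem hr y
      rw [lipschitzOnWith_univ] at this
      have e : g t = (fun y => freeField m μ H (P t) y) ∘ trunc r := funext fun y => hgpos t ht y
      rw [e]; exact this
    · have e : g t = fun _ => 0 := funext fun y => if_neg ht
      rw [e]; exact LipschitzWith.const' 0
  have hα : 0 ≤ H.nu * H.α := mul_nonneg h.valid.nu_pos.le h.valid.α_nonneg
  have hg0 : ∀ t, ‖g t 0‖ ≤ H.nu * H.α := fun t => by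
    by_cases ht : 0 ≤ t
    · rw [hgpos t ht, htrunc0]; exact h.norm_freeField_zero_le ht
    · simp only [hg, if_neg ht, norm_zero]; exact hα
  obtain ⟨y, hyc, hyi, hy⟩ := exists_global_solution hα hm hgK hg0 t₀ s
  have hy0 : y t₀ = s := by simpa using hy t₀ le_rfl
  set v : ℝ → State N l := fun t => g t (y t) with hv
  have hvm : Measurable v :=
    (stronglyMeasurable_comp_curve hm (fun t => (hgK t).continuous) hyc).measurable
  have hvel : ∀ T, HasVelocityOn y v t₀ T := fun T =>
    ⟨hyi t₀ T, fun t ht => by rw [hy0]; exact hy t ht.1⟩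
  have hvB : ∀ t, t₀ ≤ t → tB (v t) ≤ 0 := fun t ht => by
    have ht0 := ht₀.trans ht
    simp only [hv, hgpos t ht0]
    exact neg_nonpos.2 (h.lossB_nonneg ht0 (trunc_mem hr _))
  have hv1 : ∀ t, t₀ ≤ t → ∀ i, t1 (v t) i ≤ 0 := fun t ht i => by
    have ht0 := ht₀.trans ht
    simp only [hv, hgpos t ht0]
    exact neg_nonpos.2 (h.lossU_nonneg ht0 (trunc_mem hr _) i)
  have hpp : ∀ T, HasVelocityOn (fun t => positivePart (y t)) (fun t => stopped (y t) (v t))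
      t₀ T := fun T => (hvel T).positivePart hyc hvm (fun t ht => hvB t ht.1)
    (fun t ht => hv1 t ht.1) (by rw [hy0]; exact hsb.1.1) fun i => by rw [hy0]; exact (hsb.2 i).1
  have hmono : ∀ (L : State N l →L[ℝ] ℝ), (∀ t, t₀ ≤ t → L (v t) ≤ 0) → ∀ t, t₀ ≤ t →
      L (y t) ≤ L s := fun L hL t ht => by
    have h1 := ((hvel t).comp L).2 t ⟨ht, le_rfl⟩
    have h2 := intervalIntegral.integral_mono_on ht ((hvel t).comp L).1
      (by simp : IntervalIntegrable (fun _ => (0 : ℝ)) volume t₀ t) fun τ hτ => hL τ hτ.1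
    simp only [intervalIntegral.integral_zero, hy0] at h1 h2
    linarith
  have hB1 : ∀ t, t₀ ≤ t → tB (y t) ≤ 1 := fun t ht =>
    (hmono ((ContinuousLinearMap.fst ℝ _ _).comp
      ((ContinuousLinearMap.snd ℝ _ _).comp (ContinuousLinearMap.snd ℝ _ _))) hvB t ht).trans
      hsb.1.2
  have hU1 : ∀ t, t₀ ≤ t → ∀ i, t1 (y t) i ≤ 1 := fun t ht i =>
    (hmono ((ContinuousLinearMap.proj (R := ℝ) (φ := fun _ : Fin (N.k l) => ℝ) i).comp
      ((ContinuousLinearMap.snd ℝ _ _).comp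
      ((ContinuousLinearMap.snd ℝ _ _).comp (ContinuousLinearMap.snd ℝ _ _))))
      (fun τ hτ => hv1 τ hτ i) t ht).trans (hsb.2 i).2
  have hstart : positivePart (y t₀) = s := by
    rw [hy0]
    exact Prod.ext rfl (Prod.ext rfl (Prod.ext (max_eq_left hsb.1.1)
      (funext fun i => max_eq_left (hsb.2 i).1)))
  have hbox : ∀ t, t₀ ≤ t → positivePart (y t) ∈ box N l := fun t ht =>
    ⟨⟨le_max_right _ _, max_le (hB1 t ht) zero_le_one⟩,
      fun i => ⟨le_max_right _ _, max_le (hU1 t ht i) zero_le_one⟩⟩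
  have hquad : ∀ t, t₀ ≤ t → quad 1 1 1 0 (positivePart (y t)) ≤ r ^ 2 := fun t ht => by
    -- A bootstrap: the bound holds while the level is below `(2 * r) ^ 2`, and the start is at most
    -- `r ^ 2`. The room up to `2 r` avoids the contact of `D_B` with the boundary of the ball.
    have key := le_of_nonincreasing_below (y := fun t => quad 1 1 1 0 (positivePart (y t)))
      (d := (2 * r) ^ 2) ((continuous_quad 1 1 1 0).comp_continuousOn (hpp t).continuousOn)
      (by rw [hstart]; exact hsq.trans_lt (by gcongr; linarith))
      fun a b ha hab hbt hlt => (((hpp t).mono ha hab hbt).quad_le hab 1 1 1 0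
        fun τ hτ => ?_)
    · have := key t ⟨ht, le_rfl⟩
      rw [hstart] at this
      exact this.trans hsq
    · have hτ₀ : t₀ ≤ τ := ha.trans hτ.1
      have hq := hlt τ hτ
      rw [quad_lyap] at hq
      change frob (w1 (y τ)) ^ 2 + frob (w2 (y τ)) ^ 2 + tB (positivePart (y τ)) ^ 2 < _ at hq
      have := sq_nonneg (tB (positivePart (y τ)))
      have hr2 : 0 ≤ 2 * r := by linarith
      simp only [hv, hgpos τ (ht₀.trans hτ₀)]
      exact h.quadDeriv_stopped_nonpos (ht₀.trans hτ₀) (clamp_of_le (hB1 τ hτ₀))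
        (abs_le_of_sq_le_sq' (by linarith [sq_nonneg (frob (w2 (y τ)))]) hr2).2
        (abs_le_of_sq_le_sq' (by linarith [sq_nonneg (frob (w1 (y τ)))]) hr2).2
  have hball : ∀ t, t₀ ≤ t → positivePart (y t) ∈ weightBall N l r := fun t ht =>
    mem_weightBall_of_quad_le hr (hbox t ht) (hquad t ht)
  have htr : ∀ t, t₀ ≤ t → trunc r (y t) = positivePart (y t) := fun t ht =>
    Prod.ext (retract_eq_self hr (hball t ht).2.1) (Prod.ext (retract_eq_self hr (hball t ht).2.2)
      (Prod.ext (clamp_of_le (hB1 t ht)) (funext fun i => clamp_of_le (hU1 t ht i))))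
  refine ⟨fun t => positivePart (y t), hstart, fun T hT => ⟨fun t ht => hbox t ht.1, ?_⟩⟩
  refine (hpp T).congr hT fun t ht => ?_
  have ht0 := ht₀.trans ht.1
  have hLB := h.lossB_nonneg ht0 (hball t ht.1)
  have hLU := h.lossU_nonneg ht0 (hball t ht.1)
  simp only [hv, hgpos t ht0, htr t ht.1]
  refine Prod.ext rfl (Prod.ext rfl (Prod.ext ?_ (funext fun i => ?_)))
  · exact stopped_eq_projected rfl hLB
  · exact stopped_eq_projected rfl (hLU i)

end Regime

/-! ### The lower bound of `R` and the main theorem. -/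

/-- A lower bound of the effective regularization. -/
lemma Params.le_R {H : Hyper} (hH : H.Valid) {p : Params N} (l : Fin N.L) :
    H.nu * (H.fa * (H.β / H.F) + (1 - H.β) / H.P) ≤ p.R H l := by
  have hθ : ∀ n, 0 ≤ p.θ2Norm n := fun n => by
    unfold Params.θ2Norm
    split_ifs <;> positivity
  have h1 := hθ l
  have h2 := hθ (l + 1)
  have := hH.nu_pos
  have := hH.f1_nonneg
  have := hH.f2_nonneg
  have := hH.p1_nonneg
  have := hH.p2_nonneg
  have hβ : 0 ≤ H.β / H.F := div_nonneg hH.β_mem.1 hH.F_pos.le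
  have hβ' : 0 ≤ (1 - H.β) / H.P := div_nonneg (sub_nonneg.2 hH.β_mem.2) hH.P_pos.le
  unfold Params.R
  refine mul_le_mul_of_nonneg_left (add_le_add ?_ ?_) hH.nu_pos.le
  · rw [mul_comm]
    refine mul_le_mul_of_nonneg_left ?_ hβ
    linarith [mul_nonneg hH.f1_nonneg h1, mul_nonneg hH.f2_nonneg h2]
  · refine le_mul_of_one_le_right hβ' ?_
    linarith [mul_nonneg hH.p1_nonneg h1, mul_nonneg hH.p2_nonneg h2]

lemma Hyper.Valid.regularization_pos {H : Hyper} (hH : H.Valid) :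
    0 < H.nu * (H.fa * (H.β / H.F) + (1 - H.β) / H.P) := by
  have h1 := hH.fa_pos
  have h2 := hH.F_pos
  have h3 := hH.P_pos
  refine mul_pos hH.nu_pos ?_
  rcases hH.β_mem.2.lt_or_eq with hβ | hβ
  · have : 0 ≤ H.fa * (H.β / H.F) := mul_nonneg h1.le (div_nonneg hH.β_mem.1 h2.le)
    have : 0 < (1 - H.β) / H.P := div_pos (by linarith) h3
    linarith
  · rw [hβ]
    simp only [sub_self, zero_div, add_zero]
    positivity

end ResPrune

end

theorem theorem2 (N : ResPrune.Net) (m : ResPrune.Model)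
    (μ : Measure (ResPrune.E (N.d 0) × ResPrune.E (N.d N.L))) [IsProbabilityMeasure μ]
    (H : ResPrune.Hyper) (l : Fin N.L)
    (hH : H.Valid) (hact : N.GoodActivations) (hdata : ResPrune.DataMoments μ) (M : ℝ) :
    -- admissible lower bounds `Rm > 0` of `R` exist, for example the following one
    (0 < H.nu * (H.fa * (H.β / H.F) + (1 - H.β) / H.P) ∧
      ∀ p : ResPrune.Params N, p.BoundedBy M →
        H.nu * (H.fa * (H.β / H.F) + (1 - H.β) / H.P) ≤ p.R H l) ∧
    ∀ Rm : ℝ, 0 < Rm →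
      -- constants `η`, `κ` exist, and depend on the other parameters only through the bound `M`
      (∃ η > 0, ∃ κ > 0, ∀ p : ResPrune.Params N, p.BoundedBy M →
        ResPrune.SensitivityBounds m μ p l (max M (Rm / (4 * (η + κ)))) η κ) ∧
      -- stability, for every evolution `P` of the rest of the network and all such constants
      ∀ P : ℝ → ResPrune.Params N,
        (∀ t, 0 ≤ t → (P t).BoundedBy M) →
        (∀ t, 0 ≤ t → Rm ≤ (P t).R H l) →
        (∀ s ∈ ResPrune.box N l,
          ResPrune.PiecewiseContinuous (fun t => ResPrune.freeField m μ H (P t) s)) →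
        ResPrune.LocallyLipschitzUniformly
          (fun t => ResPrune.freeField m μ H (P t)) (ResPrune.box N l) →
        ∀ η κ : ℝ, 0 < η → 0 < κ →
          (∀ t, 0 ≤ t →
            ResPrune.SensitivityBounds m μ (P t) l (Rm / (4 * (η + κ))) η κ) →
          ResPrune.Invariant (fun t => ResPrune.field m μ H (P t)) (ResPrune.box N l)
            (ResPrune.EB N l Rm η κ) ∧
          ResPrune.Stable (fun t => ResPrune.field m μ H (P t)) (ResPrune.box N l)
            (ResPrune.EB N l Rm η κ) ∧
          ResPrune.AttractedTo (fun t => ResPrune.field m μ H (P t)) (ResPrune.box N l)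
            (ResPrune.DB N l Rm η κ) (ResPrune.EB N l Rm η κ) := by
  obtain ⟨A, hA⟩ := hact.exists_lipschitz
  refine ⟨⟨hH.regularization_pos, fun p _ => ResPrune.Params.le_R hH l⟩,
    fun Rm hRm => ⟨?_, fun P hP hR hpc hlip η κ hη hκ hS => ?_⟩⟩
  · obtain ⟨η, hη, κ, hκ, hS⟩ :=
      ResPrune.exists_sensitivityBounds m μ hA hdata l M (max M 1)
    -- The radius depends on the constants it is to be used for. Enlarging `η` by `Rm / 4` makes it
    -- at most `1`, so constants found for the radius `max M 1` suffice.
    refine ⟨η + Rm / 4, by positivity, κ, hκ, fun p hp => (hS p hp).mono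
      (max_le_max le_rfl ?_) (by linarith) le_rfl⟩
    rw [div_le_one (by positivity)]
    linarith
  · set r := Rm / (4 * (η + κ)) with hr
    have hreg : ResPrune.Regime m μ H l P Rm r η κ :=
      ⟨hH, hη, hκ, by positivity, by rw [hr]; field_simp, hR, hS⟩
    -- Auxiliary constants on a larger ball, needed only to keep solutions from leaving the weight
    -- ball where `D_B` touches its boundary.
    obtain ⟨η', hη', κ', -, hS'⟩ :=
      ResPrune.exists_sensitivityBounds m μ hA hdata l M (r + 1)
    have hS'' := fun t ht => hS' (P t) (hP t ht)
    exact ⟨hreg.invariant_EB hη'.le hS'', hreg.stable_EB, fun t₀ ht₀ s hs =>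
      ⟨hreg.exists_solution hpc hlip ht₀ hs, fun x hx hsol =>
        hreg.tendsto_infDist hη'.le hS'' ht₀ hsol (hx ▸ hs)⟩⟩
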